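/- Let $(M,g)$ be a smooth, Hausdorff, paracompact, time-oriented Lorentzian manifold. Curves are piecewise $C^1$. For $p,q\in M$ write $q\in I^+(p)$, equivalently $p\in I^-(q)$, if there is a future directed timelike curve from $p$ to $q$; for $S\subset M$ put $I^+(S)=\bigcup_{p\in S}I^+(p)$. Let $d(p,q;g)\in[0,\infty]$ be the Lorentzian distance, that is, the supremum of the lengths $\int\sqrt{-g(\gamma',\gamma')}\,dt$ of the future directed timelike curves $\gamma$ from $p$ to $q$ (and $0$ if there are none), and write $d(p,q)=d(p,q;g)$. Let $x,y\in M$ and let $\lambda:[a,b)\to M$ be a past directed, past inextendible timelike curve (i.e. $\lambda(t)$ does not converge in $M$ as $t\to b$) such that $$\lambda\subset I^+(u)\ \text{ for every } u\in I^-(x),\qquad\text{and}\qquad I^+(y)\subset I^+(\lambda).$$ Then: 1. There are a smooth function $\Omega:M\to(0,\infty)$ and points $p,q\in M$ such that $d(p,q;\Omega^2g)=\infty$. 2. If there are $u\in I^-(x)$ and $v\in I^+(y)$ with $d(u,v)<\infty$, or if $d(x,y)=0$, then there is a smooth function $\Omega:M\to(0,\infty)$ such that $d(\cdot,\cdot\,;\Omega^2g):M\times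 M\to[0,\infty]$ is not continuous. (It is not assumed that $y\in I^+(x)$ or that $\lambda$ is incomplete, so the result covers in particular the case $y\in I^+(x)$ with $\lambda$ incomplete.) -/

import Mathlib

open Set Filter Topology MeasureTheory
open scoped Manifold ContDiff ENNReal Bundle

/-- A smooth Lorentzian metric, of signature `(-, +, ..., +)`, on a smooth manifold `M` modelled on
`E`: some tangent vector `v` has `g(v, v) < 0` and `g` is positive definite on its orthogonal
complement. -/
structure LorentzianMetric (E : Type*) [NormedAddCommGroup E] [NormedSpace ℝ E]
    (M : Type*) [TopologicalSpace M] [ChartedSpace E M] [IsManifold 𝓘(ℝ, E) ∞ M] where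
  val (p : M) : TangentSpace 𝓘(ℝ, E) p →L[ℝ] TangentSpace 𝓘(ℝ, E) p →L[ℝ] ℝ
  symm (p : M) (v w : TangentSpace 𝓘(ℝ, E) p) : val p v w = val p w v
  lorentzian (p : M) : ∃ v : TangentSpace 𝓘(ℝ, E) p, val p v v < 0 ∧
    ∀ w : TangentSpace 𝓘(ℝ, E) p, w ≠ 0 → val p v w = 0 → 0 < val p w w
  contMDiff : ContMDiff 𝓘(ℝ, E) (𝓘(ℝ, E).prod 𝓘(ℝ, E →L[ℝ] E →L[ℝ] ℝ)) ∞
    (fun p : M ↦ Bundle.TotalSpace.mk' (E →L[ℝ] E →L[ℝ] ℝ)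
      (E := fun p : M ↦ TangentSpace 𝓘(ℝ, E) p →L[ℝ] TangentSpace 𝓘(ℝ, E) p →L[ℝ] ℝ) p (val p))

/-- A Lorentzian metric together with a time orientation, given by a smooth timelike vector field
(which is the future one). -/
structure TimeOrientedMetric (E : Type*) [NormedAddCommGroup E] [NormedSpace ℝ E]
    (M : Type*) [TopologicalSpace M] [ChartedSpace E M] [IsManifold 𝓘(ℝ, E) ∞ M]
    extends LorentzianMetric E M where
  timeField (p : M) : TangentSpace 𝓘(ℝ, E) p
  contMDiff_timeField : ContMDiff 𝓘(ℝ, E) 𝓘(ℝ, E).tangent ∞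
    (fun p : M ↦ (⟨p, timeField p⟩ : TangentBundle 𝓘(ℝ, E) M))
  timelike_timeField (p : M) : val p (timeField p) (timeField p) < 0

/-- `PiecewiseC1 P γ a b`: `a < b` and `γ` restricted to `[a, b]` is a (continuous) piecewise `C¹`
curve, i.e. a concatenation of finitely many curves that are `C¹` up to the end points of their
parameter intervals, all of whose tangent vectors (one-sided ones at the break points) have the
property `P`. -/
inductive PiecewiseC1 {E : Type*} [NormedAddCommGroup E] [NormedSpace ℝ E]
    {M : Type*} [TopologicalSpace M] [ChartedSpace E M]
    (P : ∀ p : M, TangentSpace 𝓘(ℝ, E) p → Prop) (γ : ℝ → M) : ℝ → ℝ → Prop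
  | single {a b : ℝ} (hab : a < b)
      (hγ : ContMDiffOn 𝓘(ℝ, ℝ) 𝓘(ℝ, E) 1 γ (Icc a b))
      (hP : ∀ t ∈ Icc a b,
        P (γ t) (mfderivWithin 𝓘(ℝ, ℝ) 𝓘(ℝ, E) γ (Icc a b) t (1 : ℝ))) :
      PiecewiseC1 P γ a b
  | append {a b c : ℝ} (hab : PiecewiseC1 P γ a b) (hbc : PiecewiseC1 P γ b c) :
      PiecewiseC1 P γ a c

namespace TimeOrientedMetric

variable {E : Type*} [NormedAddCommGroup E] [NormedSpace ℝ E]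
  {M : Type*} [TopologicalSpace M] [ChartedSpace E M] [IsManifold 𝓘(ℝ, E) ∞ M]

/-- `v` is a future directed timelike vector. -/
def IsFutureTimelike (g : TimeOrientedMetric E M) (p : M) (v : TangentSpace 𝓘(ℝ, E) p) : Prop :=
  g.val p v v < 0 ∧ g.val p (g.timeField p) v < 0

/-- `v` is a past directed timelike vector. -/
def IsPastTimelike (g : TimeOrientedMetric E M) (p : M) (v : TangentSpace 𝓘(ℝ, E) p) : Prop :=
  g.val p v v < 0 ∧ 0 < g.val p (g.timeField p) v

/-- `γ` restricted to `[a, b]` is a future directed piecewise `C¹` timelike curve from `p` to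
`q`. -/
def IsTimelikeCurve (g : TimeOrientedMetric E M) (γ : ℝ → M) (a b : ℝ) (p q : M) : Prop :=
  PiecewiseC1 g.IsFutureTimelike γ a b ∧ γ a = p ∧ γ b = q

/-- The chronological future `I⁺(p)`. -/
def future (g : TimeOrientedMetric E M) (p : M) : Set M :=
  {q | ∃ (γ : ℝ → M) (a b : ℝ), g.IsTimelikeCurve γ a b p q}

/-- The chronological past `I⁻(p)`. -/
def past (g : TimeOrientedMetric E M) (p : M) : Set M :=
  {q | p ∈ g.future q}

/-- The chronological future `I⁺(S)` of a set. -/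
def futureSet (g : TimeOrientedMetric E M) (S : Set M) : Set M :=
  ⋃ p ∈ S, g.future p

/-- The Lorentzian arc length of `γ` restricted to `[a, b]`. -/
noncomputable def length (g : TimeOrientedMetric E M) (γ : ℝ → M) (a b : ℝ) : ℝ≥0∞ :=
  ∫⁻ t in Ioo a b, ENNReal.ofReal (Real.sqrt
    (-g.val (γ t) (mfderiv 𝓘(ℝ, ℝ) 𝓘(ℝ, E) γ t (1 : ℝ))
      (mfderiv 𝓘(ℝ, ℝ) 𝓘(ℝ, E) γ t (1 : ℝ))))

/-- The Lorentzian distance: the supremum of the lengths of the future directed timelike curves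
from `p` to `q`, and `0` if there is none. -/
noncomputable def lorentzianDist (g : TimeOrientedMetric E M) (p q : M) : ℝ≥0∞ :=
  ⨆ (γ : ℝ → M) (a : ℝ) (b : ℝ) (_ : g.IsTimelikeCurve γ a b p q), g.length γ a b

/-- `γ : [a, b) → M` is a past directed piecewise `C¹` timelike curve without past end point. -/
def IsPastInextendible (g : TimeOrientedMetric E M) (γ : ℝ → M) (a b : ℝ) : Prop :=
  a < b ∧ (∀ c, a < c → c < b → PiecewiseC1 g.IsPastTimelike γ a c) ∧
    ¬ ∃ p : M, Tendsto γ (𝓝[<] b) (𝓝 p)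

/-- The metric `Ω² g`, with the same time orientation. -/
noncomputable def conformal (g : TimeOrientedMetric E M) (Ω : M → ℝ)
    (hΩ : ContMDiff 𝓘(ℝ, E) 𝓘(ℝ, ℝ) ∞ Ω) (hpos : ∀ p, 0 < Ω p) : TimeOrientedMetric E M where
  val p := (Ω p ^ 2) • g.val p
  symm p v w := by
    change (Ω p ^ 2) * g.val p v w = (Ω p ^ 2) * g.val p w v
    rw [g.symm]
  lorentzian p := by
    obtain ⟨v, hv, h⟩ := g.lorentzian p
    have h2 : 0 < Ω p ^ 2 := pow_pos (hpos p) 2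
    refine ⟨v, mul_neg_of_pos_of_neg h2 hv, fun w hw hvw ↦ mul_pos h2 (h w hw ?_)⟩
    exact (mul_eq_zero.1 hvw).resolve_left h2.ne'
  contMDiff := (hΩ.pow 2).smul_section g.contMDiff
  timeField := g.timeField
  contMDiff_timeField := g.contMDiff_timeField
  timelike_timeField p :=
    mul_neg_of_pos_of_neg (pow_pos (hpos p) 2) (g.timelike_timeField p)

/-- For some conformally related metric, the Lorentzian distance takes the value `∞`. -/
def IsConformallyInfinite (g : TimeOrientedMetric E M) : Prop :=
  ∃ (Ω : M → ℝ) (hΩ : ContMDiff 𝓘(ℝ, E) 𝓘(ℝ, ℝ) ∞ Ω) (hpos : ∀ p, 0 < Ω p),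
    ∃ p q : M, (g.conformal Ω hΩ hpos).lorentzianDist p q = ⊤

/-- For some conformally related metric, the Lorentzian distance is not a continuous function
`M × M → [0, ∞]`. -/
def IsConformallyDiscontinuous (g : TimeOrientedMetric E M) : Prop :=
  ∃ (Ω : M → ℝ) (hΩ : ContMDiff 𝓘(ℝ, E) 𝓘(ℝ, ℝ) ∞ Ω) (hpos : ∀ p, 0 < Ω p),
    ¬ Continuous (fun z : M × M ↦ (g.conformal Ω hΩ hpos).lorentzianDist z.1 z.2)

end TimeOrientedMetric

/-!
# Infinite and discontinuous Lorentzian distance in a conformal class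

Let `λ` be a past inextendible timelike curve in the future of every `u ∈ I⁻(x)`, such that its
future `F = I⁺(λ)` contains `I⁺(y)`. A point `v ∈ I⁺(y)` is reached from `u` by curves that follow
`λ` as far down as one likes before going to `v`. Infinite distance is obtained by making the arcs
of `λ`, or arcs close to it, long. There are two cases.

**The curve is not contained in a compact set.** Then it meets infinitely many members of a locally
finite cover by relatively compact open sets. A conformal factor `Ω`, equal to `1` off `F` and very
large near suitable short arcs of `λ` in these members, gives them lengths tending to infinity, so
that `d_Ω(u, v) = ∞` whenever `λ ⊆ I⁺(u)` and `v ∈ F` (`IsFutureOn.exists_conformal`). If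
`d(u, v) < ∞`, then `u ∉ F`, as there is no closed timelike curve through `u`; a timelike curve from
`u` to `v` enters `F` at a point `p` at the boundary of `F`, where `d_Ω(u, p) ≤ d(u, v)` is finite,
because `Ω = 1` off `F` (`not_continuous_conformal`). If `d(x, y) = 0`, then also `d_Ω(x, y) = 0`,
whereas `d_Ω = ∞` on `I⁻(x) × I⁺(y)`, whose closure contains `(x, y)` (`not_continuous_of_eq_top`).

**The curve is contained in a compact set.** Then `Ω = 1` will do, even if `λ` is incomplete. Having
no past end point, `λ` can be cut into infinitely many segments, each of a definite size in one of
finitely many charts (`IsFutureOn.exists_segments`), and each of them can be pushed along the time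
field of `g`, by a size that varies along the segment. The length of a segment of `λ` may be very
small, but that of the pushed segment is at least of the order of the size of the push, provided
that this size `h` satisfies the linear equation `h' = q h` under which the push preserves
`g(λ', λ')` to first order, up to an additional growth of order `h²` that compensates for the error
terms (`PushBounds.pushed_timelike`, `PushBounds.exists_pushed_arc`). In terms of `r = 1 / h`, the
push along a segment, including the change to the next chart, takes `r` to `r / e - C`, with a
factor `e` that depends on the segment and is bounded above and below, and it yields a length of
order `1 / |r|` (`ChartBounds.eventually_reaches`, `eventually_push_mem_future_push`,
`exists_uniform_reaches`). It remains to solve a recursion. Let `E n` be the product of the first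
`n` inverse factors `1 / e`. If `∑ E n = ∞`, one pushes to the future, starting with a fixed `r > 0`
at the future end of `λ`; otherwise `E n → 0`, and one pushes to the past, starting with a fixed
`r < 0` far down the curve. In both cases the lengths gained add up to a logarithm that is unbounded
(`exists_recursion_pos`, `eventually_exists_recursion_neg`). So there is a limit point `p` of `λ`
with `d(u, v) = ∞` for all `u ∈ I⁻(p)` and all `v` in the future of a given point of `λ`
(`IsFutureOn.exists_lorentzianDist_eq_top`). As for continuity, if `d(u, v) < ∞` for some
`u ∈ I⁻(x)` and `v ∈ I⁺(y)`, then `u ∉ I⁻(p)` and `d(u, p) = 0`, whereas `d(u, ·)` is bounded below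
by a positive number on `λ`, which accumulates at `p`.
-/

/-! ### The metric and the time field in a chart -/

namespace TimeOrientedMetric

variable {E : Type*} [NormedAddCommGroup E] [NormedSpace ℝ E]
  {M : Type*} [TopologicalSpace M] [ChartedSpace E M] [IsManifold 𝓘(ℝ, E) ∞ M]

/-- The metric `g` read in the chart centred at `x₀`, as a bilinear form on the model space. -/
noncomputable def chartMetric (g : TimeOrientedMetric E M) (x₀ : M) (y : E) : E →L[ℝ] E →L[ℝ] ℝ :=
  let D : E →L[ℝ] E := mfderiv 𝓘(ℝ, E) 𝓘(ℝ, E) (extChartAt 𝓘(ℝ, E) x₀).symm y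
  let B : E →L[ℝ] E →L[ℝ] ℝ := g.val ((extChartAt 𝓘(ℝ, E) x₀).symm y)
  B.bilinearComp D D

/-- The time field of `g` read in the chart centred at `x₀`. -/
noncomputable def chartField (g : TimeOrientedMetric E M) (x₀ : M) (y : E) : E :=
  mfderiv 𝓘(ℝ, E) 𝓘(ℝ, E) (extChartAt 𝓘(ℝ, E) x₀) ((extChartAt 𝓘(ℝ, E) x₀).symm y)
    (g.timeField ((extChartAt 𝓘(ℝ, E) x₀).symm y))

theorem chartMetric_apply (g : TimeOrientedMetric E M) (x₀ : M) (y v w : E) :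
    g.chartMetric x₀ y v w = g.val ((extChartAt 𝓘(ℝ, E) x₀).symm y)
      (mfderiv 𝓘(ℝ, E) 𝓘(ℝ, E) (extChartAt 𝓘(ℝ, E) x₀).symm y v)
      (mfderiv 𝓘(ℝ, E) 𝓘(ℝ, E) (extChartAt 𝓘(ℝ, E) x₀).symm y w) := rfl

theorem chartMetric_symm (g : TimeOrientedMetric E M) (x₀ : M) (y v w : E) :
    g.chartMetric x₀ y v w = g.chartMetric x₀ y w v := by
  rw [chartMetric_apply, chartMetric_apply, g.symm]

variable (x₀ : M)

theorem mfderiv_chart_symm_chart {p : M} (hp : p ∈ (extChartAt 𝓘(ℝ, E) x₀).source)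
    (v : TangentSpace 𝓘(ℝ, E) p) :
    mfderiv 𝓘(ℝ, E) 𝓘(ℝ, E) (extChartAt 𝓘(ℝ, E) x₀).symm (extChartAt 𝓘(ℝ, E) x₀ p)
      (mfderiv 𝓘(ℝ, E) 𝓘(ℝ, E) (extChartAt 𝓘(ℝ, E) x₀) p v) = v := by
  have := mfderivWithin_extChartAt_symm_comp_mfderiv_extChartAt' (I := 𝓘(ℝ, E)) (x := x₀) hp
  rw [ModelWithCorners.range_eq_univ, mfderivWithin_univ] at this
  exact congrArg (fun f => f v) this

theorem mfderiv_chart_chart_symm {y : E} (hy : y ∈ (extChartAt 𝓘(ℝ, E) x₀).target) (v : E) :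
    mfderiv 𝓘(ℝ, E) 𝓘(ℝ, E) (extChartAt 𝓘(ℝ, E) x₀) ((extChartAt 𝓘(ℝ, E) x₀).symm y)
      (mfderiv 𝓘(ℝ, E) 𝓘(ℝ, E) (extChartAt 𝓘(ℝ, E) x₀).symm y v) = v := by
  have := mfderiv_extChartAt_comp_mfderivWithin_extChartAt_symm (I := 𝓘(ℝ, E)) (x := x₀) hy
  rw [ModelWithCorners.range_eq_univ, mfderivWithin_univ] at this
  exact congrArg (fun f => f v) this

theorem mfderiv_chart_symm_chartField (g : TimeOrientedMetric E M) {y : E}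
    (hy : y ∈ (extChartAt 𝓘(ℝ, E) x₀).target) :
    mfderiv 𝓘(ℝ, E) 𝓘(ℝ, E) (extChartAt 𝓘(ℝ, E) x₀).symm y (g.chartField x₀ y) =
      g.timeField ((extChartAt 𝓘(ℝ, E) x₀).symm y) := by
  have h := mfderiv_chart_symm_chart x₀ ((extChartAt 𝓘(ℝ, E) x₀).map_target hy)
    (g.timeField ((extChartAt 𝓘(ℝ, E) x₀).symm y))
  rw [(extChartAt 𝓘(ℝ, E) x₀).right_inv hy] at h
  exact h

omit [IsManifold 𝓘(ℝ, E) ∞ M] in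
theorem isOpen_target : IsOpen (extChartAt 𝓘(ℝ, E) x₀).target := isOpen_extChartAt_target x₀

/-- The metric in a chart is smooth. Smoothness of a bilinear form is tested on pairs of constant
vectors `v`, `w`; these are carried to `M` by the tangent map of the inverse chart, and `g` is
evaluated there as a section of a bundle of bilinear forms. -/
theorem contDiffOn_chartMetric [FiniteDimensional ℝ E] (g : TimeOrientedMetric E M) :
    ContDiffOn ℝ ∞ (g.chartMetric x₀) (extChartAt 𝓘(ℝ, E) x₀).target := by
  have key : ∀ v : E, ContMDiffOn 𝓘(ℝ, E) 𝓘(ℝ, E).tangent ∞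
      (fun y : E ↦ (⟨(extChartAt 𝓘(ℝ, E) x₀).symm y,
        mfderiv 𝓘(ℝ, E) 𝓘(ℝ, E) (extChartAt 𝓘(ℝ, E) x₀).symm y v⟩ : TangentBundle 𝓘(ℝ, E) M))
      (extChartAt 𝓘(ℝ, E) x₀).target := by
    intro v
    have h1 := (contMDiffOn_extChartAt_symm (I := 𝓘(ℝ, E)) (n := ∞) x₀)
    have h2 := h1.contMDiffOn_tangentMapWithin (m := ∞) (by simp)
      (isOpen_target x₀).uniqueMDiffOn
    have h3 : ContMDiff 𝓘(ℝ, E) 𝓘(ℝ, E).tangent ∞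
        (fun y : E ↦ (⟨y, v⟩ : TangentBundle 𝓘(ℝ, E) E)) :=
      contMDiff_vectorSpace_iff_contDiff.2 contDiff_const
    refine (h2.comp h3.contMDiffOn (fun y hy => hy)).congr ?_
    intro y hy
    simp only [Function.comp, tangentMapWithin]
    rw [mfderivWithin_of_isOpen (isOpen_target x₀) hy]
  refine contDiffOn_clm_apply.2 fun v => contDiffOn_clm_apply.2 fun w => ?_
  have h : ContMDiffOn 𝓘(ℝ, E) (𝓘(ℝ, E).prod 𝓘(ℝ)) ∞
      (fun y : E ↦ Bundle.TotalSpace.mk' ℝ (E := Bundle.Trivial M ℝ)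
        ((extChartAt 𝓘(ℝ, E) x₀).symm y)
        (g.val ((extChartAt 𝓘(ℝ, E) x₀).symm y)
          (mfderiv 𝓘(ℝ, E) 𝓘(ℝ, E) (extChartAt 𝓘(ℝ, E) x₀).symm y v)
          (mfderiv 𝓘(ℝ, E) 𝓘(ℝ, E) (extChartAt 𝓘(ℝ, E) x₀).symm y w)))
      (extChartAt 𝓘(ℝ, E) x₀).target := by
    intro y hy
    apply ContMDiffWithinAt.clm_bundle_apply₂ (F₁ := E) (F₂ := E)
    · exact (g.contMDiff.comp_contMDiffOn (contMDiffOn_extChartAt_symm (n := ∞) x₀)) y hy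
    · exact key v y hy
    · exact key w y hy
  refine contMDiffOn_iff_contDiffOn.1 fun y hy => ?_
  have h' := h y hy
  simp only [Bundle.contMDiffWithinAt_totalSpace] at h'
  exact h'.2

theorem contDiffOn_chartField (g : TimeOrientedMetric E M) :
    ContDiffOn ℝ ∞ (g.chartField x₀) (extChartAt 𝓘(ℝ, E) x₀).target := by
  have h1 : ContMDiffOn 𝓘(ℝ, E) 𝓘(ℝ, E) ∞ (extChartAt 𝓘(ℝ, E) x₀)
      (extChartAt 𝓘(ℝ, E) x₀).source := by
    rw [extChartAt_source]
    exact contMDiffOn_extChartAt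
  have hs : IsOpen (extChartAt 𝓘(ℝ, E) x₀).source := isOpen_extChartAt_source x₀
  have h2 := h1.contMDiffOn_tangentMapWithin (m := ∞) (by simp) hs.uniqueMDiffOn
  have h3 := g.contMDiff_timeField.comp_contMDiffOn (contMDiffOn_extChartAt_symm (n := ∞) x₀)
  have h4 := h2.comp h3 (fun y hy => (extChartAt 𝓘(ℝ, E) x₀).map_target hy)
  have h5 := contMDiff_snd_tangentBundle_modelSpace E 𝓘(ℝ, E) (n := ∞) |>.comp_contMDiffOn h4
  refine contMDiffOn_iff_contDiffOn.1 (h5.congr fun y hy => ?_)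
  simp only [Function.comp, tangentMapWithin, chartField]
  rw [mfderivWithin_of_isOpen hs ((extChartAt 𝓘(ℝ, E) x₀).map_target hy)]

end TimeOrientedMetric

/-! ### Timelike curves in a chart -/

namespace TimeOrientedMetric

variable {E : Type*} [NormedAddCommGroup E] [NormedSpace ℝ E]
  {M : Type*} [TopologicalSpace M] [ChartedSpace E M] [IsManifold 𝓘(ℝ, E) ∞ M]

/-- `v` is future directed timelike at the point `y` of the chart centred at `x₀`. -/
def ChartTimelike (g : TimeOrientedMetric E M) (x₀ : M) (y v : E) : Prop :=
  g.chartMetric x₀ y v v < 0 ∧ g.chartMetric x₀ y (g.chartField x₀ y) v < 0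

variable (x₀ : M) (g : TimeOrientedMetric E M)

theorem chartTimelike_iff {y : E} (hy : y ∈ (extChartAt 𝓘(ℝ, E) x₀).target) (v : E) :
    g.ChartTimelike x₀ y v ↔ g.IsFutureTimelike ((extChartAt 𝓘(ℝ, E) x₀).symm y)
      (mfderiv 𝓘(ℝ, E) 𝓘(ℝ, E) (extChartAt 𝓘(ℝ, E) x₀).symm y v) := by
  rw [ChartTimelike, chartMetric_apply, chartMetric_apply, mfderiv_chart_symm_chartField x₀ g hy]
  rfl

theorem mfderivWithin_chart_symm_comp {c : ℝ → E} {s : Set ℝ} {t : ℝ}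
    (hs : UniqueDiffWithinAt ℝ s t)
    (hc : DifferentiableWithinAt ℝ c s t) (ht : c t ∈ (extChartAt 𝓘(ℝ, E) x₀).target) :
    mfderivWithin 𝓘(ℝ, ℝ) 𝓘(ℝ, E) (fun t => (extChartAt 𝓘(ℝ, E) x₀).symm (c t)) s t (1 : ℝ) =
      mfderiv 𝓘(ℝ, E) 𝓘(ℝ, E) (extChartAt 𝓘(ℝ, E) x₀).symm (c t) (derivWithin c s t) := by
  have h1 : MDifferentiableAt 𝓘(ℝ, E) 𝓘(ℝ, E) (extChartAt 𝓘(ℝ, E) x₀).symm (c t) :=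
    (mdifferentiableOn_extChartAt_symm (I := 𝓘(ℝ, E)) _ ht).mdifferentiableAt
      ((isOpen_target x₀).mem_nhds ht)
  have h2 : MDifferentiableWithinAt 𝓘(ℝ, ℝ) 𝓘(ℝ, E) c s t := hc.mdifferentiableWithinAt
  have h3 := mfderiv_comp_mfderivWithin t h1 h2 hs.uniqueMDiffWithinAt
  have h4 := congrArg (fun f => f (1 : ℝ)) h3
  have h5 : mfderivWithin 𝓘(ℝ, ℝ) 𝓘(ℝ, E) c s t (1 : ℝ) = derivWithin c s t := by
    rw [mfderivWithin_eq_fderivWithin]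
    rfl
  exact h4.trans (congrArg (mfderiv 𝓘(ℝ, E) 𝓘(ℝ, E) (extChartAt 𝓘(ℝ, E) x₀).symm (c t)) h5)

theorem piecewiseC1_chart_symm_comp {c : ℝ → E} {a b : ℝ} (hab : a < b)
    (hc : ContDiffOn ℝ 1 c (Icc a b)) (ht : ∀ t ∈ Icc a b, c t ∈ (extChartAt 𝓘(ℝ, E) x₀).target)
    (htl : ∀ t ∈ Icc a b, g.ChartTimelike x₀ (c t) (derivWithin c (Icc a b) t)) :
    PiecewiseC1 g.IsFutureTimelike (fun t => (extChartAt 𝓘(ℝ, E) x₀).symm (c t)) a b := by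
  refine PiecewiseC1.single hab ?_ fun t h => ?_
  · exact ((contMDiffOn_extChartAt_symm (n := ∞) x₀).of_le (by exact_mod_cast le_top)).comp
      hc.contMDiffOn ht
  · rw [mfderivWithin_chart_symm_comp x₀ (uniqueDiffOn_Icc hab t h)
      (hc.differentiableOn one_ne_zero t h) (ht t h)]
    exact (chartTimelike_iff x₀ g (ht t h) _).1 (htl t h)

/-- Arc length is computed by the chart metric. The one-sided derivatives at the end points agree
with the two-sided ones in the interior, which is all that the integral sees. -/
theorem length_chart_symm_comp {c : ℝ → E} {a b : ℝ}
    (hc : ContDiffOn ℝ 1 c (Icc a b)) (ht : ∀ t ∈ Icc a b, c t ∈ (extChartAt 𝓘(ℝ, E) x₀).target) :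
    g.length (fun t => (extChartAt 𝓘(ℝ, E) x₀).symm (c t)) a b =
      ∫⁻ t in Ioo a b, ENNReal.ofReal (Real.sqrt
        (-g.chartMetric x₀ (c t) (derivWithin c (Icc a b) t) (derivWithin c (Icc a b) t))) := by
  refine setLIntegral_congr_fun measurableSet_Ioo fun t h => ?_
  have hn : Icc a b ∈ 𝓝 t := Icc_mem_nhds h.1 h.2
  have h' := Ioo_subset_Icc_self h
  have := mfderivWithin_chart_symm_comp x₀ (uniqueDiffOn_Icc (h.1.trans h.2) t h')
      (hc.differentiableOn one_ne_zero t h') (ht t h')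
  rw [mfderivWithin_of_mem_nhds hn] at this
  simp only [this, chartMetric_apply]
  rfl

theorem chart_comp_contDiffOn {γ : ℝ → M} {s : Set ℝ}
    (hγ : ContMDiffOn 𝓘(ℝ, ℝ) 𝓘(ℝ, E) 1 γ s)
    (hs : ∀ t ∈ s, γ t ∈ (extChartAt 𝓘(ℝ, E) x₀).source) :
    ContDiffOn ℝ 1 (fun t => extChartAt 𝓘(ℝ, E) x₀ (γ t)) s := by
  have h1 : ContMDiffOn 𝓘(ℝ, E) 𝓘(ℝ, E) 1 (extChartAt 𝓘(ℝ, E) x₀)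
      (extChartAt 𝓘(ℝ, E) x₀).source := by
    rw [extChartAt_source]
    exact (contMDiffOn_extChartAt (n := ∞)).of_le (by exact_mod_cast le_top)
  exact contMDiffOn_iff_contDiffOn.1 (h1.comp hγ hs)

theorem chartTimelike_chart_comp {γ : ℝ → M} {a b : ℝ} (hab : a < b)
    (hγ : ContMDiffOn 𝓘(ℝ, ℝ) 𝓘(ℝ, E) 1 γ (Icc a b))
    (hs : ∀ t ∈ Icc a b, γ t ∈ (extChartAt 𝓘(ℝ, E) x₀).source)
    (hP : ∀ t ∈ Icc a b,
        g.IsFutureTimelike (γ t) (mfderivWithin 𝓘(ℝ, ℝ) 𝓘(ℝ, E) γ (Icc a b) t (1 : ℝ)))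
    {t : ℝ} (h : t ∈ Icc a b) :
    g.ChartTimelike x₀ (extChartAt 𝓘(ℝ, E) x₀ (γ t))
      (derivWithin (fun t => extChartAt 𝓘(ℝ, E) x₀ (γ t)) (Icc a b) t) := by
  have hc := chart_comp_contDiffOn x₀ hγ hs
  have ht := (extChartAt 𝓘(ℝ, E) x₀).map_source (hs t h)
  have h0 := mfderivWithin_chart_symm_comp x₀ (uniqueDiffOn_Icc hab t h)
    (hc.differentiableOn one_ne_zero t h) ht
  rw [chartTimelike_iff x₀ g ht]
  have h1 : mfderivWithin 𝓘(ℝ, ℝ) 𝓘(ℝ, E)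
      (fun t => (extChartAt 𝓘(ℝ, E) x₀).symm (extChartAt 𝓘(ℝ, E) x₀ (γ t))) (Icc a b) t =
      mfderivWithin 𝓘(ℝ, ℝ) 𝓘(ℝ, E) γ (Icc a b) t :=
    mfderivWithin_congr (fun s hs' => (extChartAt 𝓘(ℝ, E) x₀).left_inv (hs s hs'))
      ((extChartAt 𝓘(ℝ, E) x₀).left_inv (hs t h))
  have h2 := hP t h
  -- tangent spaces at equal points are different types, so the equality `p = q` is eliminated on
  -- variables instead of being rewritten
  have h3 : ∀ (p q : M) (v : E) (w : E), p = q → v = w →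
      g.IsFutureTimelike p v → g.IsFutureTimelike q w := by
    rintro p q v w rfl rfl h; exact h
  exact h3 _ _ _ _ ((extChartAt 𝓘(ℝ, E) x₀).left_inv (hs t h)).symm
    ((congrArg (fun f : ℝ →L[ℝ] E => f 1) h1).symm.trans h0) h2

end TimeOrientedMetric

/-! ### Piecewise `C¹` curves -/

namespace PiecewiseC1

variable {E : Type*} [NormedAddCommGroup E] [NormedSpace ℝ E]
  {M : Type*} [TopologicalSpace M] [ChartedSpace E M]
  {P : ∀ p : M, TangentSpace 𝓘(ℝ, E) p → Prop} {γ γ' : ℝ → M} {a b c d : ℝ}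

theorem lt (h : PiecewiseC1 P γ a b) : a < b := by
  induction h with
  | single hab _ _ => exact hab
  | append _ _ h1 h2 => exact h1.trans h2

theorem continuousOn (h : PiecewiseC1 P γ a b) : ContinuousOn γ (Icc a b) := by
  induction h with
  | single _ hγ _ => exact hγ.continuousOn
  | append h1 h2 i1 i2 =>
    rw [← Icc_union_Icc_eq_Icc h1.lt.le h2.lt.le]
    exact i1.union_of_isClosed i2 isClosed_Icc isClosed_Icc

/-- `γ` is `C¹` on `[a, b]`, `a < b`, with all tangent vectors satisfying `P`. -/
def IsC1Arc (P : ∀ p : M, TangentSpace 𝓘(ℝ, E) p → Prop) (γ : ℝ → M) (a b : ℝ) : Prop :=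
  a < b ∧ ContMDiffOn 𝓘(ℝ, ℝ) 𝓘(ℝ, E) 1 γ (Icc a b) ∧
    ∀ t ∈ Icc a b, P (γ t) (mfderivWithin 𝓘(ℝ, ℝ) 𝓘(ℝ, E) γ (Icc a b) t (1 : ℝ))

theorem IsC1Arc.piecewiseC1 (h : IsC1Arc P γ a b) : PiecewiseC1 P γ a b := .single h.1 h.2.1 h.2.2

theorem IsC1Arc.mono_congr (h : IsC1Arc P γ a b) (e : ∀ t ∈ Icc c d, γ' t = γ t) (hcd : c < d)
    (hsub : Icc c d ⊆ Icc a b) : IsC1Arc P γ' c d := by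
  refine ⟨hcd, (h.2.1.mono hsub).congr e, fun t ht => ?_⟩
  have h1 : mfderivWithin 𝓘(ℝ, ℝ) 𝓘(ℝ, E) γ' (Icc c d) t =
      mfderivWithin 𝓘(ℝ, ℝ) 𝓘(ℝ, E) γ (Icc c d) t := mfderivWithin_congr e (e t ht)
  have h2 : mfderivWithin 𝓘(ℝ, ℝ) 𝓘(ℝ, E) γ (Icc c d) t =
      mfderivWithin 𝓘(ℝ, ℝ) 𝓘(ℝ, E) γ (Icc a b) t :=
    ((h.2.1.mdifferentiableOn one_ne_zero) t (hsub ht)).mfderivWithin_mono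
      (uniqueDiffOn_Icc hcd t ht).uniqueMDiffWithinAt hsub
  -- transport along `p = q`, on which the type of the tangent vector depends
  have h3 : ∀ (p q : M) (v w : E), p = q → v = w → P p v → P q w := by
    rintro p q v w rfl rfl h; exact h
  exact h3 _ _ _ _ (e t ht).symm (congrArg (fun f : ℝ →L[ℝ] E => f 1) (h1.trans h2)).symm
    (h.2.2 t (hsub ht))

theorem IsC1Arc.mono (h : IsC1Arc P γ a b) (hac : a ≤ c) (hcd : c < d) (hdb : d ≤ b) :
    IsC1Arc P γ c d :=
  h.mono_congr (fun _ _ => rfl) hcd (Icc_subset_Icc hac hdb)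

theorem congr (h : PiecewiseC1 P γ a b) (e : ∀ t ∈ Icc a b, γ' t = γ t) :
    PiecewiseC1 P γ' a b := by
  induction h with
  | single hab hγ hP => exact (IsC1Arc.mono_congr ⟨hab, hγ, hP⟩ e hab subset_rfl).piecewiseC1
  | append h1 h2 i1 i2 =>
    exact .append (i1 fun t ht => e t ⟨ht.1, ht.2.trans h2.lt.le⟩)
      (i2 fun t ht => e t ⟨h1.lt.le.trans ht.1, ht.2⟩)

theorem restrict (h : PiecewiseC1 P γ a b) (hac : a ≤ c) (hcd : c < d) (hdb : d ≤ b) :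
    PiecewiseC1 P γ c d := by
  induction h generalizing c d with
  | single hab hγ hP =>
    exact (IsC1Arc.mono ⟨hab, hγ, hP⟩ hac hcd hdb).piecewiseC1
  | @append a m b h1 h2 i1 i2 =>
    rcases le_or_gt d m with h | h
    · exact i1 hac hcd h
    rcases le_or_gt m c with h' | h'
    · exact i2 h' hcd hdb
    · exact .append (i1 hac h' le_rfl) (i2 le_rfl h hdb)

/-- A piecewise `C¹` curve ends with a `C¹` arc contained in a given neighbourhood of its end point.
-/
theorem exists_last (h : PiecewiseC1 P γ a b) {U : Set M} (hU : U ∈ 𝓝 (γ b)) :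
    ∃ α, a < α ∧ IsC1Arc P γ α b ∧ ∀ t ∈ Icc α b, γ t ∈ U := by
  induction h with
  | @single a b hab hγ hP =>
    have hc : ContinuousWithinAt γ (Icc a b) b := hγ.continuousOn b ⟨hab.le, le_rfl⟩
    have h1 : ∀ᶠ t in 𝓝[≤] b, γ t ∈ U := by
      rw [← nhdsWithin_Icc_eq_nhdsLE hab]; exact hc hU
    obtain ⟨l, hl, hl'⟩ := (mem_nhdsLE_iff_exists_Ioc_subset' hab).1 h1
    have h2 := le_max_left l a
    have h3 := le_max_right l a
    have h4 : max l a < b := max_lt hl hab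
    refine ⟨(max l a + b) / 2, by linarith,
      IsC1Arc.mono ⟨hab, hγ, hP⟩ (by linarith) (by linarith) le_rfl,
      fun t ht => hl' ⟨by linarith [ht.1], ht.2⟩⟩
  | append h1 h2 i1 i2 =>
    obtain ⟨α, h3, h4⟩ := i2 hU
    exact ⟨α, h1.lt.trans h3, h4⟩

/-- A piecewise `C¹` curve starts with a `C¹` arc contained in a given neighbourhood of its starting
point. -/
theorem exists_first (h : PiecewiseC1 P γ a b) {U : Set M} (hU : U ∈ 𝓝 (γ a)) :
    ∃ β, β < b ∧ IsC1Arc P γ a β ∧ ∀ t ∈ Icc a β, γ t ∈ U := by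
  induction h with
  | @single a b hab hγ hP =>
    have hc : ContinuousWithinAt γ (Icc a b) a := hγ.continuousOn a ⟨le_rfl, hab.le⟩
    have h1 : ∀ᶠ t in 𝓝[≥] a, γ t ∈ U := by
      rw [← nhdsWithin_Icc_eq_nhdsGE hab]; exact hc hU
    obtain ⟨l, hl, hl'⟩ := (mem_nhdsGE_iff_exists_Ico_subset' hab).1 h1
    have h2 := min_le_left l b
    have h3 := min_le_right l b
    have h4 : a < min l b := lt_min hl hab
    refine ⟨(min l b + a) / 2, by linarith,
      IsC1Arc.mono ⟨hab, hγ, hP⟩ le_rfl (by linarith) (by linarith),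
      fun t ht => hl' ⟨ht.1, by linarith [ht.2]⟩⟩
  | append h1 h2 i1 i2 =>
    obtain ⟨β, h3, h4⟩ := i1 hU
    exact ⟨β, h3.trans h2.lt, h4⟩

/-- An affine reparametrization `t ↦ σ * t + τ` of a `C¹` curve multiplies its tangent vectors by
`σ`. Translations are the case `σ = 1`, and reversal of the orientation is the case `σ = -1`. -/
theorem comp_affine {Q : ∀ p : M, TangentSpace 𝓘(ℝ, E) p → Prop} (σ τ : ℝ)
    (hcd : c < d) (hm : ∀ t ∈ Icc c d, σ * t + τ ∈ Icc a b)
    (hγ : ContMDiffOn 𝓘(ℝ, ℝ) 𝓘(ℝ, E) 1 γ (Icc a b))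
    (hP : ∀ t ∈ Icc a b, P (γ t) (mfderivWithin 𝓘(ℝ, ℝ) 𝓘(ℝ, E) γ (Icc a b) t (1 : ℝ)))
    (hPQ : ∀ p v, P p v → Q p (σ • v)) :
    PiecewiseC1 Q (fun t => γ (σ * t + τ)) c d := by
  have hd : ∀ t, HasDerivAt (fun t : ℝ => σ * t + τ) σ t := fun t => by
    simpa using ((hasDerivAt_id t).const_mul σ).add_const τ
  refine .single hcd ?_ fun t ht => ?_
  · refine hγ.comp (ContDiff.contMDiff ?_).contMDiffOn hm
    fun_prop
  · have h1 := (hγ.mdifferentiableOn one_ne_zero) _ (hm t ht)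
    have h2 : MDifferentiableWithinAt 𝓘(ℝ, ℝ) 𝓘(ℝ, ℝ) (fun t : ℝ => σ * t + τ) (Icc c d) t :=
      (hd t).differentiableAt.differentiableWithinAt.mdifferentiableWithinAt
    have hu := (uniqueDiffOn_Icc hcd t ht).uniqueMDiffWithinAt
    have h3 := mfderivWithin_comp (u := Icc a b) t h1 h2 (fun s hs => hm s hs) hu
    have h4 : mfderivWithin 𝓘(ℝ, ℝ) 𝓘(ℝ, ℝ) (fun t : ℝ => σ * t + τ) (Icc c d) t (1 : ℝ) = σ := by
      rw [mfderivWithin_eq_fderivWithin]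
      exact (fderivWithin_derivWithin (𝕜 := ℝ)).trans
        ((hd t).hasDerivWithinAt.derivWithin (uniqueDiffOn_Icc hcd t ht))
    have h5 : mfderivWithin 𝓘(ℝ, ℝ) 𝓘(ℝ, E) (fun t => γ (σ * t + τ)) (Icc c d) t (1 : ℝ) =
        (σ • mfderivWithin 𝓘(ℝ, ℝ) 𝓘(ℝ, E) γ (Icc a b) (σ * t + τ) (1 : ℝ) : E) := by
      refine (congrArg (fun f : ℝ →L[ℝ] E => f 1) h3).trans ?_
      refine (congrArg (mfderivWithin 𝓘(ℝ, ℝ) 𝓘(ℝ, E) γ (Icc a b) (σ * t + τ)) h4).trans ?_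
      have := (mfderivWithin 𝓘(ℝ, ℝ) 𝓘(ℝ, E) γ (Icc a b) (σ * t + τ)).map_smul σ (1 : ℝ)
      refine Eq.trans ?_ this
      exact congrArg _ (mul_one σ).symm
    rw [h5]
    exact hPQ _ _ (hP _ (hm t ht))

theorem translate (h : PiecewiseC1 P γ a b) (τ : ℝ) :
    PiecewiseC1 P (fun t => γ (t + τ)) (a - τ) (b - τ) := by
  induction h with
  | @single a b hab hγ hP =>
    have := comp_affine (Q := P) 1 τ (c := a - τ) (d := b - τ) (by linarith)
      (fun t ht => ⟨by linarith [ht.1], by linarith [ht.2]⟩) hγ hP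
      (fun p v h => by rwa [one_smul])
    simpa using this
  | append _ _ i1 i2 => exact .append i1 i2

theorem reverse (h : PiecewiseC1 P γ a b) :
    PiecewiseC1 (fun p v => P p (-v)) (fun t => γ (-t)) (-b) (-a) := by
  induction h with
  | @single a b hab hγ hP =>
    have := comp_affine (Q := fun p v => P p (-v)) (-1) 0 (c := -b) (d := -a)
      (by linarith)
      (fun t ht => ⟨by linarith [ht.2], by linarith [ht.1]⟩) hγ hP
      (fun p v h => by simpa using h)
    simpa using this
  | append _ _ i1 i2 => exact .append i2 i1

/-- The concatenation of two curves, the second one being reparametrized by a translation. -/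
noncomputable def glue (γ γ' : ℝ → M) (b c : ℝ) (t : ℝ) : M :=
  if t ≤ b then γ t else γ' (t - b + c)

omit [TopologicalSpace M] in
theorem glue_of_le {t : ℝ} (h : t ≤ b) : glue γ γ' b c t = γ t := if_pos h

omit [TopologicalSpace M] in
theorem glue_of_ge (e : γ b = γ' c) {t : ℝ} (h : b ≤ t) :
    glue γ γ' b c t = γ' (t + (c - b)) := by
  rcases h.eq_or_lt with rfl | h
  · rw [glue_of_le le_rfl, e]; congr 1; ring
  · rw [glue, if_neg h.not_ge]; congr 1; ring

theorem glue_piecewise (h : PiecewiseC1 P γ a b) (h' : PiecewiseC1 P γ' c d) (e : γ b = γ' c) :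
    PiecewiseC1 P (glue γ γ' b c) a (b + (d - c)) := by
  refine .append (h.congr fun t ht => glue_of_le ht.2) ?_
  have := h'.translate (c - b)
  rw [show c - (c - b) = b by ring, show d - (c - b) = b + (d - c) by ring] at this
  exact this.congr fun t ht => glue_of_ge e ht.1

end PiecewiseC1

/-! ### The reverse triangle inequality -/

namespace TimeOrientedMetric

variable {E : Type*} [NormedAddCommGroup E] [NormedSpace ℝ E]
  {M : Type*} [TopologicalSpace M] [ChartedSpace E M] [IsManifold 𝓘(ℝ, E) ∞ M]
  (g : TimeOrientedMetric E M)

theorem length_congr {γ γ' : ℝ → M} {a b : ℝ} (e : ∀ t ∈ Ioo a b, γ' t = γ t) :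
    g.length γ' a b = g.length γ a b := by
  refine setLIntegral_congr_fun measurableSet_Ioo fun t ht => ?_
  have he : γ' =ᶠ[𝓝 t] γ := by
    filter_upwards [Ioo_mem_nhds ht.1 ht.2] with s hs using e s hs
  have h1 : mfderiv 𝓘(ℝ, ℝ) 𝓘(ℝ, E) γ' t = mfderiv 𝓘(ℝ, ℝ) 𝓘(ℝ, E) γ t := he.mfderiv_eq
  have h3 : ∀ (p q : M) (v w : E), p = q → v = w →
      ENNReal.ofReal (Real.sqrt (-g.val p v v)) = ENNReal.ofReal (Real.sqrt (-g.val q w w)) := by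
    rintro p q v w rfl rfl; rfl
  exact h3 _ _ _ _ (e t ht) (congrArg (fun f : ℝ →L[ℝ] E => f 1) h1)

theorem length_translate (γ : ℝ → M) (a b τ : ℝ) :
    g.length (fun t => γ (t + τ)) (a - τ) (b - τ) = g.length γ a b := by
  have h1 : ∀ t, mfderiv 𝓘(ℝ, ℝ) 𝓘(ℝ, E) (fun t => γ (t + τ)) t (1 : ℝ) =
      (mfderiv 𝓘(ℝ, ℝ) 𝓘(ℝ, E) γ (t + τ) (1 : ℝ) : E) := by
    intro t
    have hd : ∀ s σ : ℝ, HasDerivAt (fun t : ℝ => t + σ) 1 s := fun s σ => by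
      simpa using (hasDerivAt_id s).add_const σ
    have hm : ∀ s σ : ℝ, MDifferentiableAt 𝓘(ℝ, ℝ) 𝓘(ℝ, ℝ) (fun t : ℝ => t + σ) s :=
      fun s σ => (hd s σ).differentiableAt.mdifferentiableAt
    -- where `γ` is not differentiable, both sides are the junk value `0`
    by_cases h : MDifferentiableAt 𝓘(ℝ, ℝ) 𝓘(ℝ, E) γ (t + τ)
    · have h3 := mfderiv_comp t h (hm t τ)
      have h4 : mfderiv 𝓘(ℝ, ℝ) 𝓘(ℝ, ℝ) (fun t : ℝ => t + τ) t (1 : ℝ) = (1 : ℝ) := by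
        rw [mfderiv_eq_fderiv]
        exact fderiv_apply_one_eq_deriv.trans (hd t τ).deriv
      refine (congrArg (fun f : ℝ →L[ℝ] E => f 1) h3).trans ?_
      exact congrArg (mfderiv 𝓘(ℝ, ℝ) 𝓘(ℝ, E) γ (t + τ)) h4
    · have h' : ¬ MDifferentiableAt 𝓘(ℝ, ℝ) 𝓘(ℝ, E) (fun t => γ (t + τ)) t := by
        intro h'
        have h1 : MDifferentiableAt 𝓘(ℝ, ℝ) 𝓘(ℝ, E) (fun t => γ (t + τ)) (t + τ + -τ) := by
          simpa using h'
        have h2 := h1.comp (t + τ) (hm (t + τ) (-τ))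
        simp only [Function.comp_def, neg_add_cancel_right] at h2
        exact h h2
      rw [mfderiv_zero_of_not_mdifferentiableAt h, mfderiv_zero_of_not_mdifferentiableAt h']
      rfl
  have h2 := (measurePreserving_add_right volume τ).setLIntegral_comp_preimage_emb
    (measurableEmbedding_addRight τ) (fun t => ENNReal.ofReal (Real.sqrt
    (-g.val (γ t) (mfderiv 𝓘(ℝ, ℝ) 𝓘(ℝ, E) γ t (1 : ℝ))
      (mfderiv 𝓘(ℝ, ℝ) 𝓘(ℝ, E) γ t (1 : ℝ))))) (Ioo a b)
  rw [length, length, ← h2]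
  simp only [preimage_add_const_Ioo]
  refine setLIntegral_congr_fun measurableSet_Ioo fun t _ => ?_
  have h3 : ∀ (p : M) (v w : E), v = w →
      ENNReal.ofReal (Real.sqrt (-g.val p v v)) = ENNReal.ofReal (Real.sqrt (-g.val p w w)) := by
    rintro p v w rfl; rfl
  exact h3 _ _ _ (h1 t)

theorem length_add (γ : ℝ → M) {a b c : ℝ} (hab : a < b) (hbc : b < c) :
    g.length γ a c = g.length γ a b + g.length γ b c := by
  have h : Ioo a c = (Ioo a b ∪ Ioo b c) ∪ {b} := by
    ext t; simp only [mem_Ioo, mem_union, mem_singleton_iff]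
    constructor
    · rintro ⟨h1, h2⟩
      rcases lt_trichotomy t b with h | h | h
      · exact .inl (.inl ⟨h1, h⟩)
      · exact .inr h
      · exact .inl (.inr ⟨h, h2⟩)
    · rintro ((⟨h1, h2⟩ | ⟨h1, h2⟩) | rfl) <;> constructor <;> linarith
  have h2 : (Ioo a c : Set ℝ) =ᵐ[volume] (Ioo a b ∪ Ioo b c : Set ℝ) := by
    rw [h]
    exact union_ae_eq_left_of_ae_eq_empty (by simp [ae_eq_empty])
  rw [length, setLIntegral_congr h2, lintegral_union measurableSet_Ioo]
  · rfl
  · exact Set.disjoint_left.2 fun t h1 h2 => by linarith [h1.2, h2.1]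

theorem le_lorentzianDist {γ : ℝ → M} {a b : ℝ} {p q : M} (h : g.IsTimelikeCurve γ a b p q) :
    g.length γ a b ≤ g.lorentzianDist p q :=
  le_iSup_of_le γ <| le_iSup_of_le a <| le_iSup_of_le b <| le_iSup_of_le h le_rfl

theorem isTimelikeCurve_glue {γ γ' : ℝ → M} {a b c d : ℝ} {p q r : M}
    (h : g.IsTimelikeCurve γ a b p q) (h' : g.IsTimelikeCurve γ' c d q r) :
    g.IsTimelikeCurve (PiecewiseC1.glue γ γ' b c) a (b + (d - c)) p r := by
  have e : γ b = γ' c := h.2.2.trans h'.2.1.symm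
  refine ⟨h.1.glue_piecewise h'.1 e, ?_, ?_⟩
  · rw [PiecewiseC1.glue_of_le h.1.lt.le, h.2.1]
  · rw [PiecewiseC1.glue_of_ge e (by linarith [h'.1.lt]), ← h'.2.2]; congr 1; ring

theorem length_glue {γ γ' : ℝ → M} {a b c d : ℝ} {p q r : M}
    (h : g.IsTimelikeCurve γ a b p q) (h' : g.IsTimelikeCurve γ' c d q r) :
    g.length (PiecewiseC1.glue γ γ' b c) a (b + (d - c)) = g.length γ a b + g.length γ' c d := by
  have e : γ b = γ' c := h.2.2.trans h'.2.1.symm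
  rw [g.length_add _ h.1.lt (by linarith [h'.1.lt])]
  congr 1
  · exact g.length_congr fun t ht => PiecewiseC1.glue_of_le ht.2.le
  · rw [← g.length_translate γ' c d (c - b), show c - (c - b) = b by ring,
      show d - (c - b) = b + (d - c) by ring]
    exact g.length_congr fun t ht => PiecewiseC1.glue_of_ge e ht.1.le

theorem future_trans {p q r : M} (h : q ∈ g.future p) (h' : r ∈ g.future q) : r ∈ g.future p := by
  obtain ⟨γ, a, b, h⟩ := h
  obtain ⟨γ', c, d, h'⟩ := h'
  exact ⟨_, _, _, g.isTimelikeCurve_glue h h'⟩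

/-- The reverse triangle inequality, by concatenation of curves. The suprema are taken one after the
other, by moving the other summand to the right-hand side, where it is finite. -/
theorem lorentzianDist_add_le {p q r : M} (h : q ∈ g.future p) (h' : r ∈ g.future q) :
    g.lorentzianDist p q + g.lorentzianDist q r ≤ g.lorentzianDist p r := by
  obtain ⟨γ, a, b, h⟩ := h
  obtain ⟨γ', c, d, h'⟩ := h'
  have key : ∀ (γ : ℝ → M) (a b : ℝ), g.IsTimelikeCurve γ a b p q → ∀ (γ' : ℝ → M) (c d : ℝ),
      g.IsTimelikeCurve γ' c d q r → g.length γ a b + g.length γ' c d ≤ g.lorentzianDist p r := by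
    intro γ a b h γ' c d h'
    rw [← g.length_glue h h']
    exact g.le_lorentzianDist (g.isTimelikeCurve_glue h h')
  by_cases htop : g.lorentzianDist p r = ⊤
  · rw [htop]; exact le_top
  have h1 : ∀ (γ : ℝ → M) (a b : ℝ), g.IsTimelikeCurve γ a b p q →
      g.length γ a b + g.lorentzianDist q r ≤ g.lorentzianDist p r := by
    intro γ a b h
    have hle : g.length γ a b ≤ g.lorentzianDist p r := le_self_add.trans (key γ a b h _ _ _ h')
    have h2 : g.lorentzianDist q r ≤ g.lorentzianDist p r - g.length γ a b :=
      iSup_le fun γ' => iSup_le fun c => iSup_le fun d => iSup_le fun h'' =>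
        ENNReal.le_sub_of_add_le_left (ne_top_of_le_ne_top htop hle) (key γ a b h γ' c d h'')
    exact (add_le_add_right h2 _).trans (add_tsub_cancel_of_le hle).le
  have hle : g.lorentzianDist q r ≤ g.lorentzianDist p r := le_add_self.trans (h1 γ a b h)
  have h2 : g.lorentzianDist p q ≤ g.lorentzianDist p r - g.lorentzianDist q r :=
    iSup_le fun γ' => iSup_le fun c => iSup_le fun d => iSup_le fun h'' =>
      ENNReal.le_sub_of_add_le_right (ne_top_of_le_ne_top htop hle) (h1 γ' c d h'')
  exact (add_le_add_left h2 _).trans (tsub_add_cancel_of_le hle).le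

theorem lorentzianDist_eq_zero_of_notMem {p q : M} (h : q ∉ g.future p) :
    g.lorentzianDist p q = 0 := by
  simp only [lorentzianDist, ENNReal.iSup_eq_zero]
  intro γ a b h'
  exact absurd ⟨γ, a, b, h'⟩ h

end TimeOrientedMetric

/-! ### Chronological futures are open -/

namespace TimeOrientedMetric

variable {E : Type*} [NormedAddCommGroup E] [NormedSpace ℝ E]
  {M : Type*} [TopologicalSpace M] [ChartedSpace E M] [IsManifold 𝓘(ℝ, E) ∞ M]
  (g : TimeOrientedMetric E M) (x₀ : M)

theorem chartTimelike_chartField {y : E} (hy : y ∈ (extChartAt 𝓘(ℝ, E) x₀).target) :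
    g.ChartTimelike x₀ y (g.chartField x₀ y) := by
  rw [chartTimelike_iff x₀ g hy, mfderiv_chart_symm_chartField x₀ g hy]
  exact ⟨g.timelike_timeField _, g.timelike_timeField _⟩

theorem mem_future_of_chart_curve {c : ℝ → E} {a b : ℝ} (hab : a < b)
    (hc : ContDiffOn ℝ 1 c (Icc a b)) (ht : ∀ t ∈ Icc a b, c t ∈ (extChartAt 𝓘(ℝ, E) x₀).target)
    (htl : ∀ t ∈ Icc a b, g.ChartTimelike x₀ (c t) (derivWithin c (Icc a b) t)) :
    (extChartAt 𝓘(ℝ, E) x₀).symm (c b) ∈ g.future ((extChartAt 𝓘(ℝ, E) x₀).symm (c a)) :=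
  ⟨_, a, b, piecewiseC1_chart_symm_comp x₀ g hab hc ht htl, rfl, rfl⟩

/-- A straight segment of a chart is a timelike curve if its direction is future directed timelike
at all of its points. -/
theorem mem_future_of_segment {y w : E}
    (h : ∀ s ∈ Icc (0 : ℝ) 1, y + s • w ∈ (extChartAt 𝓘(ℝ, E) x₀).target ∧
      g.ChartTimelike x₀ (y + s • w) w) :
    (extChartAt 𝓘(ℝ, E) x₀).symm (y + w) ∈ g.future ((extChartAt 𝓘(ℝ, E) x₀).symm y) := by
  have hd : ∀ t, HasDerivAt (fun s : ℝ => y + s • w) w t := fun t => by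
    simpa using ((hasDerivAt_id t).smul_const w).const_add y
  have := mem_future_of_chart_curve g x₀ (c := fun s : ℝ => y + s • w) (a := 0) (b := 1)
    one_pos (by fun_prop) (fun t ht => (h t ht).1) (fun t ht => by
      rw [(hd t).hasDerivWithinAt.derivWithin (uniqueDiffOn_Icc one_pos t ht)]
      exact (h t ht).2)
  simpa using this

variable [FiniteDimensional ℝ E]

/-- Being future directed timelike is an open condition on the base point and the vector. -/
theorem eventually_chartTimelike {y v : E} (hy : y ∈ (extChartAt 𝓘(ℝ, E) x₀).target)
    (hv : g.ChartTimelike x₀ y v) :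
    ∀ᶠ z : E × E in 𝓝 (y, v), z.1 ∈ (extChartAt 𝓘(ℝ, E) x₀).target ∧
      g.ChartTimelike x₀ z.1 z.2 := by
  have hn := (isOpen_target x₀).mem_nhds hy
  have h1 : ContinuousAt (g.chartMetric x₀) y :=
    ((contDiffOn_chartMetric x₀ g).continuousOn).continuousAt hn
  have h2 : ContinuousAt (g.chartField x₀) y :=
    ((contDiffOn_chartField x₀ g).continuousOn).continuousAt hn
  have hf : ContinuousAt (Prod.fst : E × E → E) (y, v) := continuousAt_fst
  have hs : ContinuousAt (Prod.snd : E × E → E) (y, v) := continuousAt_snd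
  have h1' : ContinuousAt (fun z : E × E => g.chartMetric x₀ z.1) (y, v) :=
    ContinuousAt.comp (f := Prod.fst) (x := (y, v)) h1 hf
  have h2' : ContinuousAt (fun z : E × E => g.chartField x₀ z.1) (y, v) :=
    ContinuousAt.comp (f := Prod.fst) (x := (y, v)) h2 hf
  have h3 : ContinuousAt (fun z : E × E => g.chartMetric x₀ z.1 z.2 z.2) (y, v) :=
    (h1'.clm_apply hs).clm_apply hs
  have h4 : ContinuousAt (fun z : E × E => g.chartMetric x₀ z.1 (g.chartField x₀ z.1) z.2) (y, v) :=
    (h1'.clm_apply h2').clm_apply hs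
  filter_upwards [h3.eventually_lt_const hv.1, h4.eventually_lt_const hv.2, hf.eventually hn]
    with z h5 h6 h7 using ⟨h7, h5, h6⟩

/-- The end points of a timelike `C¹` curve in a chart can be displaced by small vectors `w.1` and
`w.2`: the curve stays timelike when the linear interpolation of the displacements is added to it,
since its tangent vectors form a compact set. -/
theorem eventually_mem_future_of_chart_curve {c : ℝ → E} {a b : ℝ} (hab : a < b)
    (hc : ContDiffOn ℝ 1 c (Icc a b)) (ht : ∀ t ∈ Icc a b, c t ∈ (extChartAt 𝓘(ℝ, E) x₀).target)
    (htl : ∀ t ∈ Icc a b, g.ChartTimelike x₀ (c t) (derivWithin c (Icc a b) t)) :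
    ∀ᶠ w : E × E in 𝓝 0, (extChartAt 𝓘(ℝ, E) x₀).symm (c b + w.2) ∈
      g.future ((extChartAt 𝓘(ℝ, E) x₀).symm (c a + w.1)) := by
  have hK : IsCompact (((fun t => (c t, derivWithin c (Icc a b) t)) '' Icc a b) ×ˢ Icc (0 : ℝ) 1) :=
    (isCompact_Icc.image_of_continuousOn (hc.continuousOn.prodMk
      (hc.continuousOn_derivWithin (uniqueDiffOn_Icc hab) le_rfl))).prod isCompact_Icc
  have hba : 0 < b - a := sub_pos.2 hab
  have key := hK.eventually_forall_of_forall_eventually (x₀ := (0 : E × E))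
    (P := fun w z => (z.1.1 + ((1 - z.2) • w.1 + z.2 • w.2)) ∈ (extChartAt 𝓘(ℝ, E) x₀).target ∧
      g.ChartTimelike x₀ (z.1.1 + ((1 - z.2) • w.1 + z.2 • w.2))
        (z.1.2 + (b - a)⁻¹ • (w.2 - w.1))) (by
      rintro ⟨⟨y, v⟩, s⟩ ⟨⟨t, h, e⟩, hs⟩
      obtain ⟨rfl, rfl⟩ := Prod.mk.inj e
      have h1 := eventually_chartTimelike g x₀ (ht t h) (htl t h)
      have h2 : ContinuousAt (fun p : (E × E) × ((E × E) × ℝ) =>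
          (p.2.1.1 + ((1 - p.2.2) • p.1.1 + p.2.2 • p.1.2),
            p.2.1.2 + (b - a)⁻¹ • (p.1.2 - p.1.1)))
          (0, ((c t, derivWithin c (Icc a b) t), s)) := by fun_prop
      have h3 := h2.eventually (p := fun z : E × E => z.1 ∈ (extChartAt 𝓘(ℝ, E) x₀).target ∧
        g.ChartTimelike x₀ z.1 z.2) (by simpa using h1)
      exact h3)
  filter_upwards [key] with w hw
  have hw' : ∀ t ∈ Icc a b, _ := fun t h => hw ((c t, derivWithin c (Icc a b) t), (t - a) / (b - a))
    ⟨⟨t, h, rfl⟩, by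
      have := h.1; have := h.2
      exact ⟨by apply div_nonneg <;> linarith, by rw [div_le_one hba]; linarith⟩⟩
  have hd : ∀ t, HasDerivAt (fun t : ℝ => (1 - (t - a) / (b - a)) • w.1 + ((t - a) / (b - a)) • w.2)
      ((b - a)⁻¹ • (w.2 - w.1)) t := fun t => by
    have h1 : HasDerivAt (fun t : ℝ => (t - a) / (b - a)) (b - a)⁻¹ t := by
      simpa using ((hasDerivAt_id t).sub_const a).div_const (b - a)
    have h2 := ((h1.const_sub 1).smul_const w.1).add (h1.smul_const w.2)
    refine h2.congr_deriv ?_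
    rw [smul_sub, neg_smul]; abel
  have := mem_future_of_chart_curve g x₀ (c := fun t : ℝ => c t +
    ((1 - (t - a) / (b - a)) • w.1 + ((t - a) / (b - a)) • w.2)) hab
    (hc.add (by fun_prop)) (fun t h => (hw' t h).1) (fun t h => by
      have h3 := (((hc.differentiableOn one_ne_zero) t h).hasDerivWithinAt.add
        (hd t).hasDerivWithinAt).derivWithin (uniqueDiffOn_Icc hab t h)
      have h4 := (hw' t h).2
      simp only at h4
      rw [← h3] at h4
      exact h4)
  simpa [div_self hba.ne'] using this

variable {g} in
/-- Perturbation of the end points of a timelike `C¹` arc contained in the domain of a chart. -/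
theorem eventually_mem_future_of_arc {γ : ℝ → M} {a b : ℝ}
    (h : PiecewiseC1.IsC1Arc g.IsFutureTimelike γ a b)
    (hs : ∀ t ∈ Icc a b, γ t ∈ (extChartAt 𝓘(ℝ, E) x₀).source) :
    ∀ᶠ w : M × M in 𝓝 (γ a, γ b), w.2 ∈ g.future w.1 := by
  have h1 := eventually_mem_future_of_chart_curve g x₀ h.1
    (chart_comp_contDiffOn x₀ h.2.1 hs)
    (fun t ht => (extChartAt 𝓘(ℝ, E) x₀).map_source (hs t ht))
    (fun t ht => chartTimelike_chart_comp x₀ g h.1 h.2.1 hs h.2.2 ht)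
  have ha := hs a ⟨le_rfl, h.1.le⟩
  have hb := hs b ⟨h.1.le, le_rfl⟩
  have h2 : ContinuousAt (fun w : M × M =>
      (extChartAt 𝓘(ℝ, E) x₀ w.1 - extChartAt 𝓘(ℝ, E) x₀ (γ a),
        extChartAt 𝓘(ℝ, E) x₀ w.2 - extChartAt 𝓘(ℝ, E) x₀ (γ b))) (γ a, γ b) := by
    have h3 := continuousAt_extChartAt' (I := 𝓘(ℝ, E)) ha
    have h4 := continuousAt_extChartAt' (I := 𝓘(ℝ, E)) hb
    exact (ContinuousAt.comp (f := Prod.fst) (x := (γ a, γ b)) h3 continuousAt_fst |>.sub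
      continuousAt_const).prodMk (ContinuousAt.comp (f := Prod.snd) (x := (γ a, γ b)) h4
        continuousAt_snd |>.sub continuousAt_const)
  have h5 := h2.eventually (p := fun w : E × E => (extChartAt 𝓘(ℝ, E) x₀).symm
    (extChartAt 𝓘(ℝ, E) x₀ (γ b) + w.2) ∈ g.future
      ((extChartAt 𝓘(ℝ, E) x₀).symm (extChartAt 𝓘(ℝ, E) x₀ (γ a) + w.1)))
    (by simp only [sub_self]; exact h1)
  have h6 := (isOpen_extChartAt_source (I := 𝓘(ℝ, E)) x₀).mem_nhds ha
  have h7 := (isOpen_extChartAt_source (I := 𝓘(ℝ, E)) x₀).mem_nhds hb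
  filter_upwards [h5, prod_mem_nhds h6 h7] with w hw hw'
  simp only [add_sub_cancel] at hw
  rwa [(extChartAt 𝓘(ℝ, E) x₀).left_inv hw'.1, (extChartAt 𝓘(ℝ, E) x₀).left_inv hw'.2] at hw

theorem isOpen_future (p : M) : IsOpen (g.future p) := by
  refine isOpen_iff_mem_nhds.2 fun q hq => ?_
  obtain ⟨γ, a, b, h, rfl, rfl⟩ := hq
  obtain ⟨α, haα, harc, hs⟩ := h.exists_last (extChartAt_source_mem_nhds (I := 𝓘(ℝ, E)) (γ b))
  have h1 := eventually_mem_future_of_arc (γ b) harc hs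
  filter_upwards [(Continuous.prodMk_right (γ α)).continuousAt.eventually h1] with z hz
  exact g.future_trans ⟨γ, a, α, h.restrict le_rfl haα harc.1.le, rfl, rfl⟩ hz

theorem isOpen_past (p : M) : IsOpen (g.past p) := by
  refine isOpen_iff_mem_nhds.2 fun q hq => ?_
  obtain ⟨γ, a, b, h, rfl, rfl⟩ := hq
  obtain ⟨β, hβ, harc, hs⟩ := h.exists_first (extChartAt_source_mem_nhds (I := 𝓘(ℝ, E)) (γ a))
  have h1 := eventually_mem_future_of_arc (γ a) harc hs
  filter_upwards [(Continuous.prodMk_left (γ β)).continuousAt.eventually h1] with z hz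
  exact g.future_trans hz ⟨γ, β, b, h.restrict harc.1.le hβ le_rfl, rfl, rfl⟩

end TimeOrientedMetric

/-! ### Pushing points along the time field -/

namespace TimeOrientedMetric

variable {E : Type*} [NormedAddCommGroup E] [NormedSpace ℝ E]
  {M : Type*} [TopologicalSpace M] [ChartedSpace E M] [IsManifold 𝓘(ℝ, E) ∞ M]
  (g : TimeOrientedMetric E M) (x₀ : M)

theorem ChartTimelike.smul {g : TimeOrientedMetric E M} {x₀ : M} {y v : E}
    (h : g.ChartTimelike x₀ y v) {s : ℝ} (hs : 0 < s) : g.ChartTimelike x₀ y (s • v) := by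
  refine ⟨?_, ?_⟩
  · simp only [map_smul, _root_.smul_apply, smul_eq_mul]
    exact mul_neg_of_pos_of_neg hs (mul_neg_of_pos_of_neg hs h.1)
  · simp only [map_smul, smul_eq_mul]
    exact mul_neg_of_pos_of_neg hs h.2

/-- The point obtained from `p` by moving along a straight segment of the chart centred at `x₀`, by
`h` times the time field at `p`: to the future if `h > 0`, to the past if `h < 0`. This is a
substitute, correct to first order in `h`, for the flow of the time field. -/
noncomputable def push (p : M) (h : ℝ) : M :=
  (extChartAt 𝓘(ℝ, E) x₀).symm
    (extChartAt 𝓘(ℝ, E) x₀ p + h • g.chartField x₀ (extChartAt 𝓘(ℝ, E) x₀ p))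

theorem push_zero {p : M} (hp : p ∈ (extChartAt 𝓘(ℝ, E) x₀).source) : g.push x₀ p 0 = p := by
  rw [push, zero_smul, add_zero, (extChartAt 𝓘(ℝ, E) x₀).left_inv hp]

theorem continuousAt_chart_push {p : M} (hp : p ∈ (extChartAt 𝓘(ℝ, E) x₀).source) (h : ℝ) :
    ContinuousAt (fun z : M × ℝ => extChartAt 𝓘(ℝ, E) x₀ z.1 +
      z.2 • g.chartField x₀ (extChartAt 𝓘(ℝ, E) x₀ z.1)) (p, h) := by
  have h1 : ContinuousAt (fun z : M × ℝ => extChartAt 𝓘(ℝ, E) x₀ z.1) (p, h) :=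
    ContinuousAt.comp (f := Prod.fst) (x := (p, h))
      (continuousAt_extChartAt' (I := 𝓘(ℝ, E)) hp) continuousAt_fst
  have ht := (extChartAt 𝓘(ℝ, E) x₀).map_source hp
  have h2 : ContinuousAt (g.chartField x₀) (extChartAt 𝓘(ℝ, E) x₀ p) :=
    ((contDiffOn_chartField x₀ g).continuousOn).continuousAt ((isOpen_target x₀).mem_nhds ht)
  exact h1.add (continuousAt_snd.smul (ContinuousAt.comp (x := (p, h))
    (f := fun z : M × ℝ => extChartAt 𝓘(ℝ, E) x₀ z.1) h2 h1))

theorem continuousAt_push {p : M} (hp : p ∈ (extChartAt 𝓘(ℝ, E) x₀).source) :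
    ContinuousAt (fun z : M × ℝ => g.push x₀ z.1 z.2) (p, 0) := by
  have h1 := continuousAt_chart_push g x₀ hp 0
  refine ContinuousAt.comp (g := (extChartAt 𝓘(ℝ, E) x₀).symm) (x := (p, (0 : ℝ))) ?_ h1
  simp only [zero_smul, add_zero]
  exact continuousAt_extChartAt_symm' hp

variable [FiniteDimensional ℝ E]

/-- Close to the zero section, pushing further leads to the chronological future. -/
theorem eventually_push_mem_future {p : M} (hp : p ∈ (extChartAt 𝓘(ℝ, E) x₀).source) :
    ∀ᶠ z : M × ℝ × ℝ in 𝓝 (p, 0, 0), z.2.1 < z.2.2 →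
      g.push x₀ z.1 z.2.2 ∈ g.future (g.push x₀ z.1 z.2.1) := by
  have ht := (extChartAt 𝓘(ℝ, E) x₀).map_source hp
  have h1 := eventually_chartTimelike g x₀ ht (chartTimelike_chartField g x₀ ht)
  have key := (isCompact_Icc (a := (0 : ℝ)) (b := 1)).eventually_forall_of_forall_eventually
    (x₀ := ((p, 0, 0) : M × ℝ × ℝ)) (P := fun z s =>
      (extChartAt 𝓘(ℝ, E) x₀ z.1 + (z.2.1 + s * (z.2.2 - z.2.1)) •
          g.chartField x₀ (extChartAt 𝓘(ℝ, E) x₀ z.1)) ∈ (extChartAt 𝓘(ℝ, E) x₀).target ∧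
        g.ChartTimelike x₀ (extChartAt 𝓘(ℝ, E) x₀ z.1 + (z.2.1 + s * (z.2.2 - z.2.1)) •
            g.chartField x₀ (extChartAt 𝓘(ℝ, E) x₀ z.1))
          (g.chartField x₀ (extChartAt 𝓘(ℝ, E) x₀ z.1))) (by
      intro s _
      have h2 : ContinuousAt (fun z : (M × ℝ × ℝ) × ℝ =>
          (z.1.1, z.1.2.1 + z.2 * (z.1.2.2 - z.1.2.1))) ((p, 0, 0), s) := by
        fun_prop
      have h3 := ContinuousAt.comp (f := fun z : (M × ℝ × ℝ) × ℝ =>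
          (z.1.1, z.1.2.1 + z.2 * (z.1.2.2 - z.1.2.1)))
        (x := ((p, 0, 0), s)) (continuousAt_chart_push g x₀ hp _) h2
      have h4 : ContinuousAt (fun z : (M × ℝ × ℝ) × ℝ => extChartAt 𝓘(ℝ, E) x₀ z.1.1)
          ((p, 0, 0), s) :=
        ContinuousAt.comp (f := fun z : (M × ℝ × ℝ) × ℝ => z.1.1) (x := ((p, 0, 0), s))
          (continuousAt_extChartAt' (I := 𝓘(ℝ, E)) hp) (by fun_prop)
      have h5 : ContinuousAt (g.chartField x₀) (extChartAt 𝓘(ℝ, E) x₀ p) :=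
        ((contDiffOn_chartField x₀ g).continuousOn).continuousAt ((isOpen_target x₀).mem_nhds ht)
      have h6 := h3.prodMk (ContinuousAt.comp (x := ((p, 0, 0), s))
        (f := fun z : (M × ℝ × ℝ) × ℝ => extChartAt 𝓘(ℝ, E) x₀ z.1.1) h5 h4)
      have h7 := h6.eventually (p := fun z : E × E => z.1 ∈ (extChartAt 𝓘(ℝ, E) x₀).target ∧
        g.ChartTimelike x₀ z.1 z.2) (by simpa using h1)
      exact h7)
  filter_upwards [key] with z hz hlt
  have := mem_future_of_segment g x₀ (y := extChartAt 𝓘(ℝ, E) x₀ z.1 +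
      z.2.1 • g.chartField x₀ (extChartAt 𝓘(ℝ, E) x₀ z.1))
    (w := (z.2.2 - z.2.1) • g.chartField x₀ (extChartAt 𝓘(ℝ, E) x₀ z.1)) (fun s hs => by
      have := hz s hs
      rw [smul_smul, add_assoc, ← add_smul]
      exact ⟨this.1, this.2.smul (sub_pos.2 hlt)⟩)
  rw [add_assoc, ← add_smul, add_sub_cancel] at this
  exact this

theorem mem_closure_future (p : M) : p ∈ closure (g.future p) ∧ p ∈ closure (g.past p) := by
  have hp := mem_extChartAt_source (I := 𝓘(ℝ, E)) p
  have h1 := eventually_push_mem_future g p hp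
  have h0 : Tendsto (fun h : ℝ => (p, 0, h)) (𝓝[>] 0) (𝓝 (p, (0 : ℝ), 0)) :=
    ((by fun_prop : Continuous (fun h : ℝ => (p, (0 : ℝ), h))).tendsto 0).mono_left
      nhdsWithin_le_nhds
  have h0' : Tendsto (fun h : ℝ => (p, h, 0)) (𝓝[<] 0) (𝓝 (p, (0 : ℝ), (0 : ℝ))) :=
    ((by fun_prop : Continuous (fun h : ℝ => (p, h, (0 : ℝ)))).tendsto 0).mono_left
      nhdsWithin_le_nhds
  have h2 := (continuousAt_push g p hp).tendsto
  rw [push_zero g p hp] at h2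
  have h3 := h2.comp ((Continuous.prodMk_right p).tendsto 0)
  constructor
  · refine mem_closure_of_tendsto (h3.mono_left (nhdsWithin_le_nhds (s := Ioi 0))) ?_
    filter_upwards [h0.eventually h1, self_mem_nhdsWithin] with h h4 h5
    have := h4 h5
    rwa [push_zero g p hp] at this
  · refine mem_closure_of_tendsto (h3.mono_left (nhdsWithin_le_nhds (s := Iio 0))) ?_
    filter_upwards [h0'.eventually h1, self_mem_nhdsWithin] with h h4 h5
    have := h4 h5
    rwa [push_zero g p hp] at this

/-- A timelike `C¹` arc in the domain of a chart has positive length, as its speed attains a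
positive minimum. -/
theorem IsC1Arc_length_pos {γ : ℝ → M} {a b : ℝ}
    (h : PiecewiseC1.IsC1Arc g.IsFutureTimelike γ a b)
    (hs : ∀ t ∈ Icc a b, γ t ∈ (extChartAt 𝓘(ℝ, E) x₀).source) : 0 < g.length γ a b := by
  set c : ℝ → E := fun t => extChartAt 𝓘(ℝ, E) x₀ (γ t) with hcdef
  have hc : ContDiffOn ℝ 1 c (Icc a b) := chart_comp_contDiffOn x₀ h.2.1 hs
  have ht : ∀ t ∈ Icc a b, c t ∈ (extChartAt 𝓘(ℝ, E) x₀).target :=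
    fun t ht => (extChartAt 𝓘(ℝ, E) x₀).map_source (hs t ht)
  have htl : ∀ t ∈ Icc a b, g.ChartTimelike x₀ (c t) (derivWithin c (Icc a b) t) :=
    fun t ht => chartTimelike_chart_comp x₀ g h.1 h.2.1 hs h.2.2 ht
  have h1 : g.length γ a b = g.length (fun t => (extChartAt 𝓘(ℝ, E) x₀).symm (c t)) a b :=
    g.length_congr fun t ht =>
      ((extChartAt 𝓘(ℝ, E) x₀).left_inv (hs t (Ioo_subset_Icc_self ht))).symm
  rw [h1, length_chart_symm_comp x₀ g hc ht]
  have hd := hc.continuousOn_derivWithin (uniqueDiffOn_Icc h.1) le_rfl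
  have hcont : ContinuousOn (fun t => Real.sqrt
        (-g.chartMetric x₀ (c t) (derivWithin c (Icc a b) t) (derivWithin c (Icc a b) t)))
      (Icc a b) := by
    have h2 : ContinuousOn (fun t => g.chartMetric x₀ (c t)) (Icc a b) :=
      (contDiffOn_chartMetric x₀ g).continuousOn.comp hc.continuousOn ht
    exact ((h2.clm_apply hd).clm_apply hd).neg.sqrt
  obtain ⟨t0, ht0, hmin⟩ := isCompact_Icc.exists_isMinOn (nonempty_Icc.2 h.1.le) hcont
  have hpos : 0 < Real.sqrt (-g.chartMetric x₀ (c t0) (derivWithin c (Icc a b) t0)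
      (derivWithin c (Icc a b) t0)) := Real.sqrt_pos.2 (neg_pos.2 (htl t0 ht0).1)
  have h3 : ENNReal.ofReal (Real.sqrt (-g.chartMetric x₀ (c t0) (derivWithin c (Icc a b) t0)
      (derivWithin c (Icc a b) t0))) * volume (Ioo a b) ≤ _ :=
    setLIntegral_mono_ae' (s := Ioo a b) (μ := volume) (f := fun _ => ENNReal.ofReal (Real.sqrt
      (-g.chartMetric x₀ (c t0) (derivWithin c (Icc a b) t0) (derivWithin c (Icc a b) t0))))
      measurableSet_Ioo (ae_of_all _ fun t ht =>
        ENNReal.ofReal_le_ofReal (hmin (Ioo_subset_Icc_self ht))) |>.trans' (by simp)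
  refine lt_of_lt_of_le ?_ h3
  rw [Real.volume_Ioo]
  exact ENNReal.mul_pos (ENNReal.ofReal_pos.2 hpos).ne' (ENNReal.ofReal_pos.2 (sub_pos.2 h.1)).ne'

theorem lorentzianDist_pos {p q : M} (h : q ∈ g.future p) : 0 < g.lorentzianDist p q := by
  obtain ⟨γ, a, b, h, rfl, rfl⟩ := h
  obtain ⟨α, haα, harc, hs⟩ := h.exists_last (extChartAt_source_mem_nhds (I := 𝓘(ℝ, E)) (γ b))
  have h1 := IsC1Arc_length_pos g (γ b) harc hs
  have h2 := g.length_add γ haα harc.1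
  have h3 := g.le_lorentzianDist ⟨h, rfl, rfl⟩
  rw [h2] at h3
  exact h1.trans_le (le_add_self.trans h3)

theorem lorentzianDist_eq_zero_iff {p q : M} : g.lorentzianDist p q = 0 ↔ q ∉ g.future p :=
  ⟨fun h h' => (g.lorentzianDist_pos h').ne' h, g.lorentzianDist_eq_zero_of_notMem⟩

end TimeOrientedMetric

/-! ### Conformal factors and curves not contained in a compact set -/

theorem PiecewiseC1.imp {E : Type*} [NormedAddCommGroup E] [NormedSpace ℝ E]
    {M : Type*} [TopologicalSpace M] [ChartedSpace E M]
    {P Q : ∀ p : M, TangentSpace 𝓘(ℝ, E) p → Prop} {γ : ℝ → M} {a b : ℝ}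
    (h : PiecewiseC1 P γ a b) (hPQ : ∀ p v, P p v → Q p v) : PiecewiseC1 Q γ a b := by
  induction h with
  | single hab hγ hP => exact .single hab hγ fun t ht => hPQ _ _ (hP t ht)
  | append _ _ i1 i2 => exact .append i1 i2

namespace TimeOrientedMetric

variable {E : Type*} [NormedAddCommGroup E] [NormedSpace ℝ E]
  {M : Type*} [TopologicalSpace M] [ChartedSpace E M] [IsManifold 𝓘(ℝ, E) ∞ M]
  (g : TimeOrientedMetric E M)

/-- `μ` restricted to `(α, β]` is a future directed timelike curve. The interval is open on the
left, where a past inextendible curve has no end point. -/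
def IsFutureOn (μ : ℝ → M) (α β : ℝ) : Prop :=
  ∀ s t, α < s → s < t → t ≤ β → PiecewiseC1 g.IsFutureTimelike μ s t

variable {g} in
/-- A past directed curve on `[a, b)`, traversed backwards, is a future directed one on `(-b, -a]`.
-/
theorem IsPastInextendible.isFutureOn {l : ℝ → M} {a b : ℝ} (h : g.IsPastInextendible l a b) :
    g.IsFutureOn (fun t => l (-t)) (-b) (-a) := by
  intro s t hs hst ht
  have h1 := (h.2.1 (-s) (by linarith) (by linarith)).reverse
  rw [neg_neg] at h1
  refine (h1.restrict le_rfl hst ht).imp fun p v hv => ?_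
  refine ⟨?_, ?_⟩
  · have := hv.1
    simpa using this
  · have := hv.2
    simpa using this

variable {g} in
theorem IsFutureOn.mem_future {μ : ℝ → M} {α β s t : ℝ} (h : g.IsFutureOn μ α β) (hs : α < s)
    (hst : s < t) (ht : t ≤ β) : μ t ∈ g.future (μ s) :=
  ⟨μ, s, t, h s t hs hst ht, rfl, rfl⟩

theorem lorentzianDist_mono {p q r s : M} (h1 : q ∈ g.future p) (h2 : r ∈ g.future q)
    (h3 : s ∈ g.future r) : g.lorentzianDist q r ≤ g.lorentzianDist p s :=
  le_add_self.trans <| (g.lorentzianDist_add_le h1 h2).trans <|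
    le_self_add.trans (g.lorentzianDist_add_le (g.future_trans h1 h2) h3)

section Conformal

variable (Ω : M → ℝ) (hΩ : ContMDiff 𝓘(ℝ, E) 𝓘(ℝ, ℝ) ∞ Ω) (hpos : ∀ p, 0 < Ω p)

theorem conformal_isFutureTimelike :
    (g.conformal Ω hΩ hpos).IsFutureTimelike = g.IsFutureTimelike := by
  funext p v
  have h2 : 0 < Ω p ^ 2 := pow_pos (hpos p) 2
  have e1 : (g.conformal Ω hΩ hpos).val p v v = Ω p ^ 2 * g.val p v v := rfl
  have e2 : (g.conformal Ω hΩ hpos).val p ((g.conformal Ω hΩ hpos).timeField p) v =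
    Ω p ^ 2 * g.val p (g.timeField p) v := rfl
  have key : ∀ x : ℝ, Ω p ^ 2 * x < 0 ↔ x < 0 := fun x => by
    rw [← not_le, ← not_le, mul_nonneg_iff_of_pos_left h2]
  rw [IsFutureTimelike, IsFutureTimelike, e1, e2, key, key]

theorem conformal_isTimelikeCurve {γ : ℝ → M} {a b : ℝ} {p q : M} :
    (g.conformal Ω hΩ hpos).IsTimelikeCurve γ a b p q ↔ g.IsTimelikeCurve γ a b p q := by
  rw [IsTimelikeCurve, IsTimelikeCurve, conformal_isFutureTimelike]

theorem conformal_future (p : M) : (g.conformal Ω hΩ hpos).future p = g.future p := by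
  ext q
  simp only [future, conformal_isTimelikeCurve]

theorem conformal_speed (p : M) (v : TangentSpace 𝓘(ℝ, E) p) :
    ENNReal.ofReal (Real.sqrt (-(g.conformal Ω hΩ hpos).val p v v)) =
      ENNReal.ofReal (Ω p) * ENNReal.ofReal (Real.sqrt (-g.val p v v)) := by
  have e1 : (g.conformal Ω hΩ hpos).val p v v = Ω p ^ 2 * g.val p v v := rfl
  rw [e1, ← ENNReal.ofReal_mul (hpos p).le, ← mul_neg, Real.sqrt_mul (sq_nonneg _),
    Real.sqrt_sq (hpos p).le]

theorem le_length_conformal {γ : ℝ → M} {a b : ℝ} (C : ℝ)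
    (h : ∀ t ∈ Ioo a b, C ≤ Ω (γ t)) :
    ENNReal.ofReal C * g.length γ a b ≤ (g.conformal Ω hΩ hpos).length γ a b := by
  rw [length, length, ← lintegral_const_mul' _ _ ENNReal.ofReal_ne_top]
  refine setLIntegral_mono_ae' measurableSet_Ioo (ae_of_all _ fun t ht => ?_)
  rw [conformal_speed]
  exact mul_le_mul_left (ENNReal.ofReal_le_ofReal (h t ht)) _

theorem length_conformal_eq {γ : ℝ → M} {a b : ℝ} (h : ∀ t ∈ Ioo a b, Ω (γ t) = 1) :
    (g.conformal Ω hΩ hpos).length γ a b = g.length γ a b := by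
  refine setLIntegral_congr_fun measurableSet_Ioo fun t ht => ?_
  simp only [conformal_speed, h t ht, ENNReal.ofReal_one, one_mul]

theorem lorentzianDist_conformal_one :
    (g.conformal (fun _ => 1) contMDiff_const (fun _ => one_pos)).lorentzianDist =
      g.lorentzianDist := by
  funext p q
  simp only [lorentzianDist, conformal_isTimelikeCurve]
  refine iSup_congr fun γ => iSup_congr fun a => iSup_congr fun b => iSup_congr fun _ => ?_
  exact length_conformal_eq g _ _ _ fun _ _ => rfl

end Conformal

variable [FiniteDimensional ℝ E]

theorem isOpen_futureSet (S : Set M) : IsOpen (g.futureSet S) :=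
  isOpen_biUnion fun p _ => g.isOpen_future p

omit [FiniteDimensional ℝ E] in
variable {g} in
theorem IsFutureOn.subset_futureSet {μ : ℝ → M} {α β : ℝ} (h : g.IsFutureOn μ α β) :
    μ '' Ioc α β ⊆ g.futureSet (μ '' Ioc α β) := by
  rintro _ ⟨t, ht, rfl⟩
  refine mem_biUnion (mem_image_of_mem μ (x := (α + t) / 2) ⟨?_, ?_⟩) (h.mem_future ?_ ?_ ht.2) <;>
  linarith [ht.1, ht.2]

/-- A timelike curve that is not contained in a compact set can be given infinite length by a
conformal factor that differs from `1` only in the chronological future of the curve: on infinitely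
many pieces of the curve, in the members of a locally finite cover, the factor is made so large that
the lengths of the pieces are unbounded. -/
theorem IsFutureOn.exists_conformal [T2Space M] [ParacompactSpace M] {μ : ℝ → M} {α β : ℝ}
    (h : g.IsFutureOn μ α β) (hK : ∀ K, IsCompact K → ¬ μ '' Ioc α β ⊆ K) :
    ∃ (Ω : M → ℝ) (hΩ : ContMDiff 𝓘(ℝ, E) 𝓘(ℝ, ℝ) ∞ Ω) (hpos : ∀ p, 0 < Ω p),
      (∀ p ∉ g.futureSet (μ '' Ioc α β), Ω p = 1) ∧
      ∀ u, μ '' Ioc α β ⊆ g.future u → ∀ v ∈ g.futureSet (μ '' Ioc α β),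
        (g.conformal Ω hΩ hpos).lorentzianDist u v = ⊤ := by
  classical
  have : LocallyCompactSpace M := Manifold.locallyCompact_of_finiteDimensional 𝓘(ℝ, E)
  set S := μ '' Ioc α β with hS
  set F := g.futureSet S with hF
  have hFo : IsOpen F := g.isOpen_futureSet S
  -- a locally finite cover by relatively compact open sets `V x`; infinitely many of them meet the
  -- curve
  choose K hKc hKn using fun x : M => exists_compact_mem_nhds x
  obtain ⟨V, hVo, hVc, hVf, hVK⟩ := precise_refinement (fun x => interior (K x))
    (fun x => isOpen_interior) (eq_univ_of_forall fun x =>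
      mem_iUnion.2 ⟨x, mem_interior_iff_mem_nhds.2 (hKn x)⟩)
  have hinf : {x | (V x ∩ S).Nonempty}.Infinite := by
    intro hfin
    refine hK (⋃ x ∈ {x | (V x ∩ S).Nonempty}, K x) (hfin.isCompact_biUnion fun x _ => hKc x) ?_
    intro p hp
    obtain ⟨x, hx⟩ := mem_iUnion.1 (hVc.ge (mem_univ p))
    exact mem_biUnion (show x ∈ {x | (V x ∩ S).Nonempty} from ⟨p, hx, hp⟩)
      (interior_subset (hVK x hx))
  let i : ℕ ↪ {x | (V x ∩ S).Nonempty} := hinf.natEmbedding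
  have hi : Function.Injective fun n => (i n : M) := Subtype.val_injective.comp i.injective
  have hex : ∀ n, ∃ t ∈ Ioc α β, μ t ∈ V (i n) := by
    intro n
    obtain ⟨_, h1, t, ht, rfl⟩ := (i n).2
    exact ⟨t, ht, h1⟩
  choose t ht htV using hex
  -- bump functions at points of the curve in distinct members of the cover, supported in the future
  have hbump : ∀ n, ∃ f : SmoothBumpFunction 𝓘(ℝ, E) (μ (t n)), tsupport f ⊆ V (i n) ∩ F := by
    intro n
    have hn : V (i n) ∩ F ∈ 𝓝 (μ (t n)) := ((hVo _).inter hFo).mem_nhds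
      ⟨htV n, h.subset_futureSet (mem_image_of_mem μ (ht n))⟩
    obtain ⟨f, hf, -⟩ := (SmoothBumpFunction.nhds_basis_support (I := 𝓘(ℝ, E)) hn).mem_iff.1 hn
    exact ⟨f, hf⟩
  choose f hf using hbump
  -- pieces of the curve on which the bump functions are `1`, and factors that make them long
  have hpiece : ∀ n : ℕ, ∃ s, α < s ∧ s < t n ∧ (∀ r ∈ Icc s (t n), f n (μ r) = 1) ∧
      0 < g.length μ s (t n) := by
    intro n
    have h1 := h ((α + t n) / 2) (t n) (by linarith [(ht n).1]) (by linarith [(ht n).1]) (ht n).2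
    obtain ⟨s, hs, harc, hsU⟩ := h1.exists_last (Filter.inter_mem (f n).eventuallyEq_one
      (extChartAt_source_mem_nhds (I := 𝓘(ℝ, E)) (μ (t n))))
    exact ⟨s, by linarith [(ht n).1], harc.1, fun r hr => (hsU r hr).1,
      IsC1Arc_length_pos g (μ (t n)) harc fun r hr => (hsU r hr).2⟩
  choose s hαs hst hs1 hlen using hpiece
  have hC : ∀ n : ℕ, ∃ C : ℕ, (n : ℝ≥0∞) < C * g.length μ (s n) (t n) := fun n =>
    ENNReal.exists_nat_mul_gt (hlen n).ne' (ENNReal.natCast_ne_top n)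
  choose C hC using hC
  have hlf : LocallyFinite fun n => Function.support fun p => (C n : ℝ) * f n p := by
    refine (hVf.comp_injective hi).subset fun n p hp => ?_
    exact (hf n (subset_tsupport _ (right_ne_zero_of_mul hp))).1
  have hnn : ∀ n p, 0 ≤ (C n : ℝ) * f n p := fun n p => mul_nonneg (Nat.cast_nonneg _) (f n).nonneg
  have hsm : ContMDiff 𝓘(ℝ, E) 𝓘(ℝ, ℝ) ∞ fun p => ∑ᶠ n, (C n : ℝ) * f n p :=
    contMDiff_finsum (fun n => contMDiff_const.mul (f n).contMDiff) hlf
  have hΩ : ContMDiff 𝓘(ℝ, E) 𝓘(ℝ, ℝ) ∞ fun p => 1 + ∑ᶠ n, (C n : ℝ) * f n p :=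
    contMDiff_const.add hsm
  have hpos : ∀ p, 0 < 1 + ∑ᶠ n, (C n : ℝ) * f n p := fun p =>
    add_pos_of_pos_of_nonneg one_pos (finsum_nonneg fun n => hnn n p)
  refine ⟨_, hΩ, hpos, fun p hp => ?_, fun u hu v hv => ?_⟩
  · rw [finsum_eq_zero_of_forall_eq_zero, add_zero]
    intro n
    by_contra h0
    exact hp (hf n (subset_tsupport _ (right_ne_zero_of_mul h0))).2
  · obtain ⟨_, ⟨τ, hτ, rfl⟩, hv⟩ := mem_iUnion₂.1 hv
    -- only finitely many pieces end later than `τ`, because `[τ, β]` is compact; any other piece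
    -- lies between `u` and `v`
    have hfin : {n | τ ≤ t n}.Finite := by
      have hcomp : IsCompact (μ '' Icc τ β) := by
        have := (h ((α + τ) / 2) β (by linarith [hτ.1]) (by linarith [hτ.1, hτ.2])
          le_rfl).continuousOn
        exact isCompact_Icc.image_of_continuousOn
          (this.mono (Icc_subset_Icc (by linarith [hτ.1]) le_rfl))
      refine ((hVf.comp_injective hi).finite_nonempty_inter_compact hcomp).subset fun n hn => ?_
      exact ⟨μ (t n), htV n, mem_image_of_mem μ ⟨hn, (ht n).2⟩⟩
    refine ENNReal.eq_top_of_forall_nnreal_le fun r => ?_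
    obtain ⟨N, hN⟩ := exists_nat_ge r
    obtain ⟨n, hn, hNn⟩ : ∃ n, t n < τ ∧ N ≤ n := by
      obtain ⟨n, hn, hn'⟩ := (hfin.infinite_compl.exists_gt N)
      exact ⟨n, not_le.1 hn, hn'.le⟩
    have hfut := g.conformal_future _ hΩ hpos
    have hbound : (n : ℝ≥0∞) ≤ (g.conformal _ hΩ hpos).lorentzianDist u v := by
      refine (hC n).le.trans ?_
      have h1 := g.le_length_conformal _ hΩ hpos (γ := μ) (a := s n) (b := t n) (C n) (by
        intro r hr
        have h2 : (C n : ℝ) * f n (μ r) ≤ ∑ᶠ j, (C j : ℝ) * f j (μ r) :=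
          single_le_finsum n (hlf.point_finite (μ r)) (fun n => hnn n (μ r))
        rw [hs1 n r (Ioo_subset_Icc_self hr), mul_one] at h2
        linarith)
      rw [ENNReal.ofReal_natCast] at h1
      refine h1.trans ((le_lorentzianDist _ ((g.conformal_isTimelikeCurve _ hΩ hpos).2
        ⟨h _ _ (hαs n) (hst n) (ht n).2, rfl, rfl⟩)).trans (lorentzianDist_mono _ ?_ ?_ ?_))
      · rw [hfut]
        exact hu (mem_image_of_mem μ ⟨hαs n, (hst n).le.trans (ht n).2⟩)
      · rw [hfut]
        exact h.mem_future (hαs n) (hst n) (ht n).2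
      · rw [hfut]
        exact g.future_trans (h.mem_future (ht n).1 hn hτ.2) hv
    refine le_trans ?_ hbound
    have : r ≤ (n : NNReal) := hN.trans (by exact_mod_cast hNn)
    exact_mod_cast this

end TimeOrientedMetric

/-! ### Causal cones and Taylor bounds in a vector space -/

section VectorSpace

variable {E : Type*} [NormedAddCommGroup E] [NormedSpace ℝ E]
  {F : Type*} [NormedAddCommGroup F] [NormedSpace ℝ F]

/-- The orthogonal complement of *every* timelike vector `x` of a Lorentzian form is spacelike, if
this holds for one timelike vector `v`: the plane spanned by `x` and a causal vector `w` orthogonal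
to it would be negative semidefinite, but it contains the vector `B v w • x - B v x • w`, orthogonal
to `v`. -/
theorem pos_of_orthogonal_timelike {B : E →L[ℝ] E →L[ℝ] ℝ} (hs : ∀ v w, B v w = B w v)
    (hB : ∃ v, B v v < 0 ∧ ∀ w, w ≠ 0 → B v w = 0 → 0 < B w w) {x : E} (hx : B x x < 0)
    {w : E} (hw : w ≠ 0) (hxw : B x w = 0) : 0 < B w w := by
  obtain ⟨v, hv, h⟩ := hB
  by_contra! hcon
  set a := B v w
  set b := -B v x
  have hz : B v (a • x + b • w) = 0 := by
    simp only [map_add, map_smul, smul_eq_mul, a, b]; ring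
  have hzz : B (a • x + b • w) (a • x + b • w) = a ^ 2 * B x x + b ^ 2 * B w w := by
    simp only [map_add, map_smul, smul_eq_mul, add_apply, smul_apply, hxw, hs w x]; ring
  have hne : a • x + b • w ≠ 0 := by
    intro h0
    have h1 : B x (a • x + b • w) = 0 := by rw [h0, map_zero]
    simp only [map_add, map_smul, smul_eq_mul, hxw, mul_zero, add_zero] at h1
    have ha : a = 0 := (mul_eq_zero.1 h1).resolve_right hx.ne
    rw [ha, zero_smul, zero_add, smul_eq_zero] at h0
    have hb : b = 0 := h0.resolve_right hw
    have hx0 : x ≠ 0 := by rintro rfl; simp at hx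
    have := h x hx0 (by simpa [b] using hb)
    linarith
  have h1 := h _ hne hz
  rw [hzz] at h1
  nlinarith [sq_nonneg a, sq_nonneg b]

/-- Changing the sign of a Lorentzian form in the direction of a timelike vector `x` turns it into a
positive definite form. -/
theorem pos_of_timelike_correction {B : E →L[ℝ] E →L[ℝ] ℝ} (hs : ∀ v w, B v w = B w v)
    (hB : ∃ v, B v v < 0 ∧ ∀ w, w ≠ 0 → B v w = 0 → 0 < B w w) {x : E} (hx : B x x < 0)
    {v : E} (hv : v ≠ 0) : 0 < B v v + 2 / (-B x x) * (B x v) ^ 2 := by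
  set τ := -B x x with hτ
  have hτ0 : 0 < τ := by linarith
  set a := -(B x v) / τ with ha
  set w := v - a • x with hwdef
  have hxw : B x w = 0 := by
    simp only [hwdef, map_sub, map_smul, smul_eq_mul, ha]; field_simp; linarith
  have hvw : v = a • x + w := by rw [hwdef]; abel
  have hxx : B x x = -τ := by linarith
  have e1 : B v v = -(a ^ 2 * τ) + B w w := by
    rw [hvw]
    simp only [map_add, map_smul, smul_eq_mul, add_apply, smul_apply, hxw, hs w x, hxx]; ring
  have e2 : B x v = -(a * τ) := by
    rw [ha]; field_simp
  rw [e1, e2]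
  have e3 : 2 / τ * (-(a * τ)) ^ 2 = 2 * a ^ 2 * τ := by field_simp
  rw [e3]
  by_cases hw : w = 0
  · have ha0 : a ≠ 0 := by
      rintro h0; rw [h0, hw] at hvw; simp at hvw; exact hv hvw
    rw [hw]; simp only [map_zero]
    have := mul_pos (sq_pos_of_ne_zero ha0) hτ0
    linarith
  · have := pos_of_orthogonal_timelike hs hB hx hw hxw
    have := mul_nonneg (sq_nonneg a) hτ0.le
    linarith

/-- On causal vectors the time function given by the time field controls the norm, uniformly near a
point and even with the coefficients frozen at the point. This follows from
`pos_of_timelike_correction` by compactness of the unit sphere. -/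
theorem exists_cone_bound [FiniteDimensional ℝ E] {G : E → E →L[ℝ] E →L[ℝ] ℝ} {X : E → E} {y₀ : E}
    (hs : ∀ v w, G y₀ v w = G y₀ w v)
    (hL : ∃ v, G y₀ v v < 0 ∧ ∀ w, w ≠ 0 → G y₀ v w = 0 → 0 < G y₀ w w)
    (hX : G y₀ (X y₀) (X y₀) < 0) (hGc : ContinuousAt G y₀) (hXc : ContinuousAt X y₀) :
    ∃ A > 0, ∀ᶠ y in 𝓝 y₀, ∀ v, G y v v ≤ 0 → G y (X y) v ≤ 0 →
      ‖v‖ ≤ A * (-G y₀ (X y₀) v) ∧ ‖v‖ ≤ A * (-G y (X y) v) := by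
  have hX0 : X y₀ ≠ 0 := by intro h; rw [h] at hX; simp at hX
  set a : ℝ := 2 / (-G y₀ (X y₀) (X y₀)) with ha
  have ha0 : 0 < a := div_pos two_pos (by linarith)
  have hne : (Metric.sphere (0 : E) 1).Nonempty :=
    ⟨‖X y₀‖⁻¹ • X y₀, by simp [norm_smul, inv_mul_cancel₀ (norm_ne_zero_iff.2 hX0)]⟩
  obtain ⟨v₀, hv₀, hmin⟩ := (isCompact_sphere (0 : E) 1).exists_isMinOn hne
    (f := fun v => G y₀ v v + a * (G y₀ (X y₀) v) ^ 2)
    (((G y₀).continuous.clm_apply continuous_id).add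
      (continuous_const.mul ((G y₀ (X y₀)).continuous.pow 2))).continuousOn
  have hv₀' : v₀ ≠ 0 := by rintro rfl; simp at hv₀
  set δ := G y₀ v₀ v₀ + a * (G y₀ (X y₀) v₀) ^ 2 with hδ
  have hδ0 : 0 < δ := pos_of_timelike_correction hs hL hX hv₀'
  have key := (isCompact_sphere (0 : E) 1).eventually_forall_of_forall_eventually (x₀ := y₀)
    (P := fun y v => δ / 2 < G y v v + a * (G y (X y) v) ^ 2) (by
      intro v hv
      have h1 : ContinuousAt (fun z : E × E => G z.1) (y₀, v) :=
        ContinuousAt.comp (f := Prod.fst) (x := (y₀, v)) hGc continuousAt_fst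
      have h2 : ContinuousAt (fun z : E × E => X z.1) (y₀, v) :=
        ContinuousAt.comp (f := Prod.fst) (x := (y₀, v)) hXc continuousAt_fst
      have h3 : ContinuousAt
          (fun z : E × E => G z.1 z.2 z.2 + a * (G z.1 (X z.1) z.2) ^ 2) (y₀, v) :=
        ((h1.clm_apply continuousAt_snd).clm_apply continuousAt_snd).add
          (continuousAt_const.mul (((h1.clm_apply h2).clm_apply continuousAt_snd).pow 2))
      refine h3.eventually_const_lt ?_
      have := hmin hv
      simp only [mem_ofPred_eq] at this
      linarith)
  set η := Real.sqrt (δ / 2 / a) with hη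
  have hη0 : 0 < η := Real.sqrt_pos.2 (by positivity)
  have h4 : ∀ᶠ y in 𝓝 y₀, ‖G y (X y) - G y₀ (X y₀)‖ < η / 2 := by
    have h5 : ContinuousAt (fun y => G y (X y)) y₀ := hGc.clm_apply hXc
    have := Metric.continuousAt_iff'.1 h5 (η / 2) (by positivity)
    simpa [dist_eq_norm] using this
  refine ⟨2 / η, by positivity, ?_⟩
  filter_upwards [key, h4] with y hy hy' v h1 h2
  rcases eq_or_ne v 0 with rfl | hv
  · simp
  have hn : 0 < ‖v‖ := norm_pos_iff.2 hv
  have h5 := hy (‖v‖⁻¹ • v) (by simp [norm_smul, inv_mul_cancel₀ hn.ne'])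
  have h6 : η < -G y (X y) (‖v‖⁻¹ • v) := by
    simp only [map_smul, smul_apply, smul_eq_mul] at h5 ⊢
    have h7 : ‖v‖⁻¹ * (‖v‖⁻¹ * G y v v) ≤ 0 := by
      have : (0 : ℝ) ≤ ‖v‖⁻¹ := by positivity
      exact mul_nonpos_of_nonneg_of_nonpos this (mul_nonpos_of_nonneg_of_nonpos this h1)
    have h8 : δ / 2 / a < (-(‖v‖⁻¹ * G y (X y) v)) ^ 2 := by
      rw [div_lt_iff₀ ha0]; nlinarith
    exact (Real.sqrt_lt' (by
      have h9 : 0 ≤ -(‖v‖⁻¹ * G y (X y) v) := by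
        rw [← mul_neg]; exact mul_nonneg (by positivity) (by linarith)
      rcases h9.eq_or_lt with h9 | h9
      · rw [← h9] at h8
        have : 0 < δ / 2 / a := by positivity
        norm_num at h8; linarith
      · exact h9)).2 h8
  have h7 : η * ‖v‖ < -G y (X y) v := by
    rw [map_smul, smul_eq_mul, ← mul_neg, inv_mul_eq_div, lt_div_iff₀ hn] at h6
    exact h6
  have h8 : |G y (X y) v - G y₀ (X y₀) v| ≤ η / 2 * ‖v‖ := by
    have := (G y (X y) - G y₀ (X y₀)).le_opNorm v
    rw [sub_apply, Real.norm_eq_abs] at this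
    exact this.trans (mul_le_mul_of_nonneg_right hy'.le hn.le)
  have h9 := abs_le.1 h8
  constructor
  · rw [div_mul_eq_mul_div, le_div_iff₀ hη0]; nlinarith
  · rw [div_mul_eq_mul_div, le_div_iff₀ hη0]; nlinarith

/-- Second order Taylor bounds for a smooth map, uniform near a point. -/
theorem exists_taylor_bound {f : E → F} {U : Set E} (hU : IsOpen U) (hf : ContDiffOn ℝ ∞ f U)
    {y₀ : E} (hy₀ : y₀ ∈ U) :
    ∃ A > 0, ∃ ρ > 0, Metric.ball y₀ ρ ⊆ U ∧ ∀ y ∈ Metric.ball y₀ ρ, ‖f y‖ ≤ A ∧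
      (∀ w, ‖fderiv ℝ f y w‖ ≤ A * ‖w‖) ∧ ∀ z ∈ Metric.ball y₀ ρ, ‖f z - f y‖ ≤ A * ‖z - y‖ ∧
        ‖f z - f y - fderiv ℝ f y (z - y)‖ ≤ A * ‖z - y‖ ^ 2 := by
  have hfa : ContDiffAt ℝ ∞ f y₀ := hf.contDiffAt (hU.mem_nhds hy₀)
  have hd : ContDiffAt ℝ 1 (fderiv ℝ f) y₀ := hfa.fderiv_right (m := 1) (by norm_cast)
  obtain ⟨K, t, ht, hK⟩ := hd.exists_lipschitzOnWith
  have h1 : ∀ᶠ y in 𝓝 y₀, ‖f y‖ < ‖f y₀‖ + 1 :=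
    hfa.continuousAt.norm.eventually_lt_const (by linarith)
  have h2 : ∀ᶠ y in 𝓝 y₀, ‖fderiv ℝ f y‖ < ‖fderiv ℝ f y₀‖ + 1 :=
    hd.continuousAt.norm.eventually_lt_const (by linarith)
  obtain ⟨ρ, hρ, hball⟩ := Metric.eventually_nhds_iff_ball.1
    ((((hU.eventually_mem hy₀).and (p := fun y => y ∈ U) (q := fun y => y ∈ t) ht)).and (h1.and h2))
  set A := ‖f y₀‖ + 1 + (‖fderiv ℝ f y₀‖ + 1) + K with hA
  have n1 := norm_nonneg (f y₀)
  have n2 := norm_nonneg (fderiv ℝ f y₀)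
  have n3 : (0 : ℝ) ≤ K := K.2
  have hdiff : ∀ y ∈ Metric.ball y₀ ρ, HasFDerivAt f (fderiv ℝ f y) y := fun y hy =>
    ((hf.contDiffAt (hU.mem_nhds (hball y hy).1.1)).differentiableAt (by simp)).hasFDerivAt
  refine ⟨A, by positivity, ρ, hρ, fun y hy => (hball y hy).1.1,
    fun y hy => ⟨?_, ?_, fun z hz => ⟨?_, ?_⟩⟩⟩
  · linarith [(hball y hy).2.1]
  · exact (fderiv ℝ f y).le_of_opNorm_le (by linarith [(hball y hy).2.2])
  · refine (convex_ball y₀ ρ).norm_image_sub_le_of_norm_hasFDerivWithin_le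
      (fun x hx => (hdiff x hx).hasFDerivWithinAt) (fun x hx => ?_) hy hz
    linarith [(hball x hx).2.2]
  · have hsub : segment ℝ y z ⊆ Metric.ball y₀ ρ := (convex_ball y₀ ρ).segment_subset hy hz
    have := (convex_segment y z).norm_image_sub_le_of_norm_hasFDerivWithin_le' (𝕜 := ℝ) (f := f)
      (f' := fderiv ℝ f) (φ := fderiv ℝ f y) (C := A * ‖z - y‖)
      (fun x hx => (hdiff x (hsub hx)).hasFDerivWithinAt) (fun x hx => by
        have h3 := hK.norm_sub_le (hball x (hsub hx)).1.2 (hball y hy).1.2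
        refine h3.trans ?_
        have h4 : ‖x - y‖ ≤ ‖z - y‖ := by
          obtain ⟨s, hs, rfl⟩ := (segment_eq_image' ℝ y z ▸ hx)
          rw [add_sub_cancel_left, norm_smul, Real.norm_of_nonneg hs.1]
          exact mul_le_of_le_one_left (norm_nonneg _) hs.2
        refine mul_le_mul ?_ h4 (norm_nonneg _) (by positivity)
        linarith) (left_mem_segment ℝ y z) (right_mem_segment ℝ y z)
    rw [pow_two, ← mul_assoc]; exact this

end VectorSpace

/-! ### Perturbation estimates for pushed vectors -/

section VectorSpace

variable {E : Type*} [NormedAddCommGroup E] [NormedSpace ℝ E]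

/-- The Lie derivative of the metric `G` along the field `X`, evaluated on `(v, v)`. It is the rate
at which `G(v, v)` changes when a curve with tangent vector `v` is pushed along `X`. -/
noncomputable def lieForm (G : E → E →L[ℝ] E →L[ℝ] ℝ) (X : E → E) (y v : E) : ℝ :=
  fderiv ℝ G y (X y) v v + 2 * G y (fderiv ℝ X y v) v

/-- Uniform bounds, on the ball of radius `ρ` about `y₀`, for the effect on the metric `G` of
pushing a causal curve along the field `X`, with one constant `A` for all of them: the vector
`v + k • X y + h • fderiv ℝ X y v` is the tangent vector of a curve `c + h • X ∘ c`, where `v` is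
the tangent vector of `c` and `k` is the derivative of `h`. -/
structure PushBounds (G : E → E →L[ℝ] E →L[ℝ] ℝ) (X : E → E) (U : Set E) (y₀ : E) (A ρ : ℝ) :
    Prop where
  one_le : 1 ≤ A
  pos : 0 < ρ
  subset : Metric.ball y₀ ρ ⊆ U
  mem {y : E} (hy : y ∈ Metric.ball y₀ ρ) {h : ℝ} (hh : |h| ≤ ρ) : y + h • X y ∈ U
  clock_le (v : E) : -G y₀ (X y₀) v ≤ A * ‖v‖
  cone {y : E} (hy : y ∈ Metric.ball y₀ ρ) {v : E} (h1 : G y v v ≤ 0) (h2 : G y (X y) v ≤ 0) :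
    ‖v‖ ≤ A * (-G y₀ (X y₀) v) ∧ ‖v‖ ≤ A * (-G y (X y) v)
  lie {y : E} (hy : y ∈ Metric.ball y₀ ρ) (v : E) : |lieForm G X y v| ≤ A * ‖v‖ ^ 2
  metric {y : E} (hy : y ∈ Metric.ball y₀ ρ) {h : ℝ} (hh : |h| ≤ ρ) (v : E) (k : ℝ) :
    G (y + h • X y) (v + k • X y + h • fderiv ℝ X y v) (v + k • X y + h • fderiv ℝ X y v) ≤
      G y v v + h * lieForm G X y v + 2 * k * G y (X y) v + A * (|h| * ‖v‖ + |k|) ^ 2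
  clock {y : E} (hy : y ∈ Metric.ball y₀ ρ) {h : ℝ} (hh : |h| ≤ ρ) (v : E) (k : ℝ) :
    G (y + h • X y) (X (y + h • X y)) (v + k • X y + h • fderiv ℝ X y v) ≤
      G y (X y) v + A * (|h| * ‖v‖ + |k|)

theorem abs_apply_le {B : E →L[ℝ] E →L[ℝ] ℝ} {C c d : ℝ} {v w : E} (hB : ‖B‖ ≤ C) (hv : ‖v‖ ≤ c)
    (hw : ‖w‖ ≤ d) : |B v w| ≤ C * c * d := by
  have h := B.le_opNorm₂ v w
  rw [Real.norm_eq_abs] at h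
  have hc := (norm_nonneg v).trans hv
  have hC := (norm_nonneg B).trans hB
  exact h.trans (by gcongr)

/-- Second order expansion of a quadratic form whose coefficients and argument are perturbed. -/
theorem perturbed_form_le {B D Bz : E →L[ℝ] E →L[ℝ] ℝ} (hB : ∀ v w, B v w = B w v)
    {a h k : ℝ} {x y v : E} (ha1 : 1 ≤ a) (hh : |h| ≤ 1) (bB : ‖B‖ ≤ a)
    (bδ : ‖Bz - B‖ ≤ a ^ 2 * |h|) (hRb : ‖Bz - B - h • D‖ ≤ a ^ 3 * |h| ^ 2)
    (hwd : ‖k • x + h • y‖ ≤ a * (|h| * ‖v‖ + |k|)) :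
    Bz (v + k • x + h • y) (v + k • x + h • y) ≤
      B v v + h * (D v v + 2 * B y v) + 2 * k * B x v + 5 * a ^ 4 * (|h| * ‖v‖ + |k|) ^ 2 := by
  set w := k • x + h • y with hw
  set d := |h| * ‖v‖ + |k| with hd
  have ha0 : 0 < a := by linarith
  have ha34 : a ^ 3 ≤ a ^ 4 := pow_le_pow_right₀ ha1 (by norm_num)
  have hn := norm_nonneg v
  have hh0 := abs_nonneg h
  have hk0 := abs_nonneg k
  have hhn : 0 ≤ |h| * ‖v‖ := mul_nonneg hh0 hn
  have hd0 : 0 ≤ d := by linarith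
  have hnd : |h| * ‖v‖ ≤ d := by linarith
  have e : Bz (v + w) (v + w) = (B v v + h * (D v v + 2 * B y v) + 2 * k * B x v) +
      (B w w + (Bz - B - h • D) v v + (Bz - B) v w + (Bz - B) w v + (Bz - B) w w) := by
    have e1 : B v w = k * B x v + h * B y v := by
      rw [hB, hw]; simp only [map_add, map_smul, add_apply, smul_apply, smul_eq_mul]
    have e2 : B w v = B v w := hB w v
    simp only [map_add, add_apply, sub_apply, smul_apply, smul_eq_mul]
    rw [e2, e1]; ring
  have t1 := (abs_le.1 (abs_apply_le bB hwd hwd)).2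
  have t2 := (abs_le.1 (abs_apply_le hRb (le_refl ‖v‖) (le_refl ‖v‖))).2
  have t3 := (abs_le.1 (abs_apply_le bδ (le_refl ‖v‖) hwd)).2
  have t4 := (abs_le.1 (abs_apply_le bδ hwd (le_refl ‖v‖))).2
  have t5 := (abs_le.1 (abs_apply_le bδ hwd hwd)).2
  have s1 : a * (a * d) * (a * d) ≤ a ^ 4 * d ^ 2 := by
    have : a * (a * d) * (a * d) = a ^ 3 * d ^ 2 := by ring
    rw [this]; exact mul_le_mul_of_nonneg_right ha34 (sq_nonneg d)
  have hnd2 : (|h| * ‖v‖) ^ 2 ≤ d ^ 2 := pow_le_pow_left₀ hhn hnd 2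
  have s2 : a ^ 3 * |h| ^ 2 * ‖v‖ * ‖v‖ ≤ a ^ 4 * d ^ 2 := by
    have : a ^ 3 * |h| ^ 2 * ‖v‖ * ‖v‖ = a ^ 3 * (|h| * ‖v‖) ^ 2 := by ring
    rw [this]; gcongr
  have s3 : a ^ 2 * |h| * ‖v‖ * (a * d) ≤ a ^ 4 * d ^ 2 := by
    have : a ^ 2 * |h| * ‖v‖ * (a * d) = a ^ 3 * ((|h| * ‖v‖) * d) := by ring
    rw [this, pow_two d]; gcongr
  have s5 : a ^ 2 * |h| * (a * d) * (a * d) ≤ a ^ 4 * d ^ 2 := by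
    have : a ^ 2 * |h| * (a * d) * (a * d) = |h| * (a ^ 4 * d ^ 2) := by ring
    rw [this]
    exact mul_le_of_le_one_left (by positivity) hh
  have : v + k • x + h • y = v + w := by rw [hw]; abel
  rw [this, e]
  nlinarith

/-- First order expansion of the time component of a vector, with perturbed coefficients `Bz` and
`xz` and perturbed argument. -/
theorem perturbed_clock_le {B Bz : E →L[ℝ] E →L[ℝ] ℝ}
    {a h k : ℝ} {x xz y v : E} (ha1 : 1 ≤ a) (hh : |h| ≤ 1) (bB : ‖B‖ ≤ a)
    (bδ : ‖Bz - B‖ ≤ a ^ 2 * |h|) (bx : ‖x‖ ≤ a) (bxz : ‖xz‖ ≤ a)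
    (hXz : ‖xz - x‖ ≤ a ^ 2 * |h|) (hwd : ‖k • x + h • y‖ ≤ a * (|h| * ‖v‖ + |k|)) :
    Bz xz (v + k • x + h • y) ≤ B x v + 5 * a ^ 4 * (|h| * ‖v‖ + |k|) := by
  set w := k • x + h • y with hw
  set d := |h| * ‖v‖ + |k| with hd
  have ha0 : 0 < a := by linarith
  have ha34 : a ^ 3 ≤ a ^ 4 := pow_le_pow_right₀ ha1 (by norm_num)
  have hn := norm_nonneg v
  have hh0 := abs_nonneg h
  have hk0 := abs_nonneg k
  have hhn : 0 ≤ |h| * ‖v‖ := mul_nonneg hh0 hn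
  have hd0 : 0 ≤ d := by linarith
  have hnd : |h| * ‖v‖ ≤ d := by linarith
  have huw : ‖v + w‖ ≤ ‖v‖ + a * d := (norm_add_le v w).trans (by linarith)
  have e : Bz xz (v + w) = B x v + ((Bz - B) xz (v + w) + B (xz - x) (v + w) + B x w) := by
    simp only [map_add, map_sub, sub_apply]; ring
  have t1 := (abs_le.1 (abs_apply_le bδ bxz huw)).2
  have t2 := (abs_le.1 (abs_apply_le bB hXz huw)).2
  have t3 := (abs_le.1 (abs_apply_le bB bx hwd)).2
  have s0 : |h| * (‖v‖ + a * d) ≤ (1 + a) * d := by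
    have : |h| * (a * d) ≤ a * d := mul_le_of_le_one_left (by positivity) hh
    linarith
  have s1 : a ^ 2 * |h| * a * (‖v‖ + a * d) ≤ 2 * a ^ 4 * d := by
    have : a ^ 2 * |h| * a * (‖v‖ + a * d) = a ^ 3 * (|h| * (‖v‖ + a * d)) := by ring
    rw [this]
    calc a ^ 3 * (|h| * (‖v‖ + a * d)) ≤ a ^ 3 * ((1 + a) * d) := by gcongr
      _ = (a ^ 3 + a ^ 4) * d := by ring
      _ ≤ _ := by nlinarith
  have s2 : a * (a ^ 2 * |h|) * (‖v‖ + a * d) ≤ 2 * a ^ 4 * d := by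
    refine le_trans (le_of_eq ?_) s1; ring
  have s3 : a * a * (a * d) ≤ a ^ 4 * d := by
    have : a * a * (a * d) = a ^ 3 * d := by ring
    rw [this]; gcongr
  have : v + k • x + h • y = v + w := by rw [hw]; abel
  rw [this, e]
  linarith

/-- Smoothness and the Lorentzian signature give the bounds near every point. The radius is chosen
so small that the pushed points stay in the ball of radius `r` on which the Taylor and cone bounds
hold. -/
theorem exists_pushBounds [FiniteDimensional ℝ E] {G : E → E →L[ℝ] E →L[ℝ] ℝ} {X : E → E}
    {U : Set E} (hU : IsOpen U) (hG : ContDiffOn ℝ ∞ G U) (hX : ContDiffOn ℝ ∞ X U)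
    (hs : ∀ y v w, G y v w = G y w v) {y₀ : E} (hy₀ : y₀ ∈ U)
    (hL : ∃ v, G y₀ v v < 0 ∧ ∀ w, w ≠ 0 → G y₀ v w = 0 → 0 < G y₀ w w)
    (hX0 : G y₀ (X y₀) (X y₀) < 0) : ∃ A ρ, PushBounds G X U y₀ A ρ := by
  have hGc := hG.continuousOn.continuousAt (hU.mem_nhds hy₀)
  have hXc := hX.continuousOn.continuousAt (hU.mem_nhds hy₀)
  obtain ⟨A₁, hA₁, h₁⟩ := exists_cone_bound (hs y₀) hL hX0 hGc hXc
  obtain ⟨ρ₁, hρ₁, hcone⟩ := Metric.eventually_nhds_iff_ball.1 h₁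
  obtain ⟨A₂, hA₂, ρ₂, hρ₂, hU₂, hG₂⟩ := exists_taylor_bound hU hG hy₀
  obtain ⟨A₃, hA₃, ρ₃, hρ₃, hU₃, hX₃⟩ := exists_taylor_bound hU hX hy₀
  set a := 1 + A₁ + A₂ + A₃ with ha
  have ha1 : 1 ≤ a := by linarith
  have ha0 : 0 < a := by linarith
  set r := min ρ₁ (min ρ₂ ρ₃) with hr
  have hr0 : 0 < r := lt_min hρ₁ (lt_min hρ₂ hρ₃)
  have hr1 : r ≤ ρ₁ := min_le_left _ _
  have hr2 : r ≤ ρ₂ := (min_le_right _ _).trans (min_le_left _ _)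
  have hr3 : r ≤ ρ₃ := (min_le_right _ _).trans (min_le_right _ _)
  set ρ := min 1 (r / (2 * a)) with hρ
  have hρ0 : 0 < ρ := lt_min one_pos (by positivity)
  have hρ1 : ρ ≤ 1 := min_le_left _ _
  have hρa : ρ * (2 * a) ≤ r := (le_div_iff₀ (by positivity)).1 (min_le_right _ _)
  have hρr : ρ ≤ r / 2 := by nlinarith
  have hsub : ∀ {y}, y ∈ Metric.ball y₀ ρ → y ∈ Metric.ball y₀ r := fun hy =>
    Metric.ball_subset_ball (by linarith) hy
  have bG : ∀ {y}, y ∈ Metric.ball y₀ r → ‖G y‖ ≤ a := fun hy =>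
    (hG₂ _ (Metric.ball_subset_ball hr2 hy)).1.trans (by linarith)
  have bX : ∀ {y}, y ∈ Metric.ball y₀ r → ‖X y‖ ≤ a := fun hy =>
    (hX₃ _ (Metric.ball_subset_ball hr3 hy)).1.trans (by linarith)
  have bDG : ∀ {y}, y ∈ Metric.ball y₀ r → ∀ w, ‖fderiv ℝ G y w‖ ≤ a * ‖w‖ :=
    fun hy w => ((hG₂ _ (Metric.ball_subset_ball hr2 hy)).2.1 w).trans
      (mul_le_mul_of_nonneg_right (by linarith) (norm_nonneg w))
  have bDX : ∀ {y}, y ∈ Metric.ball y₀ r → ∀ w, ‖fderiv ℝ X y w‖ ≤ a * ‖w‖ :=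
    fun hy w => ((hX₃ _ (Metric.ball_subset_ball hr3 hy)).2.1 w).trans
      (mul_le_mul_of_nonneg_right (by linarith) (norm_nonneg w))
  have bhX : ∀ {y}, y ∈ Metric.ball y₀ r → ∀ h : ℝ, ‖h • X y‖ ≤ |h| * a := fun hy h => by
    rw [norm_smul, Real.norm_eq_abs]; exact mul_le_mul_of_nonneg_left (bX hy) (abs_nonneg h)
  have hmem : ∀ {y}, y ∈ Metric.ball y₀ ρ → ∀ {h : ℝ}, |h| ≤ ρ →
      y + h • X y ∈ Metric.ball y₀ r := by
    intro y hy h hh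
    rw [mem_ball_iff_norm, add_sub_right_comm]
    have h1 := bhX (hsub hy) h
    have h2 := mem_ball_iff_norm.1 hy
    have h3 : |h| * a ≤ ρ * a := mul_le_mul_of_nonneg_right hh ha0.le
    linarith [norm_add_le (y - y₀) (h • X y)]
  have hy₀r : y₀ ∈ Metric.ball y₀ r := Metric.mem_ball_self hr0
  -- the tangent vector differs from `v` by a vector of size `|h| * ‖v‖ + |k|`
  have bw : ∀ {y}, y ∈ Metric.ball y₀ r → ∀ (h : ℝ) (v : E) (k : ℝ),
      ‖k • X y + h • fderiv ℝ X y v‖ ≤ a * (|h| * ‖v‖ + |k|) := by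
    intro y hy h v k
    have h1 := bhX hy k
    have h2 : ‖h • fderiv ℝ X y v‖ ≤ |h| * (a * ‖v‖) := by
      rw [norm_smul, Real.norm_eq_abs]
      exact mul_le_mul_of_nonneg_left (bDX hy v) (abs_nonneg h)
    linarith [norm_add_le (k • X y) (h • fderiv ℝ X y v)]
  have bδ : ∀ {y}, y ∈ Metric.ball y₀ ρ → ∀ {h : ℝ}, |h| ≤ ρ →
      ‖G (y + h • X y) - G y‖ ≤ a ^ 2 * |h| := by
    intro y hy h hh
    have h1 := ((hG₂ y (Metric.ball_subset_ball hr2 (hsub hy))).2.2 _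
      (Metric.ball_subset_ball hr2 (hmem hy hh))).1
    rw [add_sub_cancel_left] at h1
    have h2 := bhX (hsub hy) h
    calc _ ≤ A₂ * ‖h • X y‖ := h1
      _ ≤ a * (|h| * a) := by gcongr; linarith
      _ = _ := by ring
  have ha2 : a ≤ a ^ 4 := le_self_pow₀ ha1 (by norm_num)
  have ha24 : a ^ 2 ≤ a ^ 4 := pow_le_pow_right₀ ha1 (by norm_num)
  refine ⟨5 * a ^ 4, ρ, ⟨by nlinarith, hρ0, ?_, ?_, ?_, ?_, ?_, ?_, ?_⟩⟩
  · exact fun y hy => hU₂ (Metric.ball_subset_ball hr2 (hsub hy))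
  · exact fun hy h hh => hU₂ (Metric.ball_subset_ball hr2 (hmem hy hh))
  · intro v
    have := (abs_le.1 (abs_apply_le (bG hy₀r) (bX hy₀r) (le_refl ‖v‖))).1
    nlinarith [norm_nonneg v]
  · intro y hy v h1 h2
    obtain ⟨h3, h4⟩ := hcone y (Metric.ball_subset_ball hr1 (hsub hy)) v h1 h2
    have hv := norm_nonneg v
    have h5 : A₁ ≤ 5 * a ^ 4 := by nlinarith
    constructor
    · refine h3.trans (mul_le_mul_of_nonneg_right h5 ?_)
      by_contra! hcon
      have := mul_neg_of_pos_of_neg hA₁ hcon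
      linarith
    · exact h4.trans (mul_le_mul_of_nonneg_right h5 (by linarith))
  · intro y hy v
    have h1 : ‖fderiv ℝ G y (X y)‖ ≤ a * a :=
      (bDG (hsub hy) _).trans (mul_le_mul_of_nonneg_left (bX (hsub hy)) ha0.le)
    have h2 := abs_apply_le h1 (le_refl ‖v‖) (le_refl ‖v‖)
    have h3 : ‖fderiv ℝ X y v‖ ≤ a * ‖v‖ := bDX (hsub hy) v
    have h4 := abs_apply_le (bG (hsub hy)) h3 (le_refl ‖v‖)
    rw [lieForm]
    refine (abs_add_le _ _).trans ?_
    rw [abs_mul, abs_two]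
    nlinarith [sq_nonneg ‖v‖]
  · intro y hy h hh v k
    have hRb : ‖G (y + h • X y) - G y - h • fderiv ℝ G y (X y)‖ ≤ a ^ 3 * |h| ^ 2 := by
      have h1 := ((hG₂ y (Metric.ball_subset_ball hr2 (hsub hy))).2.2 _
        (Metric.ball_subset_ball hr2 (hmem hy hh))).2
      rw [add_sub_cancel_left, (fderiv ℝ G y).map_smul] at h1
      have h2 := bhX (hsub hy) h
      calc _ ≤ A₂ * ‖h • X y‖ ^ 2 := h1
        _ ≤ a * (|h| * a) ^ 2 := by gcongr; linarith
        _ = _ := by ring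
    exact perturbed_form_le (hs y) ha1 (hh.trans hρ1) (bG (hsub hy)) (bδ hy hh) hRb
      (bw (hsub hy) h v k)
  · intro y hy h hh v k
    have hXz : ‖X (y + h • X y) - X y‖ ≤ a ^ 2 * |h| := by
      have h1 := ((hX₃ y (Metric.ball_subset_ball hr3 (hsub hy))).2.2 _
        (Metric.ball_subset_ball hr3 (hmem hy hh))).1
      rw [add_sub_cancel_left] at h1
      have h2 := bhX (hsub hy) h
      calc _ ≤ A₃ * ‖h • X y‖ := h1
        _ ≤ a * (|h| * a) := by gcongr; linarith
        _ = _ := by ring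
    exact perturbed_clock_le ha1 (hh.trans hρ1) (bG (hsub hy)) (bδ hy hh) (bX (hsub hy))
      (bX (hmem hy hh)) hXz (bw (hsub hy) h v k)

end VectorSpace

/-! ### Pushing a timelike arc -/

section VectorSpace

variable {E : Type*} [NormedAddCommGroup E] [NormedSpace ℝ E]

/-- The mean value inequality, with a function whose derivative dominates. -/
theorem norm_sub_le_of_norm_deriv_le {F : Type*} [NormedAddCommGroup F] [NormedSpace ℝ F]
    {f f' : ℝ → F} {β β' : ℝ → ℝ} {a b : ℝ}
    (hf : ∀ t ∈ Icc a b, HasDerivWithinAt f (f' t) (Icc a b) t)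
    (hβ : ∀ t ∈ Icc a b, HasDerivWithinAt β (β' t) (Icc a b) t)
    (h : ∀ t ∈ Icc a b, ‖f' t‖ ≤ β' t) {t : ℝ} (ht : t ∈ Icc a b) :
    ‖f t - f a‖ ≤ β t - β a := by
  have hmem : ∀ x ∈ Ico a b, Icc a b ∈ 𝓝[≥] x := fun x hx =>
    mem_of_superset (Icc_mem_nhdsGE hx.2) (Icc_subset_Icc hx.1 le_rfl)
  refine image_norm_le_of_norm_deriv_right_le_deriv_boundary' (f := fun t => f t - f a)
    (B := fun t => β t - β a) (f' := f') (B' := β') ?_ ?_ ?_ ?_ ?_ ?_ ht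
  · exact fun x hx => ((hf x hx).continuousWithinAt).sub continuousWithinAt_const
  · intro x hx
    exact ((hf x (Ico_subset_Icc_self hx)).mono_of_mem_nhdsWithin (hmem x hx)).sub_const _
  · simp
  · exact fun x hx => ((hβ x hx).continuousWithinAt).sub continuousWithinAt_const
  · intro x hx
    exact ((hβ x (Ico_subset_Icc_self hx)).mono_of_mem_nhdsWithin (hmem x hx)).sub_const _
  · exact fun x hx => h x (Ico_subset_Icc_self hx)

theorem continuousOn_fderiv_apply {F : Type*} [NormedAddCommGroup F] [NormedSpace ℝ F] {f : E → F}
    {U : Set E} (hU : IsOpen U) (hf : ContDiffOn ℝ ∞ f U) {c w : ℝ → E} {s : Set ℝ}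
    (hc : ContinuousOn c s) (hcU : ∀ t ∈ s, c t ∈ U) (hw : ContinuousOn w s) :
    ContinuousOn (fun t => fderiv ℝ f (c t) (w t)) s :=
  ((hf.continuousOn_fderiv_of_isOpen hU (by simp)).comp hc hcU).clm_apply hw

/-- The linear time function of the metric `G` near `y₀`: the product with the time field, with the
coefficients frozen at `y₀`, and with the sign that makes it increase to the future. -/
noncomputable def linearClock (G : E → E →L[ℝ] E →L[ℝ] ℝ) (X : E → E) (y₀ : E) : E →L[ℝ] ℝ :=
  -(G y₀ (X y₀))

namespace PushBounds

variable {G : E → E →L[ℝ] E →L[ℝ] ℝ} {X : E → E} {U : Set E} {y₀ : E} {A ρ : ℝ}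
  {c : ℝ → E} {a b : ℝ}

theorem hasDerivWithinAt_linearClock (hc : ContDiffOn ℝ 1 c (Icc a b)) {t : ℝ} (ht : t ∈ Icc a b) :
    HasDerivWithinAt (fun t => linearClock G X y₀ (c t))
      (linearClock G X y₀ (derivWithin c (Icc a b) t)) (Icc a b) t :=
  (linearClock G X y₀).hasFDerivAt.comp_hasDerivWithinAt t
    (hc.differentiableOn one_ne_zero t ht).hasDerivWithinAt

/-- The displacement of a timelike curve is bounded by the increase of the linear time function. -/
theorem norm_sub_le_linearClock (P : PushBounds G X U y₀ A ρ) (hc : ContDiffOn ℝ 1 c (Icc a b))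
    (hball : ∀ t ∈ Icc a b, c t ∈ Metric.ball y₀ ρ)
    (hT : ∀ t ∈ Icc a b, G (c t) (derivWithin c (Icc a b) t) (derivWithin c (Icc a b) t) < 0 ∧
      G (c t) (X (c t)) (derivWithin c (Icc a b) t) < 0) {t : ℝ} (ht : t ∈ Icc a b) :
    ‖c t - c a‖ ≤ A * (linearClock G X y₀ (c t) - linearClock G X y₀ (c a)) := by
  have h := norm_sub_le_of_norm_deriv_le (f := c) (β := fun t => A * linearClock G X y₀ (c t))
    (fun t ht => (hc.differentiableOn one_ne_zero t ht).hasDerivWithinAt)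
    (fun t ht => (hasDerivWithinAt_linearClock hc ht).const_mul A)
    (fun t ht => (P.cone (hball t ht) (hT t ht).1.le (hT t ht).2.le).1) ht
  linarith

end PushBounds

/-- A `C¹` function with prescribed continuous derivative on an interval. -/
theorem exists_primitive {q : ℝ → ℝ} {a b : ℝ} (hab : a < b) (hq : ContinuousOn q (Icc a b)) :
    ∃ I : ℝ → ℝ, ContDiff ℝ 1 I ∧ I a = 0 ∧ ∀ t ∈ Icc a b, HasDerivAt I (q t) t := by
  have hcont : Continuous (IccExtend hab.le ((Icc a b).domRestrict q)) :=
    (continuousOn_iff_continuous_domRestrict.1 hq).Icc_extend'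
  have hd : ∀ t, HasDerivAt (fun u => ∫ x in a..u, IccExtend hab.le ((Icc a b).domRestrict q) x)
      (IccExtend hab.le ((Icc a b).domRestrict q) t) t := fun t =>
    (hcont.integral_hasStrictDerivAt a t).hasDerivAt
  refine ⟨fun u => ∫ x in a..u, IccExtend hab.le ((Icc a b).domRestrict q) x,
    contDiff_one_iff_deriv.2 ⟨fun t => (hd t).differentiableAt, ?_⟩, by simp, fun t ht => ?_⟩
  · rw [show deriv (fun u => ∫ x in a..u, IccExtend hab.le ((Icc a b).domRestrict q) x) =
      IccExtend hab.le ((Icc a b).domRestrict q) from funext fun t => (hd t).deriv]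
    exact hcont
  · have := hd t
    rwa [IccExtend_of_mem hab.le _ ht] at this

namespace PushBounds

variable {G : E → E →L[ℝ] E →L[ℝ] ℝ} {X : E → E} {U : Set E} {y₀ : E} {A ρ : ℝ}

/-- The pointwise estimate behind the push: if the size `h` of the push grows along the curve like
the solution of the linearised equation, up to a further growth `s` of order `h²`, then the pushed
vector is timelike, with length at least `|h| * ‖v‖`. -/
theorem pushed_timelike (P : PushBounds G X U y₀ A ρ) {y : E} (hy : y ∈ Metric.ball y₀ ρ) {v : E}
    (h1 : G y v v < 0) (h2 : G y (X y) v < 0) {h k s : ℝ} (hh : |h| ≤ ρ)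
    (hh' : 4 * A ^ 4 * |h| ≤ 1)
    (hk : k = lieForm G X y v / (2 * (-G y (X y) v)) * h + s)
    (hs1 : 5 * A ^ 6 * h ^ 2 * ‖v‖ ≤ s) (hs2 : s ≤ A * |h| * ‖v‖) :
    h ^ 2 * ‖v‖ ^ 2 ≤ -G (y + h • X y) (v + k • X y + h • fderiv ℝ X y v)
        (v + k • X y + h • fderiv ℝ X y v) ∧
      G (y + h • X y) (X (y + h • X y)) (v + k • X y + h • fderiv ℝ X y v) < 0 := by
  have hA := P.one_le
  have hA0 : 0 < A := by linarith
  set ww := -G y (X y) v with hw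
  set n := ‖v‖ with hn
  have hww0 : 0 < ww := by linarith
  have hnww : n ≤ A * ww := (P.cone hy h1.le h2.le).2
  have hv0 : v ≠ 0 := by rintro rfl; simp at h1
  have hn0 : 0 < n := norm_pos_iff.2 hv0
  have hQ := P.lie hy v
  set Q := lieForm G X y v with hQd
  have hah := abs_nonneg h
  have hs0 : 0 ≤ s := le_trans (by positivity) hs1
  have hq : |Q / (2 * ww)| ≤ A ^ 2 * n := by
    rw [abs_div, abs_of_pos (by linarith : 0 < 2 * ww), div_le_iff₀ (by linarith)]
    calc |Q| ≤ A * n ^ 2 := hQ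
      _ ≤ A * (n * (A * ww)) := by rw [pow_two]; gcongr
      _ ≤ A ^ 2 * n * (2 * ww) := by nlinarith [mul_pos (mul_pos (pow_pos hA0 2) hn0) hww0]
  have hkb : |k| ≤ 2 * A ^ 2 * (|h| * n) := by
    rw [hk]
    refine (abs_add_le _ _).trans ?_
    rw [abs_mul, abs_of_nonneg hs0]
    have e1 : |Q / (2 * ww)| * |h| ≤ A ^ 2 * n * |h| := mul_le_mul_of_nonneg_right hq hah
    have e2 : A * |h| * n ≤ A ^ 2 * (|h| * n) := by
      rw [mul_assoc]; exact mul_le_mul_of_nonneg_right (by nlinarith) (by positivity)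
    linarith
  have hd : |h| * n + |k| ≤ 3 * A ^ 2 * (|h| * n) := by
    have : |h| * n ≤ A ^ 2 * (|h| * n) := le_mul_of_one_le_left (by positivity) (one_le_pow₀ hA)
    linarith
  have hd0 : 0 ≤ |h| * n + |k| := by positivity
  constructor
  · have hm := P.metric hy hh v k
    have e1 : h * Q + 2 * k * G y (X y) v = -(2 * s * ww) := by
      rw [hk, show G y (X y) v = -ww by linarith]; field_simp; ring
    have e2 : A * (|h| * n + |k|) ^ 2 ≤ 9 * A ^ 5 * (h ^ 2 * n ^ 2) := by
      calc A * (|h| * n + |k|) ^ 2 ≤ A * (3 * A ^ 2 * (|h| * n)) ^ 2 := by gcongr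
        _ = 9 * A ^ 5 * (|h| ^ 2 * n ^ 2) := by ring
        _ = _ := by rw [sq_abs]
    have e3 : 10 * A ^ 5 * (h ^ 2 * n ^ 2) ≤ 2 * s * ww := by
      calc 10 * A ^ 5 * (h ^ 2 * n ^ 2) = 2 * (5 * A ^ 5 * h ^ 2 * n) * n := by ring
        _ ≤ 2 * (5 * A ^ 5 * h ^ 2 * n) * (A * ww) := by gcongr
        _ = 2 * (5 * A ^ 6 * h ^ 2 * n) * ww := by ring
        _ ≤ 2 * s * ww := by gcongr
    have e4 : h ^ 2 * n ^ 2 ≤ A ^ 5 * (h ^ 2 * n ^ 2) :=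
      le_mul_of_one_le_left (by positivity) (one_le_pow₀ hA)
    linarith
  · have hm := P.clock hy hh v k
    have e1 : A * (|h| * n + |k|) ≤ A * (3 * A ^ 2 * (|h| * n)) :=
      mul_le_mul_of_nonneg_left hd hA0.le
    have e2 : A * (3 * A ^ 2 * (|h| * n)) * (4 * A) ≤ 3 * n := by
      calc A * (3 * A ^ 2 * (|h| * n)) * (4 * A) = 3 * (4 * A ^ 4 * |h|) * n := by ring
        _ ≤ 3 * 1 * n := by gcongr
        _ = 3 * n := by ring
    have e3 : A * (3 * A ^ 2 * (|h| * n)) < ww := by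
      by_contra! hcon
      have : ww * (4 * A) ≤ 3 * n := (mul_le_mul_of_nonneg_right hcon (by positivity)).trans e2
      nlinarith
    have : G y (X y) v = -ww := by linarith
    linarith

/-- Pushing a timelike `C¹` arc along `X`. The number `exp ε` is the factor by which the linearised
equation stretches the push along the arc; the nonlinear terms are controlled by letting the inverse
of the normalised size of the push decrease linearly with the time function, at the rate `B`.
Positive sizes push to the future and negative ones to the past. The initial factor `κ` allows the
lemma to be applied to consecutive arcs; `Λ₁` and `Λ₂` bound the normalising factor on the arc, and
`Y` bounds the normalised inverse, which determines the length gained. -/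
theorem exists_pushed_arc (P : PushBounds G X U y₀ A ρ) (hU : IsOpen U) (hG : ContDiffOn ℝ ∞ G U)
    (hX : ContDiffOn ℝ ∞ X U) {c : ℝ → E} {a b : ℝ} (hab : a < b)
    (hc : ContDiffOn ℝ 1 c (Icc a b)) (hball : ∀ t ∈ Icc a b, c t ∈ Metric.ball y₀ ρ)
    (hT : ∀ t ∈ Icc a b, G (c t) (derivWithin c (Icc a b) t) (derivWithin c (Icc a b) t) < 0 ∧
      G (c t) (X (c t)) (derivWithin c (Icc a b) t) < 0) :
    ∃ ε : ℝ, |ε| ≤ A ^ 3 * (linearClock G X y₀ (c b) - linearClock G X y₀ (c a)) ∧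
      ∀ B Λ₁ Λ₂ κ r Y : ℝ, 0 < Λ₁ → 0 < κ →
        Λ₁ ≤ κ * Real.exp (-(A ^ 3 * (linearClock G X y₀ (c b) - linearClock G X y₀ (c a)))) →
        κ * Real.exp (A ^ 3 * (linearClock G X y₀ (c b) - linearClock G X y₀ (c a))) ≤ Λ₂ →
        5 * A ^ 7 * Λ₂ ≤ B →
        (∀ t ∈ Icc a b, B ≤ |r - B * linearClock G X y₀ (c t)| ∧
          Λ₂ ≤ ρ * |r - B * linearClock G X y₀ (c t)| ∧
          4 * A ^ 4 * Λ₂ ≤ |r - B * linearClock G X y₀ (c t)| ∧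
          |r - B * linearClock G X y₀ (c t)| ≤ Y) →
        ∃ d : ℝ → E, ContDiffOn ℝ 1 d (Icc a b) ∧
          d a = c a + (κ / (r - B * linearClock G X y₀ (c a))) • X (c a) ∧
          d b = c b + (κ * Real.exp ε / (r - B * linearClock G X y₀ (c b))) • X (c b) ∧
          ∀ t ∈ Icc a b, d t ∈ U ∧
            G (d t) (derivWithin d (Icc a b) t) (derivWithin d (Icc a b) t) < 0 ∧
            G (d t) (X (d t)) (derivWithin d (Icc a b) t) < 0 ∧
            Λ₁ / (A * Y) * linearClock G X y₀ (derivWithin c (Icc a b) t) ≤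
              Real.sqrt (-G (d t) (derivWithin d (Icc a b) t) (derivWithin d (Icc a b) t)) := by
  have hA := P.one_le
  have hA0 : 0 < A := by linarith
  set ℓ := linearClock G X y₀ with hℓ
  set v := fun t => derivWithin c (Icc a b) t with hv
  have hcv : ∀ t ∈ Icc a b, HasDerivWithinAt c (v t) (Icc a b) t := fun t ht =>
    (hc.differentiableOn one_ne_zero t ht).hasDerivWithinAt
  have hcU : ∀ t ∈ Icc a b, c t ∈ U := fun t ht => P.subset (hball t ht)
  have hvc : ContinuousOn v (Icc a b) :=
    hc.continuousOn_derivWithin (uniqueDiffOn_Icc hab) le_rfl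
  have hGc : ContinuousOn (fun t => G (c t)) (Icc a b) := hG.continuousOn.comp hc.continuousOn hcU
  have hXc : ContinuousOn (fun t => X (c t)) (Icc a b) := hX.continuousOn.comp hc.continuousOn hcU
  have hdG : ContinuousOn (fun t => fderiv ℝ G (c t) (X (c t))) (Icc a b) :=
    continuousOn_fderiv_apply hU hG hc.continuousOn hcU hXc
  have hdX : ContinuousOn (fun t => fderiv ℝ X (c t) (v t)) (Icc a b) :=
    continuousOn_fderiv_apply hU hX hc.continuousOn hcU hvc
  -- `h' = q * h` is the equation under which the push preserves `G(v, v)` to first order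
  set q := fun t => lieForm G X (c t) (v t) / (2 * (-G (c t) (X (c t)) (v t))) with hq
  have hqc : ContinuousOn q (Icc a b) := by
    refine ContinuousOn.div ?_ ?_ fun t ht => ?_
    · exact ((hdG.clm_apply hvc).clm_apply hvc).add
        (continuousOn_const.mul ((hGc.clm_apply hdX).clm_apply hvc))
    · exact continuousOn_const.mul ((hGc.clm_apply hXc).clm_apply hvc).neg
    · have := (hT t ht).2
      have : 0 < -G (c t) (X (c t)) (v t) := by simp only [hv]; linarith
      positivity
  obtain ⟨I, hI1, hIa, hId⟩ := exists_primitive hab hqc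
  have hℓv : ∀ t ∈ Icc a b, ‖v t‖ ≤ A * ℓ (v t) := fun t ht =>
    (P.cone (hball t ht) (hT t ht).1.le (hT t ht).2.le).1
  have hℓle : ∀ w, ℓ w ≤ A * ‖w‖ := P.clock_le
  have hqb : ∀ t ∈ Icc a b, ‖q t‖ ≤ A ^ 3 * ℓ (v t) := by
    intro t ht
    have h1 := (hT t ht).2
    set ww := -G (c t) (X (c t)) (v t) with hw
    have hww0 : 0 < ww := by simp only [hw, hv]; linarith
    have hnww : ‖v t‖ ≤ A * ww := (P.cone (hball t ht) (hT t ht).1.le (hT t ht).2.le).2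
    have hn := norm_nonneg (v t)
    have hl := hℓv t ht
    have hQ := P.lie (hball t ht) (v t)
    rw [Real.norm_eq_abs, hq]
    simp only
    rw [abs_div, abs_of_pos (by linarith : 0 < 2 * ww), div_le_iff₀ (by linarith)]
    have hl0 : 0 ≤ ℓ (v t) := by
      by_contra! hcon
      have := mul_neg_of_pos_of_neg hA0 hcon
      linarith
    calc |lieForm G X (c t) (v t)| ≤ A * ‖v t‖ ^ 2 := hQ
      _ ≤ A * ((A * ℓ (v t)) * (A * ww)) := by rw [pow_two]; gcongr
      _ = A ^ 3 * ℓ (v t) * ww := by ring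
      _ ≤ _ := by nlinarith [mul_nonneg (mul_nonneg (pow_pos hA0 3).le hl0) hww0.le]
  have hℓd : ∀ t ∈ Icc a b, HasDerivWithinAt (fun t => ℓ (c t)) (ℓ (v t)) (Icc a b) t :=
    fun t ht => hasDerivWithinAt_linearClock hc ht
  have hIb : ∀ t ∈ Icc a b, |I t| ≤ A ^ 3 * (ℓ (c t) - ℓ (c a)) := by
    intro t ht
    have := norm_sub_le_of_norm_deriv_le (f := I) (β := fun t => A ^ 3 * ℓ (c t))
      (fun t ht => (hId t ht).hasDerivWithinAt) (fun t ht => (hℓd t ht).const_mul (A ^ 3)) hqb ht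
    rw [hIa, sub_zero, Real.norm_eq_abs] at this
    linarith
  have hmono : ∀ t ∈ Icc a b, ℓ (c t) ≤ ℓ (c b) := by
    intro t ht
    have hsub : Icc t b ⊆ Icc a b := Icc_subset_Icc ht.1 le_rfl
    have := norm_sub_le_of_norm_deriv_le (f := fun _ : ℝ => (0 : ℝ)) (f' := fun _ => 0)
      (β := fun t => A * ℓ (c t)) (a := t) (b := b)
      (fun s _ => hasDerivWithinAt_const _ _ _)
      (fun s hs => ((hℓd s (hsub hs)).mono hsub).const_mul A)
      (fun s hs => by rw [norm_zero]; exact (norm_nonneg _).trans (hℓv s (hsub hs)))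
      (right_mem_Icc.2 ht.2)
    simp only [sub_self, norm_zero] at this
    nlinarith
  have ha := left_mem_Icc.2 hab.le
  have hb := right_mem_Icc.2 hab.le
  refine ⟨I b, hIb b hb, ?_⟩
  intro B Λ₁ Λ₂ κ r Y hΛ₁ hκ hκ1 hκ2 hB hY
  -- the size `h` of the push is the solution `e` of the linearised equation, divided by `y`; since
  -- `y` decreases along the curve, the quotient grows by an additional term `s` of order `h ^ 2`
  set y := fun t => r - B * ℓ (c t) with hy
  set e := fun t => κ * Real.exp (I t) with he
  set h := fun t => e t / y t with hh
  have he1 : ∀ t ∈ Icc a b, Λ₁ ≤ e t := by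
    intro t ht
    refine hκ1.trans (mul_le_mul_of_nonneg_left (Real.exp_le_exp.2 ?_) hκ.le)
    have h1 := (abs_le.1 (hIb t ht)).1
    have h2 := mul_le_mul_of_nonneg_left (hmono t ht) (pow_pos hA0 3).le
    linarith
  have he2 : ∀ t ∈ Icc a b, e t ≤ Λ₂ := by
    intro t ht
    refine (mul_le_mul_of_nonneg_left (Real.exp_le_exp.2 ?_) hκ.le).trans hκ2
    have h1 := (abs_le.1 (hIb t ht)).2
    have h2 := mul_le_mul_of_nonneg_left (hmono t ht) (pow_pos hA0 3).le
    linarith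
  have hΛ₂ : 0 < Λ₂ := hΛ₁.trans_le ((he1 a ha).trans (he2 a ha))
  have hB0 : 0 < B := lt_of_lt_of_le (by positivity) hB
  have hy0 : ∀ t ∈ Icc a b, y t ≠ 0 := fun t ht h0 => by
    have := (hY t ht).1
    simp only [hy] at h0
    rw [h0, abs_zero] at this
    linarith
  have hed : ∀ t ∈ Icc a b, HasDerivWithinAt e (q t * e t) (Icc a b) t := by
    intro t ht
    have := ((hId t ht).exp.const_mul κ).hasDerivWithinAt (s := Icc a b)
    refine this.congr_deriv ?_
    simp only [he]; ring
  have hyd : ∀ t ∈ Icc a b, HasDerivWithinAt y (-(B * ℓ (v t))) (Icc a b) t := by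
    intro t ht
    have := ((hℓd t ht).const_mul B).const_sub r
    exact this
  set s := fun t => h t ^ 2 * (B / e t) * ℓ (v t) with hs
  have he0 : ∀ t ∈ Icc a b, 0 < e t := fun t ht => hΛ₁.trans_le (he1 t ht)
  have hhd : ∀ t ∈ Icc a b, HasDerivWithinAt h (q t * h t + s t) (Icc a b) t := by
    intro t ht
    have := (hed t ht).div (hyd t ht) (hy0 t ht)
    refine this.congr_deriv ?_
    have h1 := hy0 t ht
    have h2 := (he0 t ht).ne'
    simp only [hs, hh]
    field_simp
    ring
  set d := fun t => c t + h t • X (c t) with hd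
  have hXd : ∀ t ∈ Icc a b,
      HasDerivWithinAt (fun t => X (c t)) (fderiv ℝ X (c t) (v t)) (Icc a b) t := by
    intro t ht
    have h1 : HasFDerivAt X (fderiv ℝ X (c t)) (c t) :=
      ((hX.contDiffAt (hU.mem_nhds (hcU t ht))).differentiableAt (by simp)).hasFDerivAt
    exact h1.comp_hasDerivWithinAt t (hcv t ht)
  have hdd : ∀ t ∈ Icc a b, derivWithin d (Icc a b) t =
      v t + (q t * h t + s t) • X (c t) + h t • fderiv ℝ X (c t) (v t) := by
    intro t ht
    have := ((hcv t ht).add ((hhd t ht).smul (hXd t ht))).derivWithin (uniqueDiffOn_Icc hab t ht)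
    refine this.trans ?_
    abel
  have hhC : ContDiffOn ℝ 1 h (Icc a b) := by
    refine ContDiffOn.div ?_ ?_ hy0
    · exact (contDiff_const.mul hI1.exp).contDiffOn
    · exact contDiffOn_const.sub (contDiffOn_const.mul (ℓ.contDiff.comp_contDiffOn hc))
  have hXC : ContDiffOn ℝ 1 (fun t => X (c t)) (Icc a b) :=
    (hX.of_le (by exact_mod_cast le_top)).comp hc hcU
  have habs : ∀ t ∈ Icc a b, |h t| = e t / |y t| := fun t ht => by
    simp only [hh]; rw [abs_div, abs_of_pos (he0 t ht)]
  refine ⟨d, hc.add (hhC.smul hXC), ?_, rfl, fun t ht => ?_⟩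
  · simp only [hd, hh, he, hy, hIa, Real.exp_zero, mul_one]
  have hyp : 0 < |y t| := abs_pos.2 (hy0 t ht)
  obtain ⟨hY1, hY2, hY3, hY4⟩ := hY t ht
  have hhρ : |h t| ≤ ρ := by
    rw [habs t ht, div_le_iff₀ hyp]; exact (he2 t ht).trans hY2
  have hhA : 4 * A ^ 4 * |h t| ≤ 1 := by
    rw [habs t ht, mul_div_assoc', div_le_one hyp]
    exact (mul_le_mul_of_nonneg_left (he2 t ht) (by positivity)).trans hY3
  have hvn := norm_nonneg (v t)
  have hlv := hℓv t ht
  have hlv0 : 0 ≤ ℓ (v t) := by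
    by_contra! hcon
    have := mul_neg_of_pos_of_neg hA0 hcon
    linarith
  have key := P.pushed_timelike (hball t ht) (hT t ht).1 (hT t ht).2 (k := q t * h t + s t)
    (s := s t) hhρ hhA rfl (by
      -- the growth `s` beats the quadratic error terms because `B` is large
      have h1 : 5 * A ^ 7 ≤ B / e t := by
        rw [le_div_iff₀ (he0 t ht)]
        exact (mul_le_mul_of_nonneg_left (he2 t ht) (by positivity)).trans hB
      calc 5 * A ^ 6 * h t ^ 2 * ‖v t‖ ≤ 5 * A ^ 6 * h t ^ 2 * (A * ℓ (v t)) := by gcongr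
        _ = h t ^ 2 * (5 * A ^ 7) * ℓ (v t) := by ring
        _ ≤ h t ^ 2 * (B / e t) * ℓ (v t) := by gcongr) (by
      have h1 : h t ^ 2 * (B / e t) = |h t| * (B / |y t|) := by
        rw [← sq_abs, habs t ht]
        have := (he0 t ht).ne'
        field_simp
      have h2 : B / |y t| ≤ 1 := (div_le_one hyp).2 hY1
      simp only [hs]
      rw [h1]
      calc |h t| * (B / |y t|) * ℓ (v t) ≤ |h t| * 1 * (A * ‖v t‖) := by
            gcongr; exact hℓle _
        _ = A * |h t| * ‖v t‖ := by ring)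
  have hdt : d t = c t + h t • X (c t) := rfl
  rw [hdd t ht, hdt]
  have hvpos : 0 < ‖v t‖ := norm_pos_iff.2 fun h0 => by
    have := (hT t ht).1
    simp only [hv] at h0
    rw [h0] at this; simp at this
  have hh0 : 0 < |h t| := by rw [habs t ht]; exact div_pos (he0 t ht) hyp
  refine ⟨P.mem (hball t ht) hhρ, ?_, key.2, ?_⟩
  · have : 0 < h t ^ 2 * ‖v t‖ ^ 2 := by rw [← sq_abs]; positivity
    linarith [key.1]
  · refine Real.le_sqrt_of_sq_le (le_trans ?_ key.1)
    rw [← sq_abs (h t), ← mul_pow]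
    have hY0 : 0 < Y := hyp.trans_le hY4
    have h1 : Λ₁ / Y ≤ |h t| := by
      rw [habs t ht]
      exact div_le_div₀ (he0 t ht).le (he1 t ht) hyp hY4
    refine pow_le_pow_left₀ (by positivity) ?_ 2
    calc Λ₁ / (A * Y) * ℓ (v t) ≤ Λ₁ / (A * Y) * (A * ‖v t‖) := by gcongr; exact hℓle _
      _ = Λ₁ / Y * ‖v t‖ := by field_simp
      _ ≤ _ := by gcongr

end PushBounds

end VectorSpace

/-! ### Pushing a curve inside a chart -/

/-- The fundamental theorem of calculus for a nonnegative derivative, as a Lebesgue integral. -/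
theorem ofReal_sub_eq_lintegral {β β' : ℝ → ℝ} {a b : ℝ} (hab : a < b)
    (hβ : ∀ t ∈ Icc a b, HasDerivWithinAt β (β' t) (Icc a b) t)
    (hc : ContinuousOn β' (Icc a b)) (h0 : ∀ t ∈ Icc a b, 0 ≤ β' t) :
    ENNReal.ofReal (β b - β a) = ∫⁻ t in Ioo a b, ENNReal.ofReal (β' t) := by
  have hi : IntervalIntegrable β' volume a b := hc.intervalIntegrable_of_Icc hab.le
  have h1 := intervalIntegral.integral_eq_sub_of_hasDerivAt_of_le hab.le
    (fun t ht => (hβ t ht).continuousWithinAt)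
    (fun t ht => (hβ t (Ioo_subset_Icc_self ht)).hasDerivAt (Icc_mem_nhds ht.1 ht.2)) hi
  rw [← h1, intervalIntegral.integral_of_le hab.le, integral_Ioc_eq_integral_Ioo]
  refine ofReal_integral_eq_lintegral_ofReal (hc.integrableOn_Icc.mono_set Ioo_subset_Icc_self) ?_
  exact (ae_restrict_iff' measurableSet_Ioo).2
    (ae_of_all _ fun t ht => h0 t (Ioo_subset_Icc_self ht))

namespace TimeOrientedMetric

variable {E : Type*} [NormedAddCommGroup E] [NormedSpace ℝ E]
  {M : Type*} [TopologicalSpace M] [ChartedSpace E M] [IsManifold 𝓘(ℝ, E) ∞ M]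
  (g : TimeOrientedMetric E M) (x₀ : M)

/-- `q` lies in the chronological future of `p`, at Lorentzian distance at least `s`. -/
def Reaches (p q : M) (s : ℝ) : Prop :=
  q ∈ g.future p ∧ ENNReal.ofReal s ≤ g.lorentzianDist p q

variable {g} in
theorem Reaches.trans {p q r : M} {s t : ℝ} (h : g.Reaches p q s) (h' : g.Reaches q r t)
    (hs : 0 ≤ s) (ht : 0 ≤ t) : g.Reaches p r (s + t) := by
  refine ⟨g.future_trans h.1 h'.1, ?_⟩
  rw [ENNReal.ofReal_add hs ht]
  exact (add_le_add h.2 h'.2).trans (g.lorentzianDist_add_le h.1 h'.1)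

variable {g} in
theorem Reaches.mono {p q : M} {s t : ℝ} (h : g.Reaches p q s) (hts : t ≤ s) : g.Reaches p q t :=
  ⟨h.1, (ENNReal.ofReal_le_ofReal hts).trans h.2⟩

theorem reaches_zero {p q : M} (h : q ∈ g.future p) : g.Reaches p q 0 := ⟨h, by simp⟩

/-- The uniform estimates `PushBounds` for the metric and the time field in the chart centred at
`x₀`, on the ball of radius `ρ`. -/
abbrev ChartBounds (A ρ : ℝ) : Prop :=
  PushBounds (g.chartMetric x₀) (g.chartField x₀) (extChartAt 𝓘(ℝ, E) x₀).target
    (extChartAt 𝓘(ℝ, E) x₀ x₀) A ρ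

/-- The linear time function in the chart centred at `x₀`. -/
noncomputable def chartClock (p : M) : ℝ :=
  linearClock (g.chartMetric x₀) (g.chartField x₀) (extChartAt 𝓘(ℝ, E) x₀ x₀)
    (extChartAt 𝓘(ℝ, E) x₀ p)

omit [IsManifold 𝓘(ℝ, E) ∞ M] in
variable (E) in
/-- The ball of radius `ρ` about `x₀` in the chart centred at `x₀`. -/
def chartBall (ρ : ℝ) : Set M :=
  {p | p ∈ (extChartAt 𝓘(ℝ, E) x₀).source ∧
    extChartAt 𝓘(ℝ, E) x₀ p ∈ Metric.ball (extChartAt 𝓘(ℝ, E) x₀ x₀) ρ}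

variable {g x₀}

/-- Pushing a timelike arc of a chart ball along the time field: the end points of the pushed arc,
and its length. -/
theorem ChartBounds.exists_reaches_of_arc [FiniteDimensional ℝ E] {A ρ : ℝ}
    (hP : g.ChartBounds x₀ A ρ) {μ : ℝ → M} {s t : ℝ}
    (hμ : PiecewiseC1.IsC1Arc g.IsFutureTimelike μ s t)
    (hball : ∀ τ ∈ Icc s t, μ τ ∈ chartBall E x₀ ρ) :
    (∀ τ ∈ Icc s t, ‖extChartAt 𝓘(ℝ, E) x₀ (μ τ) - extChartAt 𝓘(ℝ, E) x₀ (μ s)‖ ≤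
      A * (g.chartClock x₀ (μ τ) - g.chartClock x₀ (μ s))) ∧
    ∃ ε : ℝ, |ε| ≤ A ^ 3 * (g.chartClock x₀ (μ t) - g.chartClock x₀ (μ s)) ∧
      ∀ B Λ₁ Λ₂ κ r Y : ℝ, 0 < Λ₁ → 0 < κ →
        Λ₁ ≤ κ * Real.exp (-(A ^ 3 * (g.chartClock x₀ (μ t) - g.chartClock x₀ (μ s)))) →
        κ * Real.exp (A ^ 3 * (g.chartClock x₀ (μ t) - g.chartClock x₀ (μ s))) ≤ Λ₂ →
        5 * A ^ 7 * Λ₂ ≤ B →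
        (∀ τ ∈ Icc s t, B ≤ |r - B * g.chartClock x₀ (μ τ)| ∧
          Λ₂ ≤ ρ * |r - B * g.chartClock x₀ (μ τ)| ∧
          4 * A ^ 4 * Λ₂ ≤ |r - B * g.chartClock x₀ (μ τ)| ∧
            |r - B * g.chartClock x₀ (μ τ)| ≤ Y) →
        g.Reaches (g.push x₀ (μ s) (κ / (r - B * g.chartClock x₀ (μ s))))
          (g.push x₀ (μ t) (κ * Real.exp ε / (r - B * g.chartClock x₀ (μ t))))
          (Λ₁ / (A * Y) * (g.chartClock x₀ (μ t) - g.chartClock x₀ (μ s))) := by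
  have hs : ∀ τ ∈ Icc s t, μ τ ∈ (extChartAt 𝓘(ℝ, E) x₀).source := fun τ hτ => (hball τ hτ).1
  set c : ℝ → E := fun t => extChartAt 𝓘(ℝ, E) x₀ (μ t) with hcdef
  have hc : ContDiffOn ℝ 1 c (Icc s t) := chart_comp_contDiffOn x₀ hμ.2.1 hs
  have htl : ∀ τ ∈ Icc s t, g.ChartTimelike x₀ (c τ) (derivWithin c (Icc s t) τ) :=
    fun τ hτ => chartTimelike_chart_comp x₀ g hμ.1 hμ.2.1 hs hμ.2.2 hτ
  refine ⟨fun τ hτ => hP.norm_sub_le_linearClock hc (fun τ hτ => (hball τ hτ).2) htl hτ, ?_⟩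
  obtain ⟨ε, hε, h⟩ := hP.exists_pushed_arc (isOpen_target x₀) (contDiffOn_chartMetric x₀ g)
    (contDiffOn_chartField x₀ g) hμ.1 hc (fun τ hτ => (hball τ hτ).2) htl
  refine ⟨ε, hε, fun B Λ₁ Λ₂ κ r Y h1 h2 h3 h4 h5 h6 => ?_⟩
  obtain ⟨d, hd, hd1, hd2, hd3⟩ := h B Λ₁ Λ₂ κ r Y h1 h2 h3 h4 h5 h6
  have hcurve := piecewiseC1_chart_symm_comp x₀ g hμ.1 hd (fun τ hτ => (hd3 τ hτ).1)
    (fun τ hτ => ⟨(hd3 τ hτ).2.1, (hd3 τ hτ).2.2.1⟩)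
  have e1 : (extChartAt 𝓘(ℝ, E) x₀).symm (d s) =
      g.push x₀ (μ s) (κ / (r - B * g.chartClock x₀ (μ s))) := by rw [hd1]; rfl
  have e2 : (extChartAt 𝓘(ℝ, E) x₀).symm (d t) =
      g.push x₀ (μ t) (κ * Real.exp ε / (r - B * g.chartClock x₀ (μ t))) := by rw [hd2]; rfl
  refine ⟨⟨_, s, t, hcurve, e1, e2⟩, le_trans ?_ (g.le_lorentzianDist ⟨hcurve, e1, e2⟩)⟩
  rw [length_chart_symm_comp x₀ g hd fun τ hτ => (hd3 τ hτ).1]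
  have hA : 0 < A := by linarith [hP.one_le]
  have hY : 0 ≤ Y := by
    have := h6 s (left_mem_Icc.2 hμ.1.le)
    linarith [abs_nonneg (r - B * g.chartClock x₀ (μ s))]
  have hk : 0 ≤ Λ₁ / (A * Y) := by positivity
  have hder : ∀ τ ∈ Icc s t, HasDerivWithinAt (fun τ => Λ₁ / (A * Y) * g.chartClock x₀ (μ τ))
      (Λ₁ / (A * Y) * linearClock (g.chartMetric x₀) (g.chartField x₀)
        (extChartAt 𝓘(ℝ, E) x₀ x₀) (derivWithin c (Icc s t) τ)) (Icc s t) τ := fun τ hτ =>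
    (PushBounds.hasDerivWithinAt_linearClock hc hτ).const_mul _
  rw [mul_sub, ofReal_sub_eq_lintegral hμ.1 hder]
  · refine setLIntegral_mono_ae' measurableSet_Ioo (ae_of_all _ fun τ hτ => ?_)
    exact ENNReal.ofReal_le_ofReal (hd3 τ (Ioo_subset_Icc_self hτ)).2.2.2
  · exact continuousOn_const.mul ((ContinuousLinearMap.continuous _).comp_continuousOn
      (hc.continuousOn_derivWithin (uniqueDiffOn_Icc hμ.1) le_rfl))
  · intro τ hτ
    have h7 := (hP.cone (hball τ hτ).2 (htl τ hτ).1.le (htl τ hτ).2.le).1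
    have h8 : 0 ≤ A * linearClock (g.chartMetric x₀) (g.chartField x₀)
        (extChartAt 𝓘(ℝ, E) x₀ x₀) (derivWithin c (Icc s t) τ) := (norm_nonneg _).trans h7
    exact mul_nonneg hk (nonneg_of_mul_nonneg_right h8 hA)

/-- The same for a piecewise `C¹` curve in a chart ball. The `C¹` arcs are composed: the second one
starts with the factor `κ * exp ε₁` that the first one ends with, so that the exponents `ε` add up,
as do the gains of length. -/
theorem ChartBounds.exists_reaches [FiniteDimensional ℝ E] {A ρ : ℝ}
    (hP : g.ChartBounds x₀ A ρ) {μ : ℝ → M} {s t : ℝ}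
    (hμ : PiecewiseC1 g.IsFutureTimelike μ s t)
    (hball : ∀ τ ∈ Icc s t, μ τ ∈ chartBall E x₀ ρ) :
    (∀ τ ∈ Icc s t, ‖extChartAt 𝓘(ℝ, E) x₀ (μ τ) - extChartAt 𝓘(ℝ, E) x₀ (μ s)‖ ≤
      A * (g.chartClock x₀ (μ τ) - g.chartClock x₀ (μ s))) ∧
    ∃ ε : ℝ, |ε| ≤ A ^ 3 * (g.chartClock x₀ (μ t) - g.chartClock x₀ (μ s)) ∧
      ∀ B Λ₁ Λ₂ κ r Y : ℝ, 0 < Λ₁ → 0 < κ →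
        Λ₁ ≤ κ * Real.exp (-(A ^ 3 * (g.chartClock x₀ (μ t) - g.chartClock x₀ (μ s)))) →
        κ * Real.exp (A ^ 3 * (g.chartClock x₀ (μ t) - g.chartClock x₀ (μ s))) ≤ Λ₂ →
        5 * A ^ 7 * Λ₂ ≤ B →
        (∀ τ ∈ Icc s t, B ≤ |r - B * g.chartClock x₀ (μ τ)| ∧
          Λ₂ ≤ ρ * |r - B * g.chartClock x₀ (μ τ)| ∧
          4 * A ^ 4 * Λ₂ ≤ |r - B * g.chartClock x₀ (μ τ)| ∧
            |r - B * g.chartClock x₀ (μ τ)| ≤ Y) →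
        g.Reaches (g.push x₀ (μ s) (κ / (r - B * g.chartClock x₀ (μ s))))
          (g.push x₀ (μ t) (κ * Real.exp ε / (r - B * g.chartClock x₀ (μ t))))
          (Λ₁ / (A * Y) * (g.chartClock x₀ (μ t) - g.chartClock x₀ (μ s))) := by
  have hA : 0 < A := by linarith [hP.one_le]
  induction hμ with
  | single hab hγ hQ => exact hP.exists_reaches_of_arc ⟨hab, hγ, hQ⟩ hball
  | @append s u t h1 h2 i1 i2 =>
    obtain ⟨n1, ε₁, he1, p1⟩ := i1 fun τ hτ => hball τ ⟨hτ.1, hτ.2.trans h2.lt.le⟩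
    obtain ⟨n2, ε₂, he2, p2⟩ := i2 fun τ hτ => hball τ ⟨h1.lt.le.trans hτ.1, hτ.2⟩
    have m1 : 0 ≤ g.chartClock x₀ (μ u) - g.chartClock x₀ (μ s) :=
      nonneg_of_mul_nonneg_right ((norm_nonneg _).trans (n1 u ⟨h1.lt.le, le_rfl⟩)) hA
    have m2 : 0 ≤ g.chartClock x₀ (μ t) - g.chartClock x₀ (μ u) :=
      nonneg_of_mul_nonneg_right ((norm_nonneg _).trans (n2 t ⟨h2.lt.le, le_rfl⟩)) hA
    have hA3 := pow_pos hA 3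
    refine ⟨fun τ hτ => ?_, ε₁ + ε₂, ?_, fun B Λ₁ Λ₂ κ r Y hΛ hκ hκ1 hκ2 hB hY => ?_⟩
    · rcases le_total τ u with h | h
      · exact n1 τ ⟨hτ.1, h⟩
      · have e1 := n1 u ⟨h1.lt.le, le_rfl⟩
        have e2 := n2 τ ⟨h, hτ.2⟩
        have e3 := norm_sub_le_norm_sub_add_norm_sub (extChartAt 𝓘(ℝ, E) x₀ (μ τ))
          (extChartAt 𝓘(ℝ, E) x₀ (μ u)) (extChartAt 𝓘(ℝ, E) x₀ (μ s))
        linarith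
    · have := abs_add_le ε₁ ε₂
      linarith
    set σ₁ := g.chartClock x₀ (μ u) - g.chartClock x₀ (μ s) with hσ₁
    set σ₂ := g.chartClock x₀ (μ t) - g.chartClock x₀ (μ u) with hσ₂
    have hσ : g.chartClock x₀ (μ t) - g.chartClock x₀ (μ s) = σ₁ + σ₂ := by
      rw [hσ₁, hσ₂]; ring
    rw [hσ] at hκ1 hκ2 ⊢
    have a1 := (abs_le.1 he1).1
    have a2 := (abs_le.1 he1).2
    have s1 := mul_nonneg hA3.le m1
    have s2 := mul_nonneg hA3.le m2
    have r1 := p1 B Λ₁ Λ₂ κ r Y hΛ hκ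
      (hκ1.trans (mul_le_mul_of_nonneg_left (Real.exp_le_exp.2 (by linarith)) hκ.le))
      ((mul_le_mul_of_nonneg_left (Real.exp_le_exp.2 (by linarith)) hκ.le).trans hκ2) hB
      fun τ hτ => hY τ ⟨hτ.1, hτ.2.trans h2.lt.le⟩
    have r2 := p2 B Λ₁ Λ₂ (κ * Real.exp ε₁) r Y hΛ (by positivity)
      (hκ1.trans (by
        rw [mul_assoc, ← Real.exp_add]
        exact mul_le_mul_of_nonneg_left (Real.exp_le_exp.2 (by linarith)) hκ.le))
      (le_trans (by
        rw [mul_assoc, ← Real.exp_add]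
        exact mul_le_mul_of_nonneg_left (Real.exp_le_exp.2 (by linarith)) hκ.le) hκ2) hB
      fun τ hτ => hY τ ⟨h1.lt.le.trans hτ.1, hτ.2⟩
    have hYp : 0 ≤ Y := by
      have := hY s (left_mem_Icc.2 (h1.lt.trans h2.lt).le)
      linarith [abs_nonneg (r - B * g.chartClock x₀ (μ s))]
    have r3 := r1.trans r2 (by positivity) (by positivity)
    rwa [mul_assoc, ← Real.exp_add, ← mul_add] at r3

/-- Every point has a chart ball with push estimates, as the metric in a chart is Lorentzian and
smooth. -/
theorem exists_chartBounds [FiniteDimensional ℝ E] (g : TimeOrientedMetric E M) (x₀ : M) :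
    ∃ A ρ, g.ChartBounds x₀ A ρ := by
  have ht := mem_extChartAt_target (I := 𝓘(ℝ, E)) x₀
  refine exists_pushBounds (isOpen_target x₀) (contDiffOn_chartMetric x₀ g)
    (contDiffOn_chartField x₀ g) (g.chartMetric_symm x₀) ht ?_ (g.chartTimelike_chartField x₀ ht).1
  set y₀ := extChartAt 𝓘(ℝ, E) x₀ x₀
  obtain ⟨v, hv, h⟩ := g.lorentzian ((extChartAt 𝓘(ℝ, E) x₀).symm y₀)
  obtain ⟨v', rfl⟩ : ∃ v' : E, mfderiv 𝓘(ℝ, E) 𝓘(ℝ, E) (extChartAt 𝓘(ℝ, E) x₀).symm y₀ v' = v := by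
    have := mfderiv_chart_symm_chart x₀ ((extChartAt 𝓘(ℝ, E) x₀).map_target ht) v
    rw [(extChartAt 𝓘(ℝ, E) x₀).right_inv ht] at this
    exact ⟨_, this⟩
  refine ⟨v', hv, fun w hw hvw => h (mfderiv 𝓘(ℝ, E) 𝓘(ℝ, E) (extChartAt 𝓘(ℝ, E) x₀).symm y₀ w)
    (fun h0 => hw ?_) hvw⟩
  have := mfderiv_chart_chart_symm x₀ ht w
  exact this.symm.trans ((congrArg _ h0).trans (map_zero _))

end TimeOrientedMetric

/-! ### Comparing pushes in two charts -/

namespace TimeOrientedMetric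

variable {E : Type*} [NormedAddCommGroup E] [NormedSpace ℝ E]
  {M : Type*} [TopologicalSpace M] [ChartedSpace E M] [IsManifold 𝓘(ℝ, E) ∞ M]
  (g : TimeOrientedMetric E M) (x₀ x₁ x₂ : M)

/-- The derivative of a change of charts maps the time field in one chart to that in the other. -/
theorem fderiv_chart_change_chartField {y : E} (hy : y ∈ (extChartAt 𝓘(ℝ, E) x₂).target)
    (hy' : (extChartAt 𝓘(ℝ, E) x₂).symm y ∈ (extChartAt 𝓘(ℝ, E) x₁).source) :
    fderiv ℝ (extChartAt 𝓘(ℝ, E) x₁ ∘ (extChartAt 𝓘(ℝ, E) x₂).symm) y (g.chartField x₂ y) =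
      g.chartField x₁ (extChartAt 𝓘(ℝ, E) x₁ ((extChartAt 𝓘(ℝ, E) x₂).symm y)) := by
  have h1 : MDifferentiableAt 𝓘(ℝ, E) 𝓘(ℝ, E) (extChartAt 𝓘(ℝ, E) x₂).symm y :=
    (mdifferentiableOn_extChartAt_symm (I := 𝓘(ℝ, E)) _ hy).mdifferentiableAt
      ((isOpen_target x₂).mem_nhds hy)
  have h2 : MDifferentiableAt 𝓘(ℝ, E) 𝓘(ℝ, E) (extChartAt 𝓘(ℝ, E) x₁)
      ((extChartAt 𝓘(ℝ, E) x₂).symm y) :=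
    mdifferentiableAt_extChartAt (by rwa [extChartAt_source] at hy')
  have h3 := mfderiv_comp y h2 h1
  rw [mfderiv_eq_fderiv] at h3
  rw [h3]
  have h4 := mfderiv_chart_symm_chartField x₂ g hy
  have h5 : ∀ p q : M, p = q → (mfderiv 𝓘(ℝ, E) 𝓘(ℝ, E) (extChartAt 𝓘(ℝ, E) x₁) p
      (g.timeField p) : E) = mfderiv 𝓘(ℝ, E) 𝓘(ℝ, E) (extChartAt 𝓘(ℝ, E) x₁) q (g.timeField q) := by
    rintro p q rfl; rfl
  exact (congrArg (mfderiv 𝓘(ℝ, E) 𝓘(ℝ, E) (extChartAt 𝓘(ℝ, E) x₁)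
    ((extChartAt 𝓘(ℝ, E) x₂).symm y)) h4).trans
      (h5 _ _ ((extChartAt 𝓘(ℝ, E) x₁).left_inv hy').symm)

variable [FiniteDimensional ℝ E]

/-- Uniformly on compact sets, pushing further leads to the chronological future. -/
theorem eventually_forall_push_mem_future {K : Set M} (hK : IsCompact K)
    (hs : K ⊆ (extChartAt 𝓘(ℝ, E) x₀).source) :
    ∀ᶠ R : ℝ in atTop, ∀ z ∈ K, ∀ h h' : ℝ, |h| ≤ 1 / R → |h'| ≤ 1 / R → h < h' →
      g.push x₀ z h' ∈ g.future (g.push x₀ z h) := by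
  have key := hK.eventually_forall_of_forall_eventually (x₀ := ((0, 0) : ℝ × ℝ))
    (P := fun w z => w.1 < w.2 → g.push x₀ z w.2 ∈ g.future (g.push x₀ z w.1)) (by
      intro z hz
      have h1 := eventually_push_mem_future g x₀ (hs hz)
      have h2 : ContinuousAt (fun w : (ℝ × ℝ) × M => (w.2, w.1.1, w.1.2)) ((0, 0), z) := by
        fun_prop
      exact h2.eventually h1)
  obtain ⟨δ, hδ, h⟩ := Metric.eventually_nhds_iff_ball.1 key
  filter_upwards [eventually_gt_atTop (1 / δ)] with R hR z hz a a' ha ha' hlt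
  have hR' : 1 / R < δ := by
    rw [div_lt_iff₀ (lt_trans (by positivity) hR)]
    rwa [div_lt_iff₀ hδ, mul_comm] at hR
  refine h (a, a') ?_ z hz hlt
  rw [Metric.mem_ball, Prod.dist_eq, max_lt_iff, Real.dist_eq, Real.dist_eq, sub_zero, sub_zero]
  exact ⟨ha.trans_lt hR', ha'.trans_lt hR'⟩

/-- Pushes in two charts agree to first order, so that a slightly longer push in the second chart
ends in the future of the push in the first chart. In terms of the inverse `r` of the size of the
push, it is enough to subtract a bounded quantity `b`, since `1 / (r - b) - 1 / r` is about
`b / r ^ 2`, whereas the two pushes differ by `O(1 / r ^ 2)`. -/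
theorem exists_nhds_push_mem_future_push {z₀ : M} (h₁ : z₀ ∈ (extChartAt 𝓘(ℝ, E) x₁).source)
    (h₂ : z₀ ∈ (extChartAt 𝓘(ℝ, E) x₂).source) :
    ∃ N ∈ 𝓝 z₀, ∀ᶠ b₀ : ℝ in atTop, ∀ b₁ : ℝ, ∀ᶠ R : ℝ in atTop, ∀ z ∈ N, ∀ b ∈ Icc b₀ b₁,
      ∀ r : ℝ, R ≤ |r| → g.push x₂ z (1 / (r - b)) ∈ g.future (g.push x₁ z (1 / r)) := by
  set φ₁ := extChartAt 𝓘(ℝ, E) x₁ with hφ₁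
  set φ₂ := extChartAt 𝓘(ℝ, E) x₂ with hφ₂
  have t₁ := φ₁.map_source h₁
  have t₂ := φ₂.map_source h₂
  set U := φ₂.target ∩ φ₂.symm ⁻¹' φ₁.source with hU
  have hUo : IsOpen U := (continuousOn_extChartAt_symm (I := 𝓘(ℝ, E)) x₂).isOpen_inter_preimage
    (isOpen_target x₂) (isOpen_extChartAt_source (I := 𝓘(ℝ, E)) x₁)
  have hf : ContDiffOn ℝ ∞ (φ₁ ∘ φ₂.symm) U := by
    have := contDiffOn_ext_coord_change (I := 𝓘(ℝ, E)) (n := ∞) x₁ x₂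
    refine this.mono fun y hy => ?_
    rw [PartialEquiv.trans_source, PartialEquiv.symm_source]
    exact hy
  have hyU : φ₂ z₀ ∈ U := ⟨t₂, by rw [mem_preimage, φ₂.left_inv h₂]; exact h₁⟩
  obtain ⟨A, hA, ρ, hρ, hball, hT⟩ := exists_taylor_bound hUo hf hyU
  obtain ⟨δ, hδ, hcone⟩ := Metric.eventually_nhds_iff_ball.1
    (eventually_chartTimelike g x₁ t₁ (chartTimelike_chartField g x₁ t₁))
  set m₁ := ‖g.chartField x₁ (φ₁ z₀)‖ + δ with hm₁
  set m := ‖g.chartField x₂ (φ₂ z₀)‖ + 1 with hm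
  have hm0 : 0 < m := by positivity
  have hm10 : 0 < m₁ := by positivity
  have c₁ : ContinuousAt φ₁ z₀ := continuousAt_extChartAt' (I := 𝓘(ℝ, E)) h₁
  have c₂ : ContinuousAt φ₂ z₀ := continuousAt_extChartAt' (I := 𝓘(ℝ, E)) h₂
  have d₁ : ContinuousAt (fun z => g.chartField x₁ (φ₁ z)) z₀ :=
    ContinuousAt.comp (((contDiffOn_chartField x₁ g).continuousOn).continuousAt
      ((isOpen_target x₁).mem_nhds t₁)) c₁
  have d₂ : ContinuousAt (fun z => g.chartField x₂ (φ₂ z)) z₀ :=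
    ContinuousAt.comp (((contDiffOn_chartField x₂ g).continuousOn).continuousAt
      ((isOpen_target x₂).mem_nhds t₂)) c₂
  refine ⟨_, inter_mem (inter_mem ((isOpen_extChartAt_source (I := 𝓘(ℝ, E)) x₁).mem_nhds h₁)
    ((isOpen_extChartAt_source (I := 𝓘(ℝ, E)) x₂).mem_nhds h₂))
    (inter_mem (inter_mem (c₁ (Metric.ball_mem_nhds _ (half_pos hδ)))
      (c₂ (Metric.ball_mem_nhds _ (half_pos hρ))))
      (inter_mem (d₁ (Metric.ball_mem_nhds _ (half_pos hδ)))
        (d₂ (Metric.ball_mem_nhds _ one_pos)))), ?_⟩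
  filter_upwards [eventually_gt_atTop (4 * A * m ^ 2 / δ)] with b₀ hb₀ b₁
  have hlim : Tendsto (fun R : ℝ => 2 / R) atTop (𝓝 0) := tendsto_const_nhds.div_atTop tendsto_id
  have l1 : ∀ᶠ R : ℝ in atTop, 2 / R * m < ρ / 2 := by
    have := hlim.mul_const m
    rw [zero_mul] at this
    exact this.eventually_lt_const (half_pos hρ)
  have l2 : ∀ᶠ R : ℝ in atTop, 2 / R * m₁ + A * m ^ 2 * (2 / R) ^ 2 < δ / 2 := by
    have := (hlim.mul_const m₁).add ((hlim.pow 2).const_mul (A * m ^ 2))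
    norm_num at this
    exact this.eventually_lt_const (half_pos hδ)
  filter_upwards [l1, l2, eventually_ge_atTop (2 * b₁), eventually_gt_atTop 0] with
    R hR1 hR2 hR3 hR0
  rintro z ⟨⟨z₁, z₂⟩, ⟨n₁, n₂⟩, n₃, n₄⟩ b hb r hr
  simp only [mem_preimage, mem_ball_iff_norm] at n₁ n₂ n₃ n₄
  have hb0 : 0 < b := lt_of_lt_of_le (lt_of_le_of_lt (by positivity) hb₀) hb.1
  have hr0 : 0 < |r| := hR0.trans_le hr
  have hrb : |r| / 2 ≤ |r - b| := by
    have h1 := abs_sub_abs_le_abs_sub r b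
    rw [abs_of_pos hb0] at h1
    linarith [hb.2]
  have hrn : r ≠ 0 := abs_pos.1 hr0
  have hrbn : r - b ≠ 0 := abs_pos.1 ((half_pos hr0).trans_le hrb)
  have hh : |1 / r| ≤ 2 / R := by
    rw [abs_div, abs_one]
    exact div_le_div₀ (by norm_num) (by norm_num) hR0 hr
  have hk : |1 / (r - b)| ≤ 2 / R := by
    rw [abs_div, abs_one, div_le_div_iff₀ (abs_pos.2 hrbn) hR0]
    linarith
  -- the ratio of the two sizes
  have hq : r / (r - b) ≤ 2 ∧ 0 < r / (r - b) := by
    rcases lt_or_gt_of_ne hrn with hneg | hpos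
    · refine ⟨?_, div_pos_of_neg_of_neg hneg (by linarith)⟩
      rw [div_le_iff_of_neg (by linarith)]; linarith
    · rw [abs_of_pos hpos] at hr
      have : 0 < r - b := by linarith [hb.2]
      refine ⟨?_, div_pos hpos this⟩
      rw [div_le_iff₀ this]; linarith [hb.2]
  set h := 1 / r with hhd
  set k := 1 / (r - b) with hkd
  have hkh : k - h = k ^ 2 * b / (r / (r - b)) := by
    rw [hkd, hhd]; field_simp; ring
  have hk0 : k ≠ 0 := one_div_ne_zero hrbn
  have hkh0 : 0 < k - h := by
    rw [hkh]
    have := hq.2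
    positivity
  set X₁ := g.chartField x₁ (φ₁ z) with hX₁
  set X₂ := g.chartField x₂ (φ₂ z) with hX₂
  have nX₁ : ‖X₁‖ ≤ m₁ := by
    have := norm_le_norm_add_norm_sub' X₁ (g.chartField x₁ (φ₁ z₀))
    linarith
  have nX₂ : ‖X₂‖ ≤ m := by
    have := norm_le_norm_add_norm_sub' X₂ (g.chartField x₂ (φ₂ z₀))
    linarith
  have hkX : ‖k • X₂‖ ≤ |k| * m := by
    rw [norm_smul, Real.norm_eq_abs]; gcongr
  have b₁' : φ₂ z ∈ Metric.ball (φ₂ z₀) ρ := mem_ball_iff_norm.2 (by linarith)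
  have b₂' : φ₂ z + k • X₂ ∈ Metric.ball (φ₂ z₀) ρ := by
    rw [mem_ball_iff_norm]
    have h3 : |k| * m ≤ 2 / R * m := mul_le_mul_of_nonneg_right hk hm0.le
    have h4 := norm_add_le (φ₂ z - φ₂ z₀) (k • X₂)
    rw [sub_add_eq_add_sub] at h4
    linarith
  have hTay := ((hT _ b₁').2.2 _ b₂').2
  have hzz : φ₂.symm (φ₂ z) = z := φ₂.left_inv z₂
  have hfd : fderiv ℝ (φ₁ ∘ φ₂.symm) (φ₂ z) X₂ = X₁ := by
    have := fderiv_chart_change_chartField g x₁ x₂ (hball b₁').1 (hball b₁').2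
    rw [← hφ₁, ← hφ₂, hzz] at this
    exact this
  rw [add_sub_cancel_left, map_smul, hfd] at hTay
  have hf0 : (φ₁ ∘ φ₂.symm) (φ₂ z) = φ₁ z := by simp only [Function.comp, hzz]
  rw [hf0] at hTay
  set err := (φ₁ ∘ φ₂.symm) (φ₂ z + k • X₂) - φ₁ z - k • X₁ with herr
  have herr1 : ‖err‖ ≤ A * m ^ 2 * k ^ 2 := by
    refine hTay.trans ?_
    calc A * ‖k • X₂‖ ^ 2 ≤ A * (|k| * m) ^ 2 := by gcongr
      _ = A * m ^ 2 * |k| ^ 2 := by ring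
      _ = _ := by rw [sq_abs]
  have herr2 : ‖(k - h)⁻¹ • err‖ < δ / 2 := by
    rw [norm_smul, norm_inv, Real.norm_eq_abs, abs_of_pos hkh0, inv_mul_lt_iff₀ hkh0]
    refine herr1.trans_lt ?_
    rw [hkh]
    have e1 : 4 * A * m ^ 2 < b * δ := by
      rw [← div_lt_iff₀ hδ]; exact hb₀.trans_le hb.1
    have hk2 : 0 < k ^ 2 := by positivity
    rw [div_mul_eq_mul_div, lt_div_iff₀ hq.2]
    calc A * m ^ 2 * k ^ 2 * (r / (r - b)) ≤ A * m ^ 2 * k ^ 2 * 2 :=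
          mul_le_mul_of_nonneg_left hq.1 (by positivity)
      _ = k ^ 2 * (4 * A * m ^ 2) / 2 := by ring
      _ < k ^ 2 * (b * δ) / 2 := by gcongr
      _ = _ := by ring
  -- in the chart of `x₁`, the end points of the two pushes differ by the vector `w`, whose
  -- direction is close to that of the time field
  set w := (k - h) • X₁ + err with hw
  have hwv : w = (k - h) • (X₁ + (k - h)⁻¹ • err) := by
    rw [smul_add, smul_smul, mul_inv_cancel₀ hkh0.ne', one_smul]
  have hseg := mem_future_of_segment g x₁ (y := φ₁ z + h • X₁) (w := w) (fun s hs => by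
    have p1 : φ₁ z + h • X₁ + s • w ∈ Metric.ball (φ₁ z₀) δ := by
      have e1 : φ₁ z + h • X₁ + s • w - φ₁ z₀ =
          (φ₁ z - φ₁ z₀) + (((1 - s) * h + s * k) • X₁ + s • err) := by
        rw [hw, smul_add, smul_smul, show (1 - s) * h + s * k = h + s * (k - h) by ring, add_smul]
        abel
      have e2 : |(1 - s) * h + s * k| ≤ 2 / R := by
        refine (abs_add_le _ _).trans ?_
        rw [abs_mul, abs_mul, abs_of_nonneg hs.1, abs_of_nonneg (sub_nonneg.2 hs.2)]
        have := mul_le_mul_of_nonneg_left hh (sub_nonneg.2 hs.2)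
        have := mul_le_mul_of_nonneg_left hk hs.1
        linarith
      have e3 : ‖((1 - s) * h + s * k) • X₁‖ ≤ 2 / R * m₁ := by
        rw [norm_smul, Real.norm_eq_abs]; gcongr
      have e4 : ‖s • err‖ ≤ A * m ^ 2 * (2 / R) ^ 2 := by
        rw [norm_smul, Real.norm_eq_abs, abs_of_nonneg hs.1]
        calc s * ‖err‖ ≤ 1 * (A * m ^ 2 * k ^ 2) := by
              gcongr; exact hs.2
          _ = A * m ^ 2 * |k| ^ 2 := by rw [one_mul, sq_abs]
          _ ≤ _ := by gcongr
      rw [mem_ball_iff_norm, e1]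
      have := norm_add_le (φ₁ z - φ₁ z₀) (((1 - s) * h + s * k) • X₁ + s • err)
      have := norm_add_le (((1 - s) * h + s * k) • X₁) (s • err)
      linarith
    have p2 : X₁ + (k - h)⁻¹ • err ∈ Metric.ball (g.chartField x₁ (φ₁ z₀)) δ := by
      rw [mem_ball_iff_norm, add_sub_right_comm]
      have := norm_add_le (X₁ - g.chartField x₁ (φ₁ z₀)) ((k - h)⁻¹ • err)
      linarith
    have := hcone (φ₁ z + h • X₁ + s • w, X₁ + (k - h)⁻¹ • err) (by
      rw [← ball_prod_same]; exact ⟨p1, p2⟩)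
    refine ⟨this.1, ?_⟩
    rw [hwv] at this ⊢
    exact this.2.smul hkh0)
  have e1 : φ₁.symm (φ₁ z + h • X₁ + w) = g.push x₂ z k := by
    have e2 : φ₁ z + h • X₁ + w = φ₁ (φ₂.symm (φ₂ z + k • X₂)) := by
      rw [hw, herr, sub_smul]; simp only [Function.comp]; abel
    rw [e2, φ₁.left_inv (hball b₂').2]
    rfl
  rw [← hφ₁, e1] at hseg
  exact hseg

/-- Uniform comparison, on compact sets, of the pushes in two charts. -/
theorem eventually_push_mem_future_push {K : Set M} (hK : IsCompact K)
    (h₁ : K ⊆ (extChartAt 𝓘(ℝ, E) x₁).source) (h₂ : K ⊆ (extChartAt 𝓘(ℝ, E) x₂).source) :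
    ∀ᶠ b₀ : ℝ in atTop, ∀ b₁ : ℝ, ∀ᶠ R : ℝ in atTop, ∀ z ∈ K, ∀ b ∈ Icc b₀ b₁,
      ∀ r : ℝ, R ≤ |r| → g.push x₂ z (1 / (r - b)) ∈ g.future (g.push x₁ z (1 / r)) := by
  refine hK.induction_on (p := fun S => ∀ᶠ b₀ : ℝ in atTop, ∀ b₁ : ℝ, ∀ᶠ R : ℝ in atTop,
    ∀ z ∈ S, ∀ b ∈ Icc b₀ b₁, ∀ r : ℝ, R ≤ |r| →
      g.push x₂ z (1 / (r - b)) ∈ g.future (g.push x₁ z (1 / r))) ?_ ?_ ?_ ?_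
  · exact Eventually.of_forall fun _ _ => Eventually.of_forall fun _ z hz => absurd hz (by simp)
  · intro S T hST hT
    filter_upwards [hT] with b₀ h b₁
    filter_upwards [h b₁] with R hR z hz using hR z (hST hz)
  · intro S T hS hT
    filter_upwards [hS, hT] with b₀ h h' b₁
    filter_upwards [h b₁, h' b₁] with R hR hR' z hz
    exact hz.elim (hR z) (hR' z)
  · intro z hz
    obtain ⟨N, hN, h⟩ := exists_nhds_push_mem_future_push g x₁ x₂ (h₁ hz) (h₂ hz)
    exact ⟨N, mem_nhdsWithin_of_mem_nhds hN, h⟩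

end TimeOrientedMetric

/-! ### Pushing a segment of definite size -/

namespace TimeOrientedMetric

variable {E : Type*} [NormedAddCommGroup E] [NormedSpace ℝ E]
  {M : Type*} [TopologicalSpace M] [ChartedSpace E M] [IsManifold 𝓘(ℝ, E) ∞ M]
  {g : TimeOrientedMetric E M} {x₀ : M} [FiniteDimensional ℝ E]

/-- Along a timelike curve in a chart ball, the linear time function increases and bounds the
displacement between any two points. -/
theorem ChartBounds.chartClock_le {A ρ : ℝ} (hP : g.ChartBounds x₀ A ρ) {μ : ℝ → M} {s t : ℝ}
    (hμ : PiecewiseC1 g.IsFutureTimelike μ s t) (hball : ∀ τ ∈ Icc s t, μ τ ∈ chartBall E x₀ ρ)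
    {τ τ' : ℝ} (h1 : s ≤ τ) (h2 : τ ≤ τ') (h3 : τ' ≤ t) :
    ‖extChartAt 𝓘(ℝ, E) x₀ (μ τ') - extChartAt 𝓘(ℝ, E) x₀ (μ τ)‖ ≤
      A * (g.chartClock x₀ (μ τ') - g.chartClock x₀ (μ τ)) ∧
    g.chartClock x₀ (μ τ) ≤ g.chartClock x₀ (μ τ') := by
  have hA : 0 < A := by linarith [hP.one_le]
  rcases h2.eq_or_lt with rfl | h2
  · simp
  have h4 := (hP.exists_reaches (hμ.restrict h1 h2 h3)
    fun x hx => hball x ⟨h1.trans hx.1, hx.2.trans h3⟩).1 τ' ⟨h2.le, le_rfl⟩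
  exact ⟨h4, sub_nonneg.1 (nonneg_of_mul_nonneg_right ((norm_nonneg _).trans h4) hA)⟩

/-- The effect of pushing a segment of a timelike curve whose displacement in the chart is bounded
below. In terms of the inverse `r` of the size of the push, the push passes from `r` to `r / e - C`,
where `e` depends on the segment only, and it gains a length of order `1 / |r|`. -/
theorem ChartBounds.eventually_reaches {A ρ : ℝ} (hP : g.ChartBounds x₀ A ρ) :
    ∀ᶠ L : ℝ in atTop, ∀ᶠ C : ℝ in atTop, ∀ᶠ R : ℝ in atTop, ∀ (μ : ℝ → M) (s t : ℝ),
      PiecewiseC1 g.IsFutureTimelike μ s t → (∀ τ ∈ Icc s t, μ τ ∈ chartBall E x₀ ρ) →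
      ρ / 4 ≤ ‖extChartAt 𝓘(ℝ, E) x₀ (μ t) - extChartAt 𝓘(ℝ, E) x₀ (μ s)‖ →
      ∃ e : ℝ, 1 / L ≤ e ∧ e ≤ L ∧ ∀ r : ℝ, R ≤ |r| → R ≤ |r / e - C| → 0 < r * (r / e - C) →
        g.Reaches (g.push x₀ (μ s) (1 / r)) (g.push x₀ (μ t) (1 / (r / e - C)))
          (1 / (L * |r|)) := by
  have hA1 := hP.one_le
  have hA : 0 < A := by linarith
  have hρ := hP.pos
  -- `σ₁` and `σ₂` bound the increase of the linear time function along the segment, and `Λ` bounds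
  -- the stretching factor
  set σ₁ := ρ / (4 * A) with hσ₁
  set σ₂ := 2 * A * ρ with hσ₂
  have hσ₁0 : 0 < σ₁ := by positivity
  have hσ₂0 : 0 < σ₂ := by positivity
  set Λ := Real.exp (A ^ 3 * σ₂) with hΛ
  have hΛ1 : 1 ≤ Λ := Real.one_le_exp (by positivity)
  have hΛ0 : 0 < Λ := by linarith
  filter_upwards [eventually_ge_atTop Λ, eventually_ge_atTop (2 * A * Λ / σ₁)] with L hL1 hL2
  filter_upwards [eventually_ge_atTop (5 * A ^ 7 * Λ * Λ * σ₂), eventually_gt_atTop 0] with C hC hC0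
  filter_upwards [eventually_ge_atTop (C * Λ / σ₁ * Λ), eventually_ge_atTop (Λ / ρ * Λ),
    eventually_ge_atTop (4 * A ^ 4 * Λ * Λ), eventually_ge_atTop (C * Λ), eventually_gt_atTop 0]
    with R hR1 hR2 hR3 hR4 hR0
  intro μ s t hμ hball hdisp
  obtain ⟨-, ε, hε, h⟩ := hP.exists_reaches hμ hball
  have hst := hμ.lt
  have hmono : ∀ τ ∈ Icc s t, g.chartClock x₀ (μ s) ≤ g.chartClock x₀ (μ τ) ∧
      g.chartClock x₀ (μ τ) ≤ g.chartClock x₀ (μ t) := fun τ hτ =>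
    ⟨(hP.chartClock_le hμ hball le_rfl hτ.1 hτ.2).2, (hP.chartClock_le hμ hball hτ.1 hτ.2 le_rfl).2⟩
  set σ := g.chartClock x₀ (μ t) - g.chartClock x₀ (μ s) with hσ
  have hs1 : σ₁ ≤ σ := by
    have := hdisp.trans (hP.chartClock_le hμ hball le_rfl hst.le le_rfl).1
    rw [hσ₁, div_le_iff₀ (by positivity)]
    linarith
  have hs2 : σ ≤ σ₂ := by
    have e1 : σ = linearClock (g.chartMetric x₀) (g.chartField x₀) (extChartAt 𝓘(ℝ, E) x₀ x₀)
        (extChartAt 𝓘(ℝ, E) x₀ (μ t) - extChartAt 𝓘(ℝ, E) x₀ (μ s)) := by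
      rw [map_sub]; rfl
    have e2 := (hball t (right_mem_Icc.2 hst.le)).2
    have e3 := (hball s (left_mem_Icc.2 hst.le)).2
    rw [mem_ball_iff_norm] at e2 e3
    have e4 : ‖extChartAt 𝓘(ℝ, E) x₀ (μ t) - extChartAt 𝓘(ℝ, E) x₀ (μ s)‖ ≤ 2 * ρ := by
      have := norm_sub_le (extChartAt 𝓘(ℝ, E) x₀ (μ t) - extChartAt 𝓘(ℝ, E) x₀ x₀)
        (extChartAt 𝓘(ℝ, E) x₀ (μ s) - extChartAt 𝓘(ℝ, E) x₀ x₀)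
      rw [sub_sub_sub_cancel_right] at this
      linarith
    calc σ ≤ A * ‖extChartAt 𝓘(ℝ, E) x₀ (μ t) - extChartAt 𝓘(ℝ, E) x₀ (μ s)‖ := by
          rw [e1]; exact hP.clock_le _
      _ ≤ A * (2 * ρ) := by gcongr
      _ = σ₂ := by rw [hσ₂]; ring
  have hσ0 : 0 < σ := hσ₁0.trans_le hs1
  have hA3 := pow_pos hA 3
  have hεσ : |ε| ≤ A ^ 3 * σ₂ := hε.trans (mul_le_mul_of_nonneg_left hs2 hA3.le)
  set e := Real.exp ε with he
  have he0 : 0 < e := Real.exp_pos ε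
  have heΛ : e ≤ Λ := Real.exp_le_exp.2 (abs_le.1 hεσ).2
  have heΛ' : 1 / Λ ≤ e := by
    rw [one_div, hΛ, ← Real.exp_neg]
    exact Real.exp_le_exp.2 (abs_le.1 hεσ).1
  refine ⟨e, (one_div_le_one_div_of_le hΛ0 hL1).trans heΛ', heΛ.trans hL1, fun r h1 h2 h3 => ?_⟩
  -- the rate `B` is chosen so that the decrease over the whole segment is `C * e`
  set B := C * e / σ with hB
  have hBσ : B * σ = C * e := by rw [hB]; field_simp
  have hB0 : 0 < B := by positivity
  have hB1 : 5 * A ^ 7 * Λ ≤ B := by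
    rw [hB, le_div_iff₀ hσ0]
    have e1 : 1 ≤ Λ * e := by
      rw [div_le_iff₀ hΛ0] at heΛ'; linarith
    calc 5 * A ^ 7 * Λ * σ ≤ 5 * A ^ 7 * Λ * σ₂ * (Λ * e) :=
          (mul_le_mul_of_nonneg_left hs2 (by positivity)).trans
            (le_mul_of_one_le_right (by positivity) e1)
      _ = 5 * A ^ 7 * Λ * Λ * σ₂ * e := by ring
      _ ≤ C * e := by gcongr
  have hB2 : B ≤ C * Λ / σ₁ := by
    rw [hB]; gcongr
  have hr0 : 0 < |r| := hR0.trans_le h1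
  have hbound : ∀ τ ∈ Icc s t, R / Λ ≤ |r - B * (g.chartClock x₀ (μ τ) - g.chartClock x₀ (μ s))| ∧
      |r - B * (g.chartClock x₀ (μ τ) - g.chartClock x₀ (μ s))| ≤ 2 * |r| := by
    intro τ hτ
    obtain ⟨m1, m2⟩ := hmono τ hτ
    have m3 : 0 ≤ B * (g.chartClock x₀ (μ τ) - g.chartClock x₀ (μ s)) :=
      mul_nonneg hB0.le (by linarith)
    have m4 : B * (g.chartClock x₀ (μ τ) - g.chartClock x₀ (μ s)) ≤ C * e := by
      rw [← hBσ]; exact mul_le_mul_of_nonneg_left (by linarith) hB0.le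
    have hRΛ : R / Λ ≤ R := div_le_self hR0.le hΛ1
    rcases lt_or_gt_of_ne (abs_pos.1 hr0) with hneg | hpos
    · rw [abs_of_neg hneg] at h1 ⊢
      rw [abs_of_neg (by linarith)]
      have : C * e ≤ C * Λ := by gcongr
      constructor <;> linarith
    · have hpos' : 0 < r / e - C := (pos_iff_pos_of_mul_pos h3).1 hpos
      rw [abs_of_pos hpos'] at h2
      rw [abs_of_pos hpos] at h1 ⊢
      have e1 : R / Λ ≤ r - C * e := by
        calc R / Λ = R * (1 / Λ) := by ring
          _ ≤ (r / e - C) * e := mul_le_mul h2 heΛ' (by positivity) hpos'.le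
          _ = r - C * e := by field_simp
      have e2 : 0 < R / Λ := by positivity
      rw [abs_of_pos (by linarith)]
      constructor <;> linarith
  have key := h B (1 / Λ) Λ 1 (r + B * g.chartClock x₀ (μ s)) (2 * |r|) (by positivity) one_pos
    (by
      rw [one_mul, one_div, hΛ, ← Real.exp_neg]
      exact Real.exp_le_exp.2 (neg_le_neg (mul_le_mul_of_nonneg_left hs2 hA3.le)))
    (by
      rw [one_mul]
      exact Real.exp_le_exp.2 (mul_le_mul_of_nonneg_left hs2 hA3.le)) hB1 (fun τ hτ => by
      obtain ⟨m1, m2⟩ := hbound τ hτ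
      rw [show r + B * g.chartClock x₀ (μ s) - B * g.chartClock x₀ (μ τ) =
        r - B * (g.chartClock x₀ (μ τ) - g.chartClock x₀ (μ s)) by ring]
      refine ⟨hB2.trans (((le_div_iff₀ hΛ0).2 hR1).trans m1), ?_,
        ((le_div_iff₀ hΛ0).2 hR3).trans m1, m2⟩
      have := ((le_div_iff₀ hΛ0).2 hR2).trans m1
      rwa [div_le_iff₀ hρ, mul_comm] at this)
  rw [add_sub_cancel_right, one_mul,
    show r + B * g.chartClock x₀ (μ s) - B * g.chartClock x₀ (μ t) = e * (r / e - C) by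
      rw [mul_sub, mul_div_cancel₀ _ he0.ne', mul_comm e C, ← hBσ, hσ]; ring,
    div_mul_eq_div_div, div_self he0.ne'] at key
  refine key.mono ?_
  have hL0 : 0 < L := hΛ0.trans_le hL1
  rw [div_mul_eq_mul_div, div_le_div_iff₀ (by positivity) (by positivity)]
  have e1 : 2 * A * Λ ≤ L * σ := by
    rw [div_le_iff₀ hσ₁0] at hL2
    exact hL2.trans (mul_le_mul_of_nonneg_left hs1 (hΛ0.le.trans hL1))
  calc 1 * (A * (2 * |r|)) = (2 * A * Λ) * |r| / Λ := by field_simp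
    _ ≤ (L * σ) * |r| / Λ := by gcongr
    _ = _ := by ring

end TimeOrientedMetric

/-! ### Finitely many charts -/

namespace TimeOrientedMetric

variable {E : Type*} [NormedAddCommGroup E] [NormedSpace ℝ E]
  {M : Type*} [TopologicalSpace M] [ChartedSpace E M]

variable (E) in
/-- The closed ball of radius `ρ` about `x₀` in the chart centred at `x₀`. -/
def chartDisk (x₀ : M) (ρ : ℝ) : Set M :=
  {p | p ∈ (extChartAt 𝓘(ℝ, E) x₀).source ∧
    extChartAt 𝓘(ℝ, E) x₀ p ∈ Metric.closedBall (extChartAt 𝓘(ℝ, E) x₀ x₀) ρ}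

theorem isCompact_chartDisk [FiniteDimensional ℝ E] {x₀ : M} {ρ : ℝ}
    (h : Metric.closedBall (extChartAt 𝓘(ℝ, E) x₀ x₀) ρ ⊆ (extChartAt 𝓘(ℝ, E) x₀).target) :
    IsCompact (chartDisk E x₀ ρ) := by
  have e : chartDisk E x₀ ρ = (extChartAt 𝓘(ℝ, E) x₀).symm ''
      Metric.closedBall (extChartAt 𝓘(ℝ, E) x₀ x₀) ρ := by
    ext p
    constructor
    · rintro ⟨h1, h2⟩
      exact ⟨_, h2, (extChartAt 𝓘(ℝ, E) x₀).left_inv h1⟩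
    · rintro ⟨y, hy, rfl⟩
      refine ⟨(extChartAt 𝓘(ℝ, E) x₀).map_target (h hy), ?_⟩
      rwa [(extChartAt 𝓘(ℝ, E) x₀).right_inv (h hy)]
  rw [e]
  have : ProperSpace E := FiniteDimensional.proper ℝ E
  exact (isCompact_closedBall _ _).image_of_continuousOn
    ((continuousOn_extChartAt_symm (I := 𝓘(ℝ, E)) x₀).mono h)

variable [IsManifold 𝓘(ℝ, E) ∞ M] {g : TimeOrientedMetric E M} [FiniteDimensional ℝ E]

theorem ChartBounds.isCompact_chartDisk {x₀ : M} {A ρ : ℝ} (hP : g.ChartBounds x₀ A ρ) :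
    IsCompact (chartDisk E x₀ (ρ / 2)) :=
  TimeOrientedMetric.isCompact_chartDisk
    ((Metric.closedBall_subset_ball (half_lt_self hP.pos)).trans hP.subset)

omit [FiniteDimensional ℝ E] in
theorem ChartBounds.chartDisk_subset {x₀ : M} {A ρ : ℝ} (hP : g.ChartBounds x₀ A ρ) :
    chartDisk E x₀ (ρ / 2) ⊆ chartBall E x₀ ρ := fun _ hp =>
  ⟨hp.1, Metric.closedBall_subset_ball (half_lt_self hP.pos) hp.2⟩

/-- Pushing, and changing the chart at the past end of the segment, for finitely many charts with
the same constants. A larger decrease `C` than the least one needed for the change of the chart and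
for the push along the segment is achieved by a further push at the future end. -/
theorem exists_uniform_reaches [T2Space M] (I : Finset M) {A ρ : M → ℝ}
    (hP : ∀ x, g.ChartBounds x (A x) (ρ x)) :
    ∃ L C₀ R : ℝ, 1 ≤ L ∧ 0 < C₀ ∧ 0 < R ∧
      (∀ x ∈ I, ∀ z ∈ chartDisk E x (ρ x / 2), ∀ h h' : ℝ, |h| ≤ 1 / R → |h'| ≤ 1 / R → h < h' →
        g.push x z h' ∈ g.future (g.push x z h)) ∧
      ∀ x ∈ I, ∀ x' ∈ I, ∀ (μ : ℝ → M) (s t : ℝ), PiecewiseC1 g.IsFutureTimelike μ s t →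
        (∀ τ ∈ Icc s t, μ τ ∈ chartDisk E x (ρ x / 2)) →
        ρ x / 4 ≤ ‖extChartAt 𝓘(ℝ, E) x (μ t) - extChartAt 𝓘(ℝ, E) x (μ s)‖ →
        μ s ∈ chartDisk E x' (ρ x' / 2) →
        ∃ e : ℝ, 1 / L ≤ e ∧ e ≤ L ∧ ∀ C r : ℝ, C₀ ≤ C → R ≤ |r| → R ≤ |r / e - C| →
          0 < r * (r / e - C) →
          g.Reaches (g.push x' (μ s) (1 / r)) (g.push x (μ t) (1 / (r / e - C)))
            (1 / (L * |r|)) := by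
  have ev1 := (eventually_all_finset I).2 fun x _ => (hP x).eventually_reaches
  obtain ⟨L, hL, hL1⟩ := (ev1.and (eventually_ge_atTop 1)).exists
  have hL0 : 0 < L := by linarith
  have ev2 := (eventually_all_finset I).2 fun x _ => (eventually_all_finset I).2 fun x' _ =>
    eventually_push_mem_future_push g x' x
      ((hP x).isCompact_chartDisk.inter (hP x').isCompact_chartDisk)
      (fun p hp => hp.2.1) (fun p hp => hp.1.1)
  obtain ⟨b₀, hb, hb0⟩ := (ev2.and (eventually_gt_atTop 0)).exists
  obtain ⟨C₁, hC₁, hC₁0⟩ := (((eventually_all_finset I).2 hL).and (eventually_gt_atTop 0)).exists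
  have ev3 := (eventually_all_finset I).2 fun x hx =>
    (((eventually_all_finset I).2 fun x' hx' => hb x hx x' hx' (L * (L * b₀))).and
      (hC₁ x hx)).and (eventually_forall_push_mem_future g x (hP x).isCompact_chartDisk
        fun p hp => hp.1)
  obtain ⟨R₁, ⟨hR, hR2⟩, hR0⟩ := ((ev3.and (eventually_ge_atTop (L * (L * b₀)))).and
    (eventually_gt_atTop 0)).exists
  have hRR : R₁ ≤ L * R₁ := le_mul_of_one_le_left hR0.le hL1
  have hpush : ∀ x ∈ I, ∀ z ∈ chartDisk E x (ρ x / 2), ∀ h h' : ℝ, |h| ≤ 1 / R₁ →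
      |h'| ≤ 1 / R₁ → h < h' → g.push x z h' ∈ g.future (g.push x z h) := fun x hx => (hR x hx).2
  refine ⟨2 * L, C₁ + L * b₀, L * R₁, by linarith, by positivity, by positivity, ?_, ?_⟩
  · have := one_div_le_one_div_of_le hR0 hRR
    exact fun x hx z hz h h' h1 h2 => hpush x hx z hz h h' (h1.trans this) (h2.trans this)
  intro x hx x' hx' μ s t hμ hdisk hdisp hs
  obtain ⟨e, he1, he2, he⟩ := (hR x hx).1.2 μ s t hμ
    (fun τ hτ => (hP x).chartDisk_subset (hdisk τ hτ)) hdisp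
  have he0 : 0 < e := lt_of_lt_of_le (by positivity) he1
  refine ⟨e, le_trans ?_ he1, by linarith, fun C r hC h1 h2 h3 => ?_⟩
  · exact one_div_le_one_div_of_le hL0 (by linarith)
  set b := L * b₀ * e with hb'
  have hbmem : b ∈ Icc b₀ (L * (L * b₀)) := by
    constructor
    · calc b₀ = L * b₀ * (1 / L) := by field_simp
        _ ≤ _ := mul_le_mul_of_nonneg_left he1 (by positivity)
    · calc b ≤ L * b₀ * L := mul_le_mul_of_nonneg_left he2 (by positivity)
        _ = _ := by ring
  have hbp : 0 < b := hb0.trans_le hbmem.1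
  have hr0 : 0 < |r| := lt_of_lt_of_le (by positivity) h1
  have step1 := (hR x hx).1.1 x' hx' (μ s) ⟨hdisk s (left_mem_Icc.2 hμ.lt.le), hs⟩ b hbmem r
    (hRR.trans h1)
  -- the three stages of the decrease from `r / e` to `r / e - C`
  have e1 : (r - b) / e - C₁ = r / e - C + (C - (C₁ + L * b₀)) := by
    rw [hb']; field_simp; ring
  have hw : 0 ≤ C - (C₁ + L * b₀) := by linarith
  set w := C - (C₁ + L * b₀)
  set r' := r / e - C
  have hcond : R₁ ≤ |r - b| ∧ R₁ ≤ |r' + w| ∧ 0 < (r - b) * (r' + w) ∧ |r - b| ≤ 2 * |r| ∧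
      0 < (r' + w) * r' := by
    have habs : |r - b| ≤ 2 * |r| := by
      have := abs_sub r b
      rw [abs_of_pos hbp] at this
      linarith [hbmem.2]
    rcases lt_or_gt_of_ne (abs_pos.1 hr0) with hneg | hpos
    · have hneg' : r' < 0 := (neg_iff_neg_of_mul_pos h3).1 hneg
      have a1 : R₁ ≤ |r - b| := by
        rw [abs_of_neg (by linarith)]
        rw [abs_of_neg hneg] at h1
        linarith
      have a2 : r' + w ≤ -R₁ := by
        rw [← e1, sub_le_iff_le_add, div_le_iff₀ he0]
        rw [abs_of_neg hneg] at h1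
        have : R₁ * e ≤ L * R₁ := by rw [mul_comm]; gcongr
        have : 0 < C₁ * e := by positivity
        linarith
      refine ⟨a1, ?_, mul_pos_of_neg_of_neg (by linarith) (by linarith), habs,
        mul_pos_of_neg_of_neg (by linarith) hneg'⟩
      rw [abs_of_neg (by linarith)]; linarith
    · have hpos' : 0 < r' := (pos_iff_pos_of_mul_pos h3).1 hpos
      rw [abs_of_pos hpos'] at h2
      have a1 : R₁ ≤ r - b := by
        have : r - b = e * (r' + w + C₁) := by rw [← e1]; field_simp; ring
        rw [this]
        calc R₁ = 1 / L * (L * R₁) := by field_simp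
          _ ≤ e * (r' + w + C₁) := by gcongr; linarith
      refine ⟨a1.trans (le_abs_self _), ?_, mul_pos (by linarith) (by linarith), habs,
        mul_pos (by linarith) hpos'⟩
      rw [abs_of_pos (by linarith)]; linarith
  obtain ⟨c1, c2, c3, c4, c5⟩ := hcond
  have step2 := he (r - b) c1 (by rwa [e1]) (by rwa [e1])
  rw [e1] at step2
  have step12 := (reaches_zero g step1).trans step2 le_rfl (by positivity)
  have hrb0 : 0 < |r - b| := hR0.trans_le c1
  have hgain : 1 / (2 * L * |r|) ≤ 0 + 1 / (L * |r - b|) := by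
    rw [zero_add]
    refine one_div_le_one_div_of_le (by positivity) ?_
    calc L * |r - b| ≤ L * (2 * |r|) := by gcongr
      _ = _ := by ring
  have step12' := step12.mono hgain
  rcases hw.eq_or_lt with hw | hw
  · rwa [← hw, add_zero] at step12'
  have step3 := hpush x hx (μ t) (hdisk t (right_mem_Icc.2 hμ.lt.le)) (1 / (r' + w)) (1 / r') (by
      rw [abs_div, abs_one]; exact one_div_le_one_div_of_le hR0 c2) (by
      rw [abs_div, abs_one]; exact one_div_le_one_div_of_le hR0 (hRR.trans h2)) (by
      have n1 : r' + w ≠ 0 := left_ne_zero_of_mul c5.ne'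
      have n2 : r' ≠ 0 := right_ne_zero_of_mul c5.ne'
      rw [← sub_pos, show 1 / r' - 1 / (r' + w) = w / ((r' + w) * r') by field_simp; ring]
      positivity)
  have := step12'.trans (reaches_zero g step3) (by positivity) le_rfl
  rwa [add_zero] at this

end TimeOrientedMetric

/-! ### The recursion for the size of the push -/

/-- The product of the inverses of the first `n` stretching factors, which solves the recursion
`r n = r (n + 1) / e n - C` up to the inhomogeneous term: `r n * invProd e n` increases by
`C * invProd e n` at each step. -/
noncomputable def invProd (e : ℕ → ℝ) (n : ℕ) : ℝ := ∏ k ∈ Finset.range n, (e k)⁻¹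

theorem invProd_succ (e : ℕ → ℝ) (n : ℕ) : invProd e (n + 1) = invProd e n * (e n)⁻¹ :=
  Finset.prod_range_succ _ _

theorem invProd_pos {e : ℕ → ℝ} (he : ∀ n, 0 < e n) (n : ℕ) : 0 < invProd e n :=
  Finset.prod_pos fun k _ => inv_pos.2 (he k)

theorem log_add_sub_log_le {a b : ℝ} (ha : 0 < a) (hb : 0 ≤ b) :
    Real.log (a + b) - Real.log a ≤ b / a := by
  rw [← Real.log_div (by positivity) ha.ne']
  have := Real.log_le_sub_one_of_pos (show 0 < (a + b) / a by positivity)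
  rw [add_div, div_self ha.ne'] at this ⊢
  linarith

/-- If the products of inverse stretching factors are not summable, the recursion
`r n = r (n + 1) / e n - C` has a positive solution that starts at `ρ` and for which the gains sum
up to infinity: up to a constant factor they dominate the increments of the logarithm of the
normalised solution, which tends to infinity. -/
theorem exists_recursion_pos {e : ℕ → ℝ} {L C R ρ : ℝ} (hL : 1 ≤ L) (hR : 0 < R)
    (he1 : ∀ n, 1 / L ≤ e n) (he2 : ∀ n, e n ≤ L) (hC : L * R ≤ C) (hρ : R ≤ ρ)
    (hS : ¬ Summable (invProd e)) :
    ∃ r : ℕ → ℝ, r 0 = ρ ∧ (∀ n, r n = r (n + 1) / e n - C) ∧ (∀ n, R ≤ r n) ∧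
      Tendsto (fun N => ∑ n ∈ Finset.range N, 1 / (L * |r (n + 1)|)) atTop atTop := by
  have hL0 : 0 < L := by linarith
  have hC0 : 0 < C := lt_of_lt_of_le (by positivity) hC
  have he0 : ∀ n, 0 < e n := fun n => lt_of_lt_of_le (by positivity) (he1 n)
  have hE := invProd_pos he0
  -- `y` is the normalised solution
  set y : ℕ → ℝ := fun n => ρ + C * ∑ k ∈ Finset.range n, invProd e k with hy
  have hy1 : ∀ n, y (n + 1) = y n + C * invProd e n := fun n => by
    simp only [hy, Finset.sum_range_succ]; ring
  have hy0 : ∀ n, 0 < y n := fun n => by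
    have : 0 ≤ ∑ k ∈ Finset.range n, invProd e k := Finset.sum_nonneg fun k _ => (hE k).le
    have : 0 ≤ C * ∑ k ∈ Finset.range n, invProd e k := by positivity
    simp only [hy]; linarith
  have hrec : ∀ n, y n / invProd e n = y (n + 1) / invProd e (n + 1) / e n - C := fun n => by
    have := (hE n).ne'
    have := (he0 n).ne'
    rw [hy1, invProd_succ]; field_simp; ring
  have hRr : ∀ n, R ≤ y n / invProd e n := by
    intro n
    cases n with
    | zero => simpa [hy, invProd] using hρ
    | succ n =>
      have h1 : y (n + 1) / invProd e (n + 1) = e n * (y n / invProd e n + C) := by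
        rw [hrec n]; have := (he0 n).ne'; field_simp; ring
      have h2 := div_pos (hy0 n) (hE n)
      rw [h1]
      calc R = 1 / L * (L * R) := by field_simp
        _ ≤ e n * (y n / invProd e n + C) :=
          mul_le_mul (he1 n) (by linarith) (by positivity) (he0 n).le
  refine ⟨fun n => y n / invProd e n, by simp [hy, invProd], hrec, hRr, ?_⟩
  set c := C * L ^ 2 * (1 + C / R) with hc
  have hc0 : 0 < c := by positivity
  have hstep : ∀ n, Real.log (y (n + 1)) - Real.log (y n) ≤
      c * (1 / (L * |y (n + 1) / invProd e (n + 1)|)) := by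
    intro n
    rw [abs_of_pos (div_pos (hy0 _) (hE _))]
    have h1 : C * invProd e n ≤ C * L * invProd e (n + 1) := by
      rw [invProd_succ, mul_assoc]
      refine mul_le_mul_of_nonneg_left ?_ hC0.le
      rw [mul_left_comm, ← div_eq_mul_inv]
      exact le_mul_of_one_le_right (hE n).le ((one_le_div (he0 n)).2 (he2 n))
    have h2 : y (n + 1) ≤ y n * (1 + C / R) := by
      have := hRr n
      rw [le_div_iff₀ (hE n)] at this
      rw [hy1, mul_add, mul_one, mul_div_assoc', add_le_add_iff_left, le_div_iff₀ hR]
      calc C * invProd e n * R = C * (R * invProd e n) := by ring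
        _ ≤ C * y n := by gcongr
        _ = _ := by ring
    have h3 : 1 / y n ≤ (1 + C / R) / y (n + 1) := by
      rw [div_le_div_iff₀ (hy0 n) (hy0 _)]; linarith
    have h4 := log_add_sub_log_le (hy0 n) (mul_nonneg hC0.le (hE n).le)
    rw [← hy1] at h4
    refine h4.trans ?_
    calc C * invProd e n / y n = C * invProd e n * (1 / y n) := by ring
      _ ≤ C * L * invProd e (n + 1) * ((1 + C / R) / y (n + 1)) := by
        have := hy0 n
        have := hE (n + 1)
        gcongr
      _ = _ := by rw [hc]; field_simp
  have hsum : ∀ N, (Real.log (y N) - Real.log (y 0)) / c ≤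
      ∑ n ∈ Finset.range N, 1 / (L * |y (n + 1) / invProd e (n + 1)|) := by
    intro N
    rw [div_le_iff₀ hc0, ← Finset.sum_range_sub (fun n => Real.log (y n)), Finset.sum_mul]
    exact Finset.sum_le_sum fun n _ => (hstep n).trans_eq (mul_comm _ _)
  refine tendsto_atTop_mono hsum ((tendsto_atTop_add_const_right _ _ ?_).atTop_div_const hc0)
  refine Real.tendsto_log_atTop.comp (tendsto_atTop_add_const_left _ _ ?_)
  exact ((not_summable_iff_tendsto_nat_atTop_of_nonneg fun n => (hE n).le).1 hS).const_mul_atTop hC0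

/-- If the products of inverse stretching factors tend to zero, the recursion
`r n = r (n + 1) / e n - C`, solved backwards from the value `-ρ` at `N`, has negative solutions
with arbitrarily large gain: the absolute value of the normalised solution grows, from `N` back to
`0`, from a value that is small for large `N` to one that is at least `C`. -/
theorem eventually_exists_recursion_neg {e : ℕ → ℝ} {L C R ρ : ℝ} (hL : 1 ≤ L) (hR : 0 < R)
    (he1 : ∀ n, 1 / L ≤ e n) (he2 : ∀ n, e n ≤ L) (hC : R ≤ C) (hρ : R ≤ ρ)
    (hE0 : Tendsto (invProd e) atTop (𝓝 0)) (D : ℝ) :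
    ∀ᶠ N in atTop, ∃ r : ℕ → ℝ, r N = -ρ ∧ (∀ n, r n = r (n + 1) / e n - C) ∧
      (∀ n ≤ N, r n ≤ -R) ∧ D ≤ ∑ n ∈ Finset.range N, 1 / (L * |r (n + 1)|) := by
  have hL0 : 0 < L := by linarith
  have hC0 : 0 < C := by linarith
  have hρ0 : 0 < ρ := by linarith
  have he0 : ∀ n, 0 < e n := fun n => lt_of_lt_of_le (by positivity) (he1 n)
  have hE := invProd_pos he0
  set c := C * L ^ 2 with hc
  have hc0 : 0 < c := by positivity
  have hlim : ∀ᶠ N in atTop, ρ * invProd e N < C * Real.exp (-(c * D)) := by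
    have := hE0.const_mul ρ
    rw [mul_zero] at this
    exact this.eventually_lt_const (by positivity)
  filter_upwards [hlim, eventually_ge_atTop 1] with N hN hN1
  set S : ℕ → ℝ := fun n => ∑ k ∈ Finset.range n, invProd e k with hS
  have hSm : Monotone S := monotone_nat_of_le_succ fun n => by
    simp only [hS, Finset.sum_range_succ]; linarith [hE n]
  have hS1 : ∀ n, S (n + 1) = S n + invProd e n := fun n => Finset.sum_range_succ _ _
  -- `y` is the absolute value of the normalised solution
  set y : ℕ → ℝ := fun n => ρ * invProd e N + C * (S N - S n) with hy
  have hy1 : ∀ n, y n = y (n + 1) + C * invProd e n := fun n => by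
    simp only [hy, hS1]; ring
  have hyp : ∀ n ≤ N, 0 < y n := fun n hn => by
    have h1 : 0 ≤ C * (S N - S n) := mul_nonneg hC0.le (sub_nonneg.2 (hSm hn))
    have h2 := mul_pos hρ0 (hE N)
    simp only [hy]; linarith
  have hrec : ∀ n, -(y n / invProd e n) = -(y (n + 1) / invProd e (n + 1)) / e n - C := fun n => by
    have := (hE n).ne'
    have := (he0 n).ne'
    rw [hy1 n, invProd_succ]; field_simp; ring
  have hyN : y N = ρ * invProd e N := by simp [hy]
  have hyC : ∀ n < N, C * invProd e n ≤ y n := fun n hn => by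
    rw [hy1 n]; linarith [hyp (n + 1) hn]
  refine ⟨fun n => -(y n / invProd e n), ?_, hrec, fun n hn => ?_, ?_⟩
  · simp only [hyN]
    rw [mul_div_assoc, div_self (hE N).ne', mul_one]
  · refine neg_le_neg ?_
    rw [le_div_iff₀ (hE n)]
    rcases hn.eq_or_lt with rfl | hn
    · rw [hyN]; exact mul_le_mul_of_nonneg_right hρ (hE n).le
    · exact (mul_le_mul_of_nonneg_right hC (hE n).le).trans (hyC n hn)
  have hstep : ∀ n ∈ Finset.range N, Real.log (y n) - Real.log (y (n + 1)) ≤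
      1 / (L * |-(y (n + 1) / invProd e (n + 1))|) * c := by
    intro n hn
    have hn' : n + 1 ≤ N := Finset.mem_range.1 hn
    have hyn := hyp (n + 1) hn'
    rw [abs_neg, abs_of_pos (div_pos hyn (hE _))]
    have h4 := log_add_sub_log_le hyn (mul_nonneg hC0.le (hE n).le)
    rw [← hy1] at h4
    have h1 : invProd e n ≤ L * invProd e (n + 1) := by
      rw [invProd_succ, mul_left_comm, ← div_eq_mul_inv]
      exact le_mul_of_one_le_right (hE n).le ((one_le_div (he0 n)).2 (he2 n))
    refine h4.trans ?_
    calc C * invProd e n / y (n + 1) ≤ C * (L * invProd e (n + 1)) / y (n + 1) := by gcongr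
      _ = _ := by rw [hc]; field_simp
  have hsum := Finset.sum_le_sum hstep
  rw [← Finset.sum_mul, Finset.sum_range_sub' (fun n => Real.log (y n))] at hsum
  have h1 : Real.log C ≤ Real.log (y 0) := by
    refine Real.log_le_log hC0 ?_
    simpa [invProd] using hyC 0 hN1
  have h2 : Real.log (y N) ≤ Real.log C - c * D := by
    rw [← Real.log_exp (-(c * D)) |> fun h => (by rw [h]; ring :
      Real.log C + Real.log (Real.exp (-(c * D))) = Real.log C - c * D),
      ← Real.log_mul hC0.ne' (Real.exp_pos _).ne']
    refine Real.log_le_log (hyp N le_rfl) ?_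
    rw [hyN]; exact hN.le
  refine le_of_mul_le_mul_right ?_ hc0
  linarith

/-! ### Cutting a curve without end point into segments -/

namespace TimeOrientedMetric

variable {E : Type*} [NormedAddCommGroup E] [NormedSpace ℝ E]
  {M : Type*} [TopologicalSpace M] [ChartedSpace E M]

theorem isOpen_chartBall (x₀ : M) (ρ : ℝ) : IsOpen (chartBall E x₀ ρ) :=
  (continuousOn_extChartAt (I := 𝓘(ℝ, E)) x₀).isOpen_inter_preimage
    (isOpen_extChartAt_source (I := 𝓘(ℝ, E)) x₀) Metric.isOpen_ball

variable [IsManifold 𝓘(ℝ, E) ∞ M] {g : TimeOrientedMetric E M} [FiniteDimensional ℝ E]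

omit [FiniteDimensional ℝ E] in
theorem IsFutureOn.continuousOn {μ : ℝ → M} {α β : ℝ} (h : g.IsFutureOn μ α β) {s t : ℝ}
    (hs : α < s) (ht : t ≤ β) : ContinuousOn μ (Icc s t) := by
  rcases lt_or_ge s t with h1 | h1
  · exact (h s t hs h1 ht).continuousOn
  · exact (subsingleton_Icc_of_ge h1).continuousOn _

/-- A timelike curve that stays in a compact chart ball has an end point, because its displacement
is controlled by a bounded monotone function. -/
theorem IsFutureOn.exists_tendsto_of_chartDisk {μ : ℝ → M} {α τ : ℝ} {x₀ : M} {A ρ : ℝ}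
    (hP : g.ChartBounds x₀ A ρ) (h : g.IsFutureOn μ α τ) (hατ : α < τ)
    (hd : ∀ s ∈ Ioc α τ, μ s ∈ chartDisk E x₀ (ρ / 2)) : ∃ p, Tendsto μ (𝓝[>] α) (𝓝 p) := by
  have hA : 0 < A := by linarith [hP.one_le]
  have hmono : ∀ s s', α < s → s ≤ s' → s' ≤ τ →
      ‖extChartAt 𝓘(ℝ, E) x₀ (μ s') - extChartAt 𝓘(ℝ, E) x₀ (μ s)‖ ≤
      A * (g.chartClock x₀ (μ s') - g.chartClock x₀ (μ s)) := by
    intro s s' h1 h2 h3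
    rcases h2.eq_or_lt with rfl | h2
    · simp
    · exact (hP.chartClock_le (h s s' h1 h2 h3) (fun σ hσ =>
        hP.chartDisk_subset (hd σ ⟨h1.trans_le hσ.1, hσ.2.trans h3⟩)) le_rfl h2.le le_rfl).1
  set S := (fun s => g.chartClock x₀ (μ s)) '' Ioc α τ with hS
  have hSne : S.Nonempty := ⟨_, τ, ⟨hατ, le_rfl⟩, rfl⟩
  have hbdd : BddBelow S := by
    refine ⟨g.chartClock x₀ x₀ - A * (ρ / 2), ?_⟩
    rintro _ ⟨s, hs, rfl⟩
    have h1 := (hd s hs).2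
    rw [mem_closedBall_iff_norm'] at h1
    have h2 := hP.clock_le (extChartAt 𝓘(ℝ, E) x₀ x₀ - extChartAt 𝓘(ℝ, E) x₀ (μ s))
    have h3 : g.chartClock x₀ x₀ - g.chartClock x₀ (μ s) ≤
        A * ‖extChartAt 𝓘(ℝ, E) x₀ x₀ - extChartAt 𝓘(ℝ, E) x₀ (μ s)‖ := by
      refine le_trans (le_of_eq ?_) h2
      rw [map_sub, neg_sub]
      simp only [chartClock, linearClock, neg_apply]; ring
    have h4 := mul_le_mul_of_nonneg_left h1 hA.le
    simp only
    linarith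
  have hcauchy : Cauchy (map (fun s => extChartAt 𝓘(ℝ, E) x₀ (μ s)) (𝓝[>] α)) := by
    rw [Metric.cauchy_iff]
    refine ⟨inferInstance, fun ε hε => ?_⟩
    obtain ⟨_, ⟨s, hs, rfl⟩, hlt⟩ := exists_lt_of_csInf_lt hSne
      (show sInf S < sInf S + ε / A by linarith [div_pos hε hA])
    have key : ∀ σ σ', α < σ → σ ≤ σ' → σ' < s →
        dist (extChartAt 𝓘(ℝ, E) x₀ (μ σ')) (extChartAt 𝓘(ℝ, E) x₀ (μ σ)) < ε := by
      intro σ σ' h1 h2 h3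
      rw [dist_eq_norm]
      refine (hmono σ σ' h1 h2 (h3.le.trans hs.2)).trans_lt ?_
      have h4 : sInf S ≤ g.chartClock x₀ (μ σ) :=
        csInf_le hbdd ⟨σ, ⟨h1, (h2.trans h3.le).trans hs.2⟩, rfl⟩
      have h5 := (norm_nonneg _).trans (hmono σ' s (h1.trans_le h2) h3.le hs.2)
      have h6 := nonneg_of_mul_nonneg_right h5 hA
      have h7 : A * (g.chartClock x₀ (μ σ') - g.chartClock x₀ (μ σ)) < A * (ε / A) :=
        mul_lt_mul_of_pos_left (by simp only at hlt; linarith) hA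
      rwa [mul_div_cancel₀ _ hA.ne'] at h7
    refine ⟨_, image_mem_map (Ioo_mem_nhdsGT hs.1), ?_⟩
    rintro _ ⟨σ, hσ, rfl⟩ _ ⟨σ', hσ', rfl⟩
    rcases le_total σ σ' with h1 | h1
    · rw [dist_comm]; exact key σ σ' hσ.1 h1 hσ'.2
    · exact key σ' σ hσ'.1 h1 hσ.2
  have : CompleteSpace E := FiniteDimensional.complete ℝ E
  obtain ⟨y, hy⟩ := cauchy_map_iff_exists_tendsto.1 hcauchy
  have hev : ∀ᶠ s in 𝓝[>] α, μ s ∈ chartDisk E x₀ (ρ / 2) := by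
    filter_upwards [Ioo_mem_nhdsGT hατ] with s hs using hd s ⟨hs.1, hs.2.le⟩
  have hyt : y ∈ (extChartAt 𝓘(ℝ, E) x₀).target := by
    refine hP.subset (Metric.closedBall_subset_ball (half_lt_self hP.pos) ?_)
    exact Metric.isClosed_closedBall.mem_of_tendsto hy (hev.mono fun s hs => hs.2)
  refine ⟨(extChartAt 𝓘(ℝ, E) x₀).symm y, ?_⟩
  refine ((continuousAt_extChartAt_symm'' hyt).tendsto.comp hy).congr' ?_
  exact hev.mono fun s hs => (extChartAt 𝓘(ℝ, E) x₀).left_inv hs.1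

/-- Going back along a timelike curve without past end point, one leaves every chart ball. -/
theorem IsFutureOn.exists_exit [T2Space M] {μ : ℝ → M} {α β : ℝ} {x₀ : M} {A ρ : ℝ}
    (hP : g.ChartBounds x₀ A ρ) (h : g.IsFutureOn μ α β)
    (hend : ¬ ∃ p, Tendsto μ (𝓝[>] α) (𝓝 p)) {τ : ℝ} (hτ : τ ∈ Ioc α β)
    (hx : μ τ ∈ chartBall E x₀ (ρ / 4)) :
    ∃ s, α < s ∧ s < τ ∧ (∀ σ ∈ Icc s τ, μ σ ∈ chartDisk E x₀ (ρ / 2)) ∧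
      ρ / 4 ≤ ‖extChartAt 𝓘(ℝ, E) x₀ (μ τ) - extChartAt 𝓘(ℝ, E) x₀ (μ s)‖ := by
  have hρ := hP.pos
  obtain ⟨s₁, hs₁, hs₁'⟩ : ∃ s ∈ Ioc α τ, μ s ∉ chartDisk E x₀ (ρ / 2) := by
    by_contra! hcon
    exact hend (IsFutureOn.exists_tendsto_of_chartDisk hP
      (fun s t h1 h2 h3 => h s t h1 h2 (h3.trans hτ.2)) hτ.1 hcon)
  have hcont := h.continuousOn hs₁.1 hτ.2
  have hcomp : IsCompact (Icc s₁ τ ∩ μ ⁻¹' (chartBall E x₀ (ρ / 2))ᶜ) :=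
    isCompact_Icc.of_isClosed_subset
      (hcont.preimage_isClosed_of_isClosed isClosed_Icc (isOpen_chartBall x₀ _).isClosed_compl)
      inter_subset_left
  have hsub : chartBall E x₀ (ρ / 2) ⊆ chartDisk E x₀ (ρ / 2) := fun p hp =>
    ⟨hp.1, Metric.ball_subset_closedBall hp.2⟩
  obtain ⟨s, ⟨hs1, hs2⟩, hs3⟩ := hcomp.exists_isGreatest
    ⟨s₁, left_mem_Icc.2 hs₁.2, fun hcon => hs₁' (hsub hcon)⟩
  have hx2 : μ τ ∈ chartBall E x₀ (ρ / 2) := ⟨hx.1, Metric.ball_subset_ball (by linarith) hx.2⟩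
  have hsτ : s < τ := lt_of_le_of_ne hs1.2 fun e => hs2 (by rw [e]; exact hx2)
  have hin : ∀ σ ∈ Ioc s τ, μ σ ∈ chartDisk E x₀ (ρ / 2) := by
    intro σ hσ
    by_contra hcon
    exact absurd (hs3 ⟨⟨hs1.1.trans hσ.1.le, hσ.2⟩, fun h => hcon (hsub h)⟩) hσ.1.not_ge
  have hsd : μ s ∈ chartDisk E x₀ (ρ / 2) := by
    have h1 : ContinuousWithinAt μ (Ioc s τ) s :=
      (hcont s hs1).mono (Ioc_subset_Icc_self.trans (Icc_subset_Icc hs1.1 le_rfl))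
    have : (𝓝[Ioc s τ] s).NeBot := by rw [nhdsWithin_Ioc_eq_nhdsGT hsτ]; infer_instance
    exact hP.isCompact_chartDisk.isClosed.mem_of_tendsto h1.tendsto
      (eventually_mem_nhdsWithin.mono hin)
  refine ⟨s, hs₁.1.trans_le hs1.1, hsτ, fun σ hσ => ?_, ?_⟩
  · rcases hσ.1.eq_or_lt with rfl | h1
    · exact hsd
    · exact hin σ ⟨h1, hσ.2⟩
  · have h1 : ρ / 2 ≤ ‖extChartAt 𝓘(ℝ, E) x₀ (μ s) - extChartAt 𝓘(ℝ, E) x₀ x₀‖ := by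
      by_contra! hcon
      exact hs2 ⟨hsd.1, mem_ball_iff_norm.2 hcon⟩
    have h2 := mem_ball_iff_norm.1 hx.2
    have h3 := norm_sub_le (extChartAt 𝓘(ℝ, E) x₀ (μ τ) - extChartAt 𝓘(ℝ, E) x₀ x₀)
      (extChartAt 𝓘(ℝ, E) x₀ (μ τ) - extChartAt 𝓘(ℝ, E) x₀ (μ s))
    rw [sub_sub_sub_cancel_left] at h3
    linarith

/-- A timelike curve without past end point, in a set covered by finitely many chart balls, can be
cut into infinitely many segments, each of a definite size in one of these charts. -/
theorem IsFutureOn.exists_segments [T2Space M] {μ : ℝ → M} {α β : ℝ} {A ρ : M → ℝ}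
    (hP : ∀ x, g.ChartBounds x (A x) (ρ x)) (h : g.IsFutureOn μ α β)
    (hend : ¬ ∃ p, Tendsto μ (𝓝[>] α) (𝓝 p)) (I : Finset M)
    (hI : ∀ t ∈ Ioc α β, ∃ x ∈ I, μ t ∈ chartBall E x (ρ x / 4)) {t₁ : ℝ} (ht₁ : t₁ ∈ Ioc α β) :
    ∃ (τ : ℕ → ℝ) (x : ℕ → M), τ 0 = t₁ ∧ ∀ n, τ n ∈ Ioc α β ∧ x n ∈ I ∧
      μ (τ n) ∈ chartDisk E (x n) (ρ (x n) / 2) ∧ τ (n + 1) < τ n ∧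
      (∀ σ ∈ Icc (τ (n + 1)) (τ n), μ σ ∈ chartDisk E (x n) (ρ (x n) / 2)) ∧
      ρ (x n) / 4 ≤ ‖extChartAt 𝓘(ℝ, E) (x n) (μ (τ n)) -
        extChartAt 𝓘(ℝ, E) (x n) (μ (τ (n + 1)))‖ := by
  have step : ∀ q : {q : ℝ × M // q.1 ∈ Ioc α β ∧ q.2 ∈ I ∧ μ q.1 ∈ chartBall E q.2 (ρ q.2 / 4)},
      ∃ q' : {q : ℝ × M // q.1 ∈ Ioc α β ∧ q.2 ∈ I ∧ μ q.1 ∈ chartBall E q.2 (ρ q.2 / 4)},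
      q'.1.1 < q.1.1 ∧ (∀ σ ∈ Icc q'.1.1 q.1.1, μ σ ∈ chartDisk E q.1.2 (ρ q.1.2 / 2)) ∧
      ρ q.1.2 / 4 ≤ ‖extChartAt 𝓘(ℝ, E) q.1.2 (μ q.1.1) - extChartAt 𝓘(ℝ, E) q.1.2 (μ q'.1.1)‖ := by
    rintro ⟨⟨τ, x⟩, h1, h2, h3⟩
    obtain ⟨s, hs1, hs2, hs3, hs4⟩ := h.exists_exit (hP x) hend h1 h3
    have hs : s ∈ Ioc α β := ⟨hs1, hs2.le.trans h1.2⟩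
    obtain ⟨x', hx', hx''⟩ := hI s hs
    exact ⟨⟨(s, x'), hs, hx', hx''⟩, hs2, hs3, hs4⟩
  choose f hf using step
  obtain ⟨x, hx, hx'⟩ := hI t₁ ht₁
  set Q := fun n => f^[n] ⟨(t₁, x), ht₁, hx, hx'⟩ with hQ
  have hQ1 : ∀ n, Q (n + 1) = f (Q n) := fun n => Function.iterate_succ_apply' _ _ _
  refine ⟨fun n => (Q n).1.1, fun n => (Q n).1.2, rfl, fun n => ?_⟩
  have h1 := (Q n).2
  have h2 := hf (Q n)
  rw [← hQ1] at h2
  have hρ := (hP (Q n).1.2).pos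
  exact ⟨h1.1, h1.2.1, ⟨h1.2.2.1, Metric.ball_subset_closedBall
    (Metric.ball_subset_ball (by linarith) h1.2.2.2)⟩, h2⟩

end TimeOrientedMetric

/-! ### Infinite distance near an imprisoned curve -/

namespace TimeOrientedMetric

variable {E : Type*} [NormedAddCommGroup E] [NormedSpace ℝ E]
  {M : Type*} [TopologicalSpace M] [ChartedSpace E M]
  [IsManifold 𝓘(ℝ, E) ∞ M] {g : TimeOrientedMetric E M}

/-- Concatenating `N` consecutive steps of the push. The solution `r` of the recursion keeps its
sign, so the whole curve is pushed to the same side. -/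
theorem reaches_of_steps {P : ℕ → ℝ → M} {e r : ℕ → ℝ} {L C C₀ R : ℝ} (hL : 0 < L) (hR : 0 < R)
    (hstep : ∀ n, ∀ C r : ℝ, C₀ ≤ C → R ≤ |r| → R ≤ |r / e n - C| → 0 < r * (r / e n - C) →
      g.Reaches (P (n + 1) (1 / r)) (P n (1 / (r / e n - C))) (1 / (L * |r|)))
    (hC : C₀ ≤ C) (hrec : ∀ n, r n = r (n + 1) / e n - C) {w : M}
    (hw : w ∈ g.future (P 0 (1 / r 0))) {N : ℕ}
    (hr : (∀ n ≤ N, R ≤ r n) ∨ ∀ n ≤ N, r n ≤ -R) :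
    g.Reaches (P N (1 / r N)) w (∑ n ∈ Finset.range N, 1 / (L * |r (n + 1)|)) := by
  induction N with
  | zero => simpa using g.reaches_zero hw
  | succ N ih =>
    have h1 := ih (hr.imp (fun h n hn => h n (by omega)) fun h n hn => h n (by omega))
    have h2 := hstep N C (r (N + 1)) hC (by
      rcases hr with h | h
      · exact (h _ le_rfl).trans (le_abs_self _)
      · exact le_trans (by linarith [h (N + 1) le_rfl]) (neg_le_abs _)) (by
      rw [← hrec]
      rcases hr with h | h
      · exact (h _ (by omega)).trans (le_abs_self _)
      · exact le_trans (by linarith [h N (by omega)]) (neg_le_abs _)) (by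
      rw [← hrec]
      rcases hr with h | h
      · exact mul_pos (hR.trans_le (h _ le_rfl)) (hR.trans_le (h _ (by omega)))
      · exact mul_pos_of_neg_of_neg (by linarith [h (N + 1) le_rfl])
          (by linarith [h N (by omega)]))
    rw [← hrec] at h2
    rw [Finset.sum_range_succ, add_comm (∑ n ∈ Finset.range N, _)]
    exact h2.trans h1 (by positivity) (Finset.sum_nonneg fun n _ => by positivity)

variable [FiniteDimensional ℝ E]

/-- A timelike curve without past end point that stays in a compact set has a limit point `p` such
that every point in the chronological past of `p` has infinite distance to every point in the
chronological future of a given point of the curve. The curve is cut into segments of a definite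
size, which are pushed along the time field, to the past or to the future according to whether or
not the products `invProd e` are summable; the pushed curve is longer than any given number. -/
theorem IsFutureOn.exists_lorentzianDist_eq_top [T2Space M] {μ : ℝ → M} {α β : ℝ}
    (h : g.IsFutureOn μ α β) (hend : ¬ ∃ p, Tendsto μ (𝓝[>] α) (𝓝 p)) {K : Set M}
    (hK : IsCompact K) (hμK : μ '' Ioc α β ⊆ K) {t₁ : ℝ} (ht₁ : t₁ ∈ Ioc α β) :
    ∃ p ∈ closure (μ '' Ioc α β), ∀ u ∈ g.past p, ∀ v ∈ g.future (μ t₁),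
      g.lorentzianDist u v = ⊤ := by
  choose A ρ hP using exists_chartBounds g
  obtain ⟨I, -, hI⟩ := hK.elim_nhds_subcover (fun x => chartBall E x (ρ x / 4)) fun x _ =>
    (isOpen_chartBall x _).mem_nhds ⟨mem_extChartAt_source x,
      Metric.mem_ball_self (by linarith [(hP x).pos])⟩
  obtain ⟨τ, x, hτ0, hτ⟩ := h.exists_segments hP hend I (fun t ht => by
    simpa using hI (hμK (mem_image_of_mem μ ht))) ht₁
  obtain ⟨L, C₀, R, hL, hC₀, hR, hpush, hstep⟩ := exists_uniform_reaches I hP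
  have hL0 : 0 < L := by linarith
  have hseg : ∀ n, ∃ e : ℝ, 1 / L ≤ e ∧ e ≤ L ∧ ∀ C r : ℝ, C₀ ≤ C → R ≤ |r| → R ≤ |r / e - C| →
      0 < r * (r / e - C) → g.Reaches (g.push (x (n + 1)) (μ (τ (n + 1))) (1 / r))
        (g.push (x n) (μ (τ n)) (1 / (r / e - C))) (1 / (L * |r|)) := by
    intro n
    obtain ⟨h1, h2, h3, h4, h5, h6⟩ := hτ n
    obtain ⟨k1, k2, k3, -⟩ := hτ (n + 1)
    exact hstep (x n) h2 (x (n + 1)) k2 μ _ _ (h _ _ k1.1 h4 h1.2) h5 h6 k3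
  choose e he1 he2 he using hseg
  set P : ℕ → ℝ → M := fun n h => g.push (x n) (μ (τ n)) h with hPdef
  have hsrc : ∀ n, μ (τ n) ∈ (extChartAt 𝓘(ℝ, E) (x n)).source := fun n => (hτ n).2.2.1.1
  have hP0 : ∀ n, P n 0 = μ (τ n) := fun n => g.push_zero (x n) (hsrc n)
  have hPlt : ∀ n h h', |h| ≤ 1 / R → |h'| ≤ 1 / R → h < h' → P n h' ∈ g.future (P n h) :=
    fun n h h' => hpush (x n) (hτ n).2.1 _ (hτ n).2.2.1 h h'
  have habs0 : |(0 : ℝ)| ≤ 1 / R := by rw [abs_zero]; positivity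
  have habs : ∀ r : ℝ, R ≤ |r| → |1 / r| ≤ 1 / R := fun r hr => by
    rw [abs_div, abs_one]; exact one_div_le_one_div_of_le hR hr
  -- the point `p` is a limit point of the cutting points of the curve
  obtain ⟨p, -, hp⟩ := hK.exists_mapClusterPt (f := atTop) (u := fun n => μ (τ n))
    (tendsto_principal.2 (Eventually.of_forall fun n => hμK (mem_image_of_mem μ (hτ n).1)))
  have hfreq := mapClusterPt_iff_frequently.1 hp
  refine ⟨p, ?_, fun u hu v hv => ENNReal.eq_top_of_forall_nnreal_le fun D => ?_⟩
  · refine mem_closure_iff_nhds.2 fun V hV => ?_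
    obtain ⟨n, hn⟩ := (hfreq V hV).exists
    exact ⟨_, hn, mem_image_of_mem μ (hτ n).1⟩
  suffices hD : g.Reaches u v D by simpa using hD.2
  have hu' : g.future u ∈ 𝓝 p := (g.isOpen_future u).mem_nhds hu
  rw [← hτ0] at hv
  by_cases hS : Summable (invProd e)
  · -- the products tend to zero: push to the past, by a fixed amount at a point close to `p`
    have h1 : ∀ᶠ z : ℝ × M in 𝓝 (0, p), ∀ y ∈ I, z.2 ∈ chartDisk E y (ρ y / 2) →
        g.push y z.2 z.1 ∈ g.future u := by
      refine (eventually_all_finset I).2 fun y _ => ?_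
      by_cases hy : p ∈ chartDisk E y (ρ y / 2)
      · have h2 := continuousAt_push g y hy.1
        have h3 : ContinuousAt (fun z : ℝ × M => g.push y z.2 z.1) (0, p) :=
          ContinuousAt.comp (f := Prod.swap) (x := ((0 : ℝ), p)) h2 continuous_swap.continuousAt
        have h4 := h3.eventually_mem (s := g.future u) (by
          simp only [g.push_zero y hy.1]; exact hu')
        exact h4.mono fun z hz _ => hz
      · have h2 : ∀ᶠ z : ℝ × M in 𝓝 (0, p), z.2 ∉ chartDisk E y (ρ y / 2) :=
          (continuousAt_snd (p := ((0 : ℝ), p))).eventually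
            (IsOpen.mem_nhds (x := p) (hP y).isCompact_chartDisk.isClosed.isOpen_compl hy)
        exact h2.mono fun z hz hz' => absurd hz' hz
    have h2 : Tendsto (fun r : ℝ => 1 / -r) atTop (𝓝 0) :=
      tendsto_const_nhds.div_atBot tendsto_neg_atTop_atBot
    obtain ⟨r₀, hr₀, hr₀R⟩ := ((h2.eventually h1.curry_nhds).and (eventually_ge_atTop R)).exists
    have hC : R ≤ max C₀ R := le_max_right _ _
    have h3 := eventually_exists_recursion_neg hL hR he1 he2 hC hr₀R hS.tendsto_atTop_zero (D : ℝ)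
    obtain ⟨N, hN, r, hrN, hrec, hr, hD⟩ := ((hfreq _ hr₀).and_eventually h3).exists
    have h4 : P N (1 / r N) ∈ g.future u := by
      rw [hrN]; exact hN (x N) (hτ N).2.1 (hτ N).2.2.1
    have hr0 := hr 0 (Nat.zero_le _)
    have h5 : v ∈ g.future (P 0 (1 / r 0)) := by
      refine g.future_trans ?_ hv
      rw [← hP0 0]
      exact hPlt 0 _ _ (habs _ (le_trans (by linarith) (neg_le_abs _))) habs0
        (one_div_neg.2 (by linarith))
    have h6 := reaches_of_steps hL0 hR he (le_max_left _ _) hrec h5 (Or.inr hr)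
    have h7 := (g.reaches_zero h4).trans h6 le_rfl
      (Finset.sum_nonneg fun n _ => by positivity)
    rw [zero_add] at h7
    exact h7.mono hD
  · -- the products are not summable: push to the future, by a fixed amount at the future end point
    have h2 : Tendsto (fun r : ℝ => P 0 (1 / r)) atTop (𝓝 (μ (τ 0))) := by
      have h3 : Tendsto (fun r : ℝ => (μ (τ 0), 1 / r)) atTop (𝓝 (μ (τ 0), 0)) :=
        tendsto_const_nhds.prodMk_nhds (tendsto_const_nhds.div_atTop tendsto_id)
      have h4 := (continuousAt_push g (x 0) (hsrc 0)).tendsto.comp h3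
      rwa [g.push_zero (x 0) (hsrc 0)] at h4
    obtain ⟨r₀, hr₀, hr₀R⟩ := ((h2.eventually_mem ((g.isOpen_past v).mem_nhds hv)).and
      (eventually_ge_atTop R)).exists
    obtain ⟨r, hr0, hrec, hr, hlim⟩ := exists_recursion_pos hL hR he1 he2
      (le_max_right C₀ (L * R)) hr₀R hS
    obtain ⟨N, hN, hD⟩ := ((hfreq _ hu').and_eventually
      (hlim.eventually_ge_atTop (D : ℝ))).exists
    have h4 : P N (1 / r N) ∈ g.future u := by
      refine g.future_trans hN ?_
      rw [← hP0 N]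
      exact hPlt N _ _ habs0 (habs _ ((hr N).trans (le_abs_self _)))
        (one_div_pos.2 (hR.trans_le (hr N)))
    have h6 := reaches_of_steps hL0 hR he (le_max_left _ _) hrec (by rw [hr0]; exact hr₀)
      (Or.inl fun n (_ : n ≤ N) => hr n)
    have h7 := (g.reaches_zero h4).trans h6 le_rfl
      (Finset.sum_nonneg fun n _ => by positivity)
    rw [zero_add] at h7
    exact h7.mono hD

end TimeOrientedMetric

/-! ### Discontinuity of the distance -/

namespace TimeOrientedMetric

variable {E : Type*} [NormedAddCommGroup E] [NormedSpace ℝ E]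
  {M : Type*} [TopologicalSpace M] [ChartedSpace E M]
  [IsManifold 𝓘(ℝ, E) ∞ M] {g : TimeOrientedMetric E M} [FiniteDimensional ℝ E]

variable (g) in
/-- A function that is infinite on `I⁻(x) × I⁺(y)` but finite at `(x, y)` is not continuous, since
`(x, y)` lies in the closure of that set. -/
theorem not_continuous_of_eq_top {f : M × M → ℝ≥0∞} {x y : M}
    (h : ∀ u ∈ g.past x, ∀ v ∈ g.future y, f (u, v) = ⊤) (hxy : f (x, y) ≠ ⊤) :
    ¬ Continuous f := by
  intro hf
  have h1 : (x, y) ∈ closure (g.past x ×ˢ g.future y) := by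
    rw [closure_prod_eq]
    exact ⟨(g.mem_closure_future x).2, (g.mem_closure_future y).1⟩
  obtain ⟨z, hz, hz'⟩ := mem_closure_iff_nhds.1 h1 _
    (hf.continuousAt.eventually_lt_const hxy.lt_top)
  exact absurd (h z.1 hz'.1 z.2 hz'.2) (ne_of_lt hz)

/-- Along a closed timelike curve one can go round arbitrarily often. -/
theorem lorentzianDist_eq_top_of_mem_future {u v : M} (hu : u ∈ g.future u)
    (hv : v ∈ g.future u) : g.lorentzianDist u v = ⊤ := by
  by_contra h
  have h1 := g.lorentzianDist_add_le hu hv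
  exact absurd h1 (not_le.2
    (ENNReal.lt_add_right h (g.lorentzianDist_pos hu).ne' |>.trans_eq (add_comm _ _)))

/-- If the conformal factor is `1` off the chronological future `F` of a set and the distance from
`u` is infinite on `F`, then it is discontinuous at the point where a curve from `u` enters `F`. -/
theorem not_continuous_conformal {S : Set M} {Ω : M → ℝ} (hΩ : ContMDiff 𝓘(ℝ, E) 𝓘(ℝ, ℝ) ∞ Ω)
    (hpos : ∀ p, 0 < Ω p) (hone : ∀ p ∉ g.futureSet S, Ω p = 1) {u v : M}
    (hu : u ∉ g.futureSet S) (hv : v ∈ g.futureSet S) (huv : v ∈ g.future u)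
    (hd : g.lorentzianDist u v < ⊤)
    (htop : ∀ w ∈ g.futureSet S, (g.conformal Ω hΩ hpos).lorentzianDist u w = ⊤) :
    ¬ Continuous (fun z : M × M => (g.conformal Ω hΩ hpos).lorentzianDist z.1 z.2) := by
  intro hcont
  obtain ⟨γ, a, b, hγ, rfl, rfl⟩ := huv
  have hγc := hγ.continuousOn
  have hcomp : IsCompact (Icc a b ∩ γ ⁻¹' (g.futureSet S)ᶜ) :=
    isCompact_Icc.of_isClosed_subset
      (hγc.preimage_isClosed_of_isClosed isClosed_Icc (g.isOpen_futureSet S).isClosed_compl)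
      inter_subset_left
  obtain ⟨s, ⟨hs1, hs2⟩, hs3⟩ := hcomp.exists_isGreatest ⟨a, left_mem_Icc.2 hγ.lt.le, hu⟩
  have hsb : s < b := lt_of_le_of_ne hs1.2 fun e => hs2 (by rw [e]; exact hv)
  have hin : ∀ t ∈ Ioc s b, γ t ∈ g.futureSet S := by
    intro t ht
    by_contra hcon
    exact absurd (hs3 ⟨⟨hs1.1.trans ht.1.le, ht.2⟩, hcon⟩) ht.1.not_ge
  have hfut : ∀ p ∈ g.futureSet S, ∀ q ∈ g.future p, q ∈ g.futureSet S := by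
    intro p hp q hq
    obtain ⟨r, hr, hpr⟩ := mem_iUnion₂.1 hp
    exact mem_iUnion₂.2 ⟨r, hr, g.future_trans hpr hq⟩
  -- curves ending at `γ s` do not meet the future set, so that the conformal factor is `1` there
  have hle : (g.conformal Ω hΩ hpos).lorentzianDist (γ a) (γ s) ≤ g.lorentzianDist (γ a) (γ b) := by
    refine iSup_le fun c => iSup_le fun t₁ => iSup_le fun t₂ => iSup_le fun hc => ?_
    rw [conformal_isTimelikeCurve] at hc
    rw [length_conformal_eq g Ω hΩ hpos fun t ht => hone _ fun hcon => hs2 <| by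
      refine hfut _ hcon (γ s) ?_
      exact ⟨c, t, t₂, hc.1.restrict ht.1.le ht.2 le_rfl, rfl, hc.2.2⟩]
    have h1 := g.lorentzianDist_add_le ⟨c, t₁, t₂, hc⟩
      ⟨γ, s, b, hγ.restrict hs1.1 hsb le_rfl, rfl, rfl⟩
    exact ((g.le_lorentzianDist hc).trans le_self_add).trans h1
  have h1 : ContinuousWithinAt γ (Ioc s b) s :=
    (hγc s hs1).mono (Ioc_subset_Icc_self.trans (Icc_subset_Icc hs1.1 le_rfl))
  have h2 := Continuous.uncurry_left
    (f := fun p q => (g.conformal Ω hΩ hpos).lorentzianDist p q) (γ a) hcont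
  have h3 := (h2.continuousAt.comp_continuousWithinAt h1).eventually_lt_const (hle.trans_lt hd)
  have : (𝓝[Ioc s b] s).NeBot := by rw [nhdsWithin_Ioc_eq_nhdsGT hsb]; infer_instance
  obtain ⟨t, ht, ht'⟩ := (h3.and eventually_mem_nhdsWithin).exists
  exact ht.ne (htop _ (hin t ht'))

omit [FiniteDimensional ℝ E] in
variable (g) in
theorem IsPastInextendible.not_tendsto {l : ℝ → M} {a b : ℝ} (h : g.IsPastInextendible l a b) :
    ¬ ∃ p, Tendsto (fun t => l (-t)) (𝓝[>] (-b)) (𝓝 p) := by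
  rintro ⟨p, hp⟩
  refine h.2.2 ⟨p, ?_⟩
  have := hp.comp (tendsto_neg_nhdsLT (a := b))
  simpa [Function.comp_def] using this

end TimeOrientedMetric

theorem mainTheorem6 {E : Type*} [NormedAddCommGroup E] [NormedSpace ℝ E] [FiniteDimensional ℝ E]
    {M : Type*} [TopologicalSpace M] [ChartedSpace E M] [IsManifold 𝓘(ℝ, E) ∞ M]
    [T2Space M] [ParacompactSpace M]
    (g : TimeOrientedMetric E M) (x y : M) (l : ℝ → M) (a b : ℝ)
    (hl : g.IsPastInextendible l a b)
    (hpast : ∀ u ∈ g.past x, l '' Ico a b ⊆ g.future u)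
    (hfuture : g.future y ⊆ g.futureSet (l '' Ico a b)) :
    g.IsConformallyInfinite ∧
      (((∃ u ∈ g.past x, ∃ v ∈ g.future y, g.lorentzianDist u v < ⊤) ∨
          g.lorentzianDist x y = 0) →
        g.IsConformallyDiscontinuous) := by
  have hμ := hl.isFutureOn
  have hend := TimeOrientedMetric.IsPastInextendible.not_tendsto g hl
  have himg : (fun t => l (-t)) '' Ioc (-b) (-a) = l '' Ico a b := by
    rw [← image_image l (fun t => -t), image_neg_eq_neg, neg_Ioc, neg_neg, neg_neg]
  obtain ⟨u₀, hu₀⟩ := closure_nonempty_iff.1 ⟨x, (g.mem_closure_future x).2⟩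
  obtain ⟨v₀, hv₀⟩ := closure_nonempty_iff.1 ⟨y, (g.mem_closure_future y).1⟩
  by_cases hK : ∃ K, IsCompact K ∧ l '' Ico a b ⊆ K
  · -- an imprisoned curve: the distance of `g` itself is infinite
    obtain ⟨K, hK, hlK⟩ := hK
    rw [← himg] at hlK
    have key : ∀ v ∈ g.future y, ∃ p ∈ closure (l '' Ico a b), ∀ u ∈ g.past p,
        g.lorentzianDist u v = ⊤ := by
      intro v hv
      obtain ⟨q, hq, hqv⟩ := mem_iUnion₂.1 (hfuture hv)
      rw [← himg] at hq ⊢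
      obtain ⟨t, ht, rfl⟩ := hq
      obtain ⟨p, hp, h⟩ := hμ.exists_lorentzianDist_eq_top hend hK hlK ht
      exact ⟨p, hp, fun u hu => h u hu v hqv⟩
    refine ⟨?_, fun hyp => ⟨fun _ => 1, contMDiff_const, fun _ => one_pos, ?_⟩⟩
    · obtain ⟨p, -, hp⟩ := key v₀ hv₀
      obtain ⟨u, hu⟩ := closure_nonempty_iff.1 ⟨p, (g.mem_closure_future p).2⟩
      refine ⟨fun _ => 1, contMDiff_const, fun _ => one_pos, u, v₀, ?_⟩
      rw [g.lorentzianDist_conformal_one]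
      exact hp u hu
    rw [g.lorentzianDist_conformal_one]
    by_cases hall : ∀ u ∈ g.past x, ∀ v ∈ g.future y, g.lorentzianDist u v = ⊤
    · rcases hyp with ⟨u, hu, v, hv, hd⟩ | hd
      · exact absurd (hall u hu v hv) hd.ne
      · exact g.not_continuous_of_eq_top hall (by simp [hd])
    · push Not at hall
      obtain ⟨u, hu, v, hv, hd⟩ := hall
      obtain ⟨p, hp, hpv⟩ := key v hv
      -- `d(u, ·)` vanishes at `p`, a limit of points of the curve, on which it is bounded below by
      -- the distance from `u` to a point of `I⁻(x)` in its future
      have hup : g.lorentzianDist u p = 0 :=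
        g.lorentzianDist_eq_zero_of_notMem fun h => hd (hpv u h)
      obtain ⟨u', hu', hu'x⟩ := mem_closure_iff_nhds.1 (g.mem_closure_future x).2 _
        ((g.isOpen_future u).mem_nhds hu)
      have hpos := g.lorentzianDist_pos hu'
      intro hcont
      have h2 := Continuous.uncurry_left (f := fun p q => g.lorentzianDist p q) u hcont
      obtain ⟨q, hq, hq'⟩ := mem_closure_iff_nhds.1 hp _
        (h2.continuousAt.eventually_lt_const (hup.trans_lt hpos))
      exact absurd hq (not_lt.2 (le_self_add.trans
        (g.lorentzianDist_add_le hu' (hpast u' hu'x hq'))))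
  · push Not at hK
    -- the curve is not contained in a compact set: a conformal factor makes it infinitely long
    obtain ⟨Ω, hΩ, hpos, hone, htop⟩ := hμ.exists_conformal (g := g) (by rwa [himg])
    rw [himg] at hone htop
    refine ⟨⟨Ω, hΩ, hpos, u₀, v₀, htop u₀ (hpast u₀ hu₀) v₀ (hfuture hv₀)⟩,
      fun hyp => ⟨Ω, hΩ, hpos, ?_⟩⟩
    rcases hyp with ⟨u, hu, v, hv, hd⟩ | hd
    · obtain ⟨q, hq, hqv⟩ := mem_iUnion₂.1 (hfuture hv)
      have huv : v ∈ g.future u := g.future_trans (hpast u hu hq) hqv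
      refine TimeOrientedMetric.not_continuous_conformal hΩ hpos hone (fun hcon => ?_) (hfuture hv)
        huv hd (htop u (hpast u hu))
      obtain ⟨q', hq', hq'u⟩ := mem_iUnion₂.1 hcon
      -- if `u` were in the future of the curve, there would be a closed timelike curve through `u`,
      -- and `d(u, v)` would be infinite
      exact hd.ne (TimeOrientedMetric.lorentzianDist_eq_top_of_mem_future
        (g.future_trans (hpast u hu hq') hq'u) huv)
    · refine g.not_continuous_of_eq_top (x := x) (y := y)
        (fun u hu v hv => htop u (hpast u hu) v (hfuture hv)) ?_
      have h1 : (g.conformal Ω hΩ hpos).lorentzianDist x y = 0 := by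
        refine (g.conformal Ω hΩ hpos).lorentzianDist_eq_zero_of_notMem ?_
        rw [g.conformal_future]
        exact g.lorentzianDist_eq_zero_iff.1 hd
      simp [h1]
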